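/- Let $d\in\mathbb N$, $1\le p,q\le\infty$. Let $w$ be a weight on $\mathbb R^d$ (positive, locally integrable) such that, for some constants $c_w>0$ and $C_w$, $w(x)\le C_w\,w(x-y)\,e^{c_w|y|_1}$ for all $x,y\in\mathbb R^d$, where $|y|_1=\sum_i|y_i|$. Let $\delta$ be a norm on $\mathbb R^d$ and $L\in\mathbb N_0$ with $\delta(\bar j)<L|\bar j|_1$ for all $\bar j\in\mathbb N_0^d\setminus\{\bar 0\}$. Let $b,b'>0$ with $c_w/p<b'<b$ (where $c_w/\infty=0$). For $n\in\mathbb N_0$ let $X_b^{n}(\mathbb R^d)$ be the space of functions $\varphi:\mathbb R^d\to\mathbb C$ whose weak derivatives $D^{\bar\alpha}\varphi$, $\bar\alpha\in\{0,\dots,n\}^d$, exist and satisfy $$\sum_{\bar\alpha\in\{0,\dots,n\}^d}\ \sum_{\bar\beta\in\{0,\dots,n\}^d}\big\|e^{b|x|_1}x^{\bar\beta}D^{\bar\alpha}\varphi\big\|_{L^2(\mathbb R^d)}<\infty ,$$ normed by this sum, and let $X_b^{n}(\mathbb R^d)'$ be its topological dual. For $f\in X_b^{n}(\mathbb R^d)'$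 and $g\in X_b^{n}(\mathbb R^d)$ put $g*f(x)=\langle f,g(x-\cdot)\rangle$. For $i=1,\dots,d$ let $\psi_0^i,\psi^i,\varphi_0^i\in X_b^{L+1}(\mathbb R)$ and $\varphi^i:=\varphi_0^i-2^{-1}\varphi_0^i(2^{-1}\,\cdot)$, and suppose that $\int_{\mathbb R}\varphi_0^i*\varphi_0^i(x)\,dx=1$ and that $(D^s\widehat{\psi^i})(0)=(D^s\widehat{\varphi^i})(0)=0$ for $s=0,1,\dots,L$. Put $\psi^i_j(t)=2^j\psi^i(2^jt)$ and $\varphi^i_j(t)=2^j\varphi^i(2^jt)$ for $j\ge1$ (the members with index $j=0$ being $\psi_0^i,\varphi_0^i$), and for $\bar j\in\mathbb N_0^d$ $$\boldsymbol\psi_{\bar j}(x)=\prod_{i=1}^d\psi^i_{j_i}(x_i),\qquad \boldsymbol\varphi_{\bar j}(x)=\prod_{i=1}^d\varphi^i_{j_i}(x_i),\qquad \boldsymbol\psi^*_{\bar j,b'}f(x)=\sup_{y\in\mathbb R^d}\frac{|\boldsymbol\psi_{\bar j}*f(x-y)|}{\prod_{i=1}^d e^{2^{j_i}b'|y_i|}}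 .$$ Then there is a constant $C$, independent of $f$, such that for every $f\in X_b^{L+1}(\mathbb R^d)'$ $$\Big(\sum_{\bar j\in\mathbb N_0^d}2^{q\delta(\bar j)}\big\|\boldsymbol\psi^*_{\bar j,b'}f\big\|_{L^p_w}^q\Big)^{1/q}\le C\,\Big(\sum_{\bar j\in\mathbb N_0^d}2^{q\delta(\bar j)}\big\|\boldsymbol\varphi_{\bar j}*f\big\|_{L^p_w}^q\Big)^{1/q}$$ (as an inequality in $[0,\infty]$). Here $\|F\|_{L^p_w}=(\int|F|^pw\,dx)^{1/p}$, the essential supremum of $|F|$ if $p=\infty$, and the $\ell^q$-sums are suprema if $q=\infty$. In particular this holds for every $f$ in the weighted Besov space $VB^{\delta,w}_{p,q}(\mathbb R^d)$, which consists of the $f$ for which the right-hand side is finite. -/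

import Mathlib

open MeasureTheory
open scoped ENNReal NNReal ContDiff FourierTransform

namespace ExpBesov

noncomputable section

/-- The norm `|x|₁ = ∑ |x_i|` on `ℝ^d`. -/
def l1Norm {d : ℕ} (x : Fin d → ℝ) : ℝ := ∑ i, |x i|

/-- A multi-index of natural numbers seen as a vector of `ℝ^d`. -/
def toReal {d : ℕ} (j : Fin d → ℕ) : Fin d → ℝ := fun i => (j i : ℝ)

/-! ### Weak derivatives and the test function spaces `X_b^s(ℝ^d)` -/

/-- The classical partial derivative `∂_i t`. -/
def partialD {d : ℕ} (i : Fin d) (t : (Fin d → ℝ) → ℝ) : (Fin d → ℝ) → ℝ :=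
  fun x => lineDeriv ℝ t x (Pi.single i 1)

/-- The classical partial derivative `∂^α t = ∂_0^{α_0} ⋯ ∂_{d-1}^{α_{d-1}} t`
(it is used for smooth `t` only). -/
def multiD {d : ℕ} (α : Fin d → ℕ) (t : (Fin d → ℝ) → ℝ) : (Fin d → ℝ) → ℝ :=
  (List.finRange d).foldr (fun i u => (partialD i)^[α i] u) t

/-- `g` is the weak (distributional) derivative `D^α φ` on `ℝ^d`. -/
def HasWeakDeriv {d : ℕ} (α : Fin d → ℕ) (φ g : (Fin d → ℝ) → ℂ) : Prop :=
  LocallyIntegrable φ volume ∧ LocallyIntegrable g volume ∧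
    ∀ t : (Fin d → ℝ) → ℝ, ContDiff ℝ ∞ t → HasCompactSupport t →
      ∫ x, φ x * (multiD α t x : ℂ) = (-1) ^ (∑ i, α i) * ∫ x, g x * (t x : ℂ)

/-- The family `D α`, `α ≤ s`, consists of weak derivatives `D^α φ` of `φ`. -/
def IsWeakDerivFamily {d : ℕ} (s : Fin d → ℕ) (φ : (Fin d → ℝ) → ℂ)
    (D : (Fin d → ℕ) → (Fin d → ℝ) → ℂ) : Prop :=
  ∀ α ≤ s, HasWeakDeriv α φ (D α)

/-- `∑_{0 ≤ α ≤ s} ∑_{0 ≤ β ≤ s} ‖ e^{b|x|₁} x^β D^α(x) ‖_{L²}`. -/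
def expSum {d : ℕ} (b : ℝ) (s : Fin d → ℕ) (D : (Fin d → ℕ) → (Fin d → ℝ) → ℂ) : ℝ≥0∞ :=
  ∑ α ∈ Finset.Icc 0 s, ∑ β ∈ Finset.Icc 0 s,
    eLpNorm (fun x : Fin d → ℝ =>
      ((Real.exp (b * l1Norm x) * ∏ i, x i ^ β i : ℝ) : ℂ) * D α x) 2 volume

theorem partialD_regular {d : ℕ} (i : Fin d) {t : (Fin d → ℝ) → ℝ} (h : ContDiff ℝ ∞ t)
    (hc : HasCompactSupport t) : ContDiff ℝ ∞ (partialD i t) ∧ HasCompactSupport (partialD i t) := by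
  have e : partialD i t = fun x => fderiv ℝ t x (Pi.single i 1) := by
    funext x
    exact (h.differentiable (by simp) x).lineDeriv_eq_fderiv
  rw [e]
  exact ⟨(h.fderiv_right (m := ∞) (by simp)).clm_apply contDiff_const, hc.fderiv_apply ℝ _⟩

theorem multiD_regular {d : ℕ} (α : Fin d → ℕ) {t : (Fin d → ℝ) → ℝ} (h : ContDiff ℝ ∞ t)
    (hc : HasCompactSupport t) : ContDiff ℝ ∞ (multiD α t) ∧ HasCompactSupport (multiD α t) := by
  unfold multiD
  induction List.finRange d with
  | nil => exact ⟨h, hc⟩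
  | cons i l ih =>
    rw [List.foldr_cons]
    generalize l.foldr (fun i u => (partialD i)^[α i] u) t = u at ih
    induction α i with
    | zero => exact ih
    | succ n ih2 =>
      rw [Function.iterate_succ_apply']
      exact partialD_regular i ih2.1 ih2.2

theorem integrable_mul_test {d : ℕ} {φ : (Fin d → ℝ) → ℂ} (hφ : LocallyIntegrable φ volume)
    {t : (Fin d → ℝ) → ℝ} (h : ContDiff ℝ ∞ t) (hc : HasCompactSupport t) :
    Integrable (fun x => φ x * (t x : ℂ)) volume := by
  refine (hφ.integrable_smul_left_of_hasCompactSupport h.continuous hc).congr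
    (Filter.Eventually.of_forall fun x => ?_)
  simp [mul_comm]

theorem HasWeakDeriv.add {d : ℕ} {α : Fin d → ℕ} {φ ψ g h : (Fin d → ℝ) → ℂ}
    (h1 : HasWeakDeriv α φ g) (h2 : HasWeakDeriv α ψ h) :
    HasWeakDeriv α (φ + ψ) (g + h) := by
  refine ⟨h1.1.add h2.1, h1.2.1.add h2.2.1, fun t ht hc => ?_⟩
  obtain ⟨ht', hc'⟩ := multiD_regular α ht hc
  simp only [Pi.add_apply, add_mul]
  rw [integral_add (integrable_mul_test h1.1 ht' hc') (integrable_mul_test h2.1 ht' hc'),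
    integral_add (integrable_mul_test h1.2.1 ht hc) (integrable_mul_test h2.2.1 ht hc),
    h1.2.2 t ht hc, h2.2.2 t ht hc, mul_add]

theorem HasWeakDeriv.smul {d : ℕ} {α : Fin d → ℕ} {φ g : (Fin d → ℝ) → ℂ} (c : ℂ)
    (h1 : HasWeakDeriv α φ g) : HasWeakDeriv α (c • φ) (c • g) := by
  refine ⟨h1.1.smul c, h1.2.1.smul c, fun t ht hc => ?_⟩
  simp only [Pi.smul_apply, smul_eq_mul, mul_assoc]
  rw [integral_const_mul, integral_const_mul, h1.2.2 t ht hc]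
  ring

theorem expSum_smul {d : ℕ} (b : ℝ) (s : Fin d → ℕ) (c : ℂ)
    (D : (Fin d → ℕ) → (Fin d → ℝ) → ℂ) :
    expSum b s (fun α => c • D α) = ‖c‖ₑ * expSum b s D := by
  unfold expSum
  simp only [Finset.mul_sum]
  refine Finset.sum_congr rfl fun α _ => Finset.sum_congr rfl fun β _ => ?_
  rw [← eLpNorm_const_smul]
  congr 1
  funext x
  simp only [Pi.smul_apply, smul_eq_mul]
  ring

theorem expSum_add_le {d : ℕ} (b : ℝ) {s : Fin d → ℕ} {φ ψ : (Fin d → ℝ) → ℂ}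
    {D E : (Fin d → ℕ) → (Fin d → ℝ) → ℂ} (hD : IsWeakDerivFamily s φ D)
    (hE : IsWeakDerivFamily s ψ E) :
    expSum b s (fun α => D α + E α) ≤ expSum b s D + expSum b s E := by
  unfold expSum
  simp only [← Finset.sum_add_distrib]
  refine Finset.sum_le_sum fun α hα => Finset.sum_le_sum fun β _ => ?_
  have hm : Measurable fun x : Fin d → ℝ =>
      ((Real.exp (b * l1Norm x) * ∏ i, x i ^ β i : ℝ) : ℂ) := by
    unfold l1Norm
    fun_prop
  have hα' := (Finset.mem_Icc.mp hα).2
  refine le_trans (le_of_eq ?_) (eLpNorm_add_le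
    (hm.aestronglyMeasurable.mul (hD α hα').2.1.aestronglyMeasurable)
    (hm.aestronglyMeasurable.mul (hE α hα').2.1.aestronglyMeasurable) (by norm_num))
  congr 1
  funext x
  simp only [Pi.add_apply]
  ring

/-- The test function space `X_b^s(ℝ^d)` for `s ∈ ℕ^d` and `b ≥ 0`: the functions all of whose weak
derivatives `D^α φ`, `α ≤ s`, exist and satisfy
`∑_{α ≤ s} ∑_{β ≤ s} ‖ e^{b|x|₁} x^β D^α φ ‖_{L²} < ∞`. Since `b ≥ 0`, the terms with `β = 0`
give `D^α φ ∈ L²` for all `α ≤ s`, so that `φ` lies in the Sobolev space of dominating mixed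
smoothness `s`, which is the Besov space of dominating mixed smoothness with `p = q = 2`. -/
def testSpace {d : ℕ} (b : ℝ) (s : Fin d → ℕ) : Submodule ℂ ((Fin d → ℝ) → ℂ) where
  carrier := {φ | ∃ D, IsWeakDerivFamily s φ D ∧ expSum b s D < ⊤}
  zero_mem' := by
    refine ⟨fun _ => 0, fun α _ => ⟨locallyIntegrable_zero, locallyIntegrable_zero, ?_⟩, ?_⟩
    · intro t _ _
      simp
    · simp [expSum]
  add_mem' := by
    rintro φ ψ ⟨D, hD, hD'⟩ ⟨E, hE, hE'⟩
    exact ⟨fun α => D α + E α, fun α hα => (hD α hα).add (hE α hα),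
      (expSum_add_le b hD hE).trans_lt (ENNReal.add_lt_top.mpr ⟨hD', hE'⟩)⟩
  smul_mem' := by
    rintro c φ ⟨D, hD, hD'⟩
    refine ⟨fun α => c • D α, fun α hα => (hD α hα).smul c, ?_⟩
    rw [expSum_smul]
    exact ENNReal.mul_lt_top enorm_lt_top hD'

/-- The topological dual `X_b^s(ℝ^d)'`: the linear functionals on `X_b^s(ℝ^d)` that are bounded by
a multiple of the norm `∑_{α ≤ s} ∑_{β ≤ s} ‖ e^{b|x|₁} x^β D^α φ ‖_{L²}` (weak derivatives are
unique almost everywhere, so that the norm does not depend on the family `D`). -/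
def DualSpace {d : ℕ} (b : ℝ) (s : Fin d → ℕ) : Type :=
  {f : testSpace b s →ₗ[ℂ] ℂ // ∃ C : ℝ≥0, ∀ (φ : testSpace b s)
    (D : (Fin d → ℕ) → (Fin d → ℝ) → ℂ), IsWeakDerivFamily s (φ : (Fin d → ℝ) → ℂ) D →
      ‖f φ‖ₑ ≤ C * expSum b s D}

/-- Membership of a function of one real variable in `X_b^n(ℝ)`. -/
def MemTestSpace1 (b : ℝ) (n : ℕ) (φ : ℝ → ℂ) : Prop :=
  (fun x : Fin 1 → ℝ => φ (x 0)) ∈ testSpace b (fun _ : Fin 1 => n)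

open Classical in
/-- The convolution `g * f (x) = ⟨f, g(x - ·)⟩` of a test function `g` with a functional
`f ∈ X_b^s(ℝ^d)'`. (The space is invariant under translations and reflections; the value is set
to `0` if `g(x - ·)` is not a test function.) -/
def conv {d : ℕ} {b : ℝ} {s : Fin d → ℕ} (g : (Fin d → ℝ) → ℂ) (f : DualSpace b s)
    (x : Fin d → ℝ) : ℂ :=
  if h : (fun y => g (x - y)) ∈ testSpace b s then f.1 ⟨fun y => g (x - y), h⟩ else 0

/-! ### Dyadic systems -/

/-- `φ = φ₀ - 2⁻¹ φ₀(2⁻¹ ·)`. -/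
def dyadicDiff (φ₀ : ℝ → ℂ) : ℝ → ℂ := fun x => φ₀ x - 2⁻¹ * φ₀ (2⁻¹ * x)

/-- The sequence with `0`-th member `φ₀` and `j`-th member `2^j φ(2^j ·)`, `j ≥ 1`. -/
def dyadicSeq (φ₀ φ : ℝ → ℂ) (j : ℕ) : ℝ → ℂ :=
  if j = 0 then φ₀ else fun x => 2 ^ j * φ (2 ^ j * x)

/-- The tensor products `x ↦ ∏ i, φ^i_{j_i}(x_i)`. -/
def tensorSeq {d : ℕ} (φ₀ φ : Fin d → ℝ → ℂ) (j : Fin d → ℕ) : (Fin d → ℝ) → ℂ :=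
  fun x => ∏ i, dyadicSeq (φ₀ i) (φ i) (j i) (x i)

/-- `(D^s φ̂)(0) = 0` for `s = 0, …, L`. (The normalization of the Fourier transform and of `D` does
not matter for this condition.) -/
def FourierVanishes (L : ℕ) (φ : ℝ → ℂ) : Prop :=
  ∀ s ≤ L, iteratedDeriv s (𝓕 φ) 0 = 0

/-! ### Weights and norms -/

/-- `w` is a weight (positive, locally integrable) on `ℝ^d` with
`w(x) ≲ w(x - y) e^{c |y|₁}` for a constant `c > 0`. -/
structure IsExpWeight {d : ℕ} (w : (Fin d → ℝ) → ℝ) (c : ℝ) : Prop where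
  pos : ∀ x, 0 < w x
  locallyIntegrable : LocallyIntegrable w volume
  const_pos : 0 < c
  bound : ∃ C : ℝ, ∀ x y, w x ≤ C * (w (x - y) * Real.exp (c * l1Norm y))

/-- The measure `w dx`, so that `eLpNorm F p (weighted w)` is the norm of `L^p_w`:
`(∫ |F|^p w dx)^{1/p}` for `p < ∞`, and the essential supremum for `p = ∞`. -/
def weighted {d : ℕ} (w : (Fin d → ℝ) → ℝ) : Measure (Fin d → ℝ) :=
  volume.withDensity fun x => ENNReal.ofReal (w x)

/-- `(∑_{j ∈ ℕ^d} 2^{q δ(j)} A_j^q)^{1/q}`, read as `sup_j 2^{δ(j)} A_j` for `q = ∞`. -/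
def smoothSum {d : ℕ} (q : ℝ≥0∞) (δ : Seminorm ℝ (Fin d → ℝ)) (A : (Fin d → ℕ) → ℝ≥0∞) : ℝ≥0∞ :=
  if q = ⊤ then ⨆ j, ENNReal.ofReal ((2 : ℝ) ^ δ (toReal j)) * A j
  else (∑' j, ENNReal.ofReal ((2 : ℝ) ^ (q.toReal * δ (toReal j))) * A j ^ q.toReal)
    ^ (1 / q.toReal)

/-- The Peetre maximal function with purely exponential denominators, for a function `F` at the
dyadic level `j`: `sup_y |F(x - y)| / ∏ i, e^{2^{j_i} b' |y_i|}`. -/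
def peetreMax {d : ℕ} (b' : ℝ) (j : Fin d → ℕ) (F : (Fin d → ℝ) → ℂ) (x : Fin d → ℝ) : ℝ≥0∞ :=
  ⨆ y : Fin d → ℝ, ‖F (x - y)‖ₑ / ENNReal.ofReal (∏ i, Real.exp (2 ^ j i * b' * |y i|))

end

end ExpBesov

namespace ExpBesov

open Filter Topology

/-! Each $\psi_{\bar j}*f$ is recovered from the $\varphi_{\bar k}*f$ by a Calderón formula whose
kernels decay exponentially. The exponential Peetre function is then dominated, linearly and with no
auxiliary maximal operator, by exponential averages of $|\varphi_{\bar k}*f|$.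

On the line, let $y_k$ be the Fourier transform of $\Phi_k=2^k\varphi_0(2^k\cdot)$, so that
$\varphi_k=\Phi_k-\Phi_{k-1}$ for $k\ge1$. With $P(y)=2y^2-y^4$ one has
$P(u)-P(v)=(u-v)(u+v)(2-u^2-v^2)$. Let $\Lambda_0$ have transform $2y_0-y_0^3$ and $\Lambda_k$ the
transform $(y_k+y_{k-1})(2-y_k^2-y_{k-1}^2)$. Then $\sum_{k\le N}\Lambda_k*\varphi_k$ telescopes to
the function with transform $P(y_N)$ (`sum_dualSeq_diffChain`), which is $2^NS(2^N\cdot)$ with $\int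
S=1$. The hypotheses say that $y_0(0)^2=1$ and that the derivatives of $y_0$ of orders $1,\dots,L$
vanish at $0$, so $2-y_k^2-y_{k-1}^2$, and with it $\Lambda_k$ for $k\ge1$, has vanishing moments
(`fourierVanishes_bandChain`). As finite convolution polynomials in dilates of $\varphi_0$, the
$\Lambda_k$ still decay exponentially.

The kernel $K_{jk}=\Lambda_k*\psi_j$ gains $2^{-L|j-k|}$: the moments of the factor at the finer
scale are played against the derivatives of the other (`exists_norm_cv_scl_le`,
`exists_kernel_bound`). Since derivatives are only weak, a function is carried along with its
derivatives as a `Chain` of primitives, and integration by parts is the identity `Chain.cv_swap`.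
The derivative of highest order is only in a weighted $L^2$ space; the lower ones are pointwise
$O(e^{-b|x|})$.

A functional $f$ is written as $\sum_\alpha\int a_\alpha W D^\alpha(\cdot)$ with $a_\alpha\in L^2$
and a product weight $W$ (`DualSpace.exists_repr`). Convolutions with $f$ become continuous
functions of growth $O(W)$, for which Fubini and the approximate identity are available at every
point. This yields $|\psi_{\bar j}*f|\le\sum_{\bar k}|K_{\bar j\bar k}|*|\varphi_{\bar k}*f|$ in
$[0,\infty]$ (`enorm_reprConv_le`).

The kernels live at scales no finer than $2^{j_i}$, so a shift by $y$ costs at most the denominator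
of the Peetre function (`peetreMax_le_tsum`). Exponential averages are bounded on $L^p_w$ because
$c_w/p<b'$ (`exists_eLpNorm_expAvg_le`). Finally $\delta(\bar j)-\delta(\bar
k)\le\sum_i\delta(e_i)|j_i-k_i|$ with $\delta(e_i)<L$, and Schur's test sums over $\bar k$
(`smoothSum_le`). -/

/-! ### Convolution on the line -/

/-- The convolution of two functions on the line. -/
noncomputable def cv (f g : ℝ → ℂ) (x : ℝ) : ℂ := ∫ t, f t * g (x - t)

/-- The dilation `r g(r ·)`. -/
noncomputable def scl (r : ℝ) (g : ℝ → ℂ) (x : ℝ) : ℂ := r * g (r * x)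

open Convolution in
theorem cv_eq_convolution (f g : ℝ → ℂ) :
    cv f g = f ⋆[ContinuousLinearMap.mul ℂ ℂ] g := rfl

theorem cv_comm (f g : ℝ → ℂ) : cv f g = cv g f := by
  funext x
  unfold cv
  rw [← integral_sub_left_eq_self (fun t => g t * f (x - t)) volume x]
  simp [mul_comm]

theorem integrable_cv {f g : ℝ → ℂ} (hf : Integrable f) (hg : Integrable g) :
    Integrable (cv f g) :=
  hf.integrable_convolution (ContinuousLinearMap.mul ℂ ℂ) hg

theorem fourier_cv {f g : ℝ → ℂ} (hf : Integrable f) (hg : Integrable g) (ξ : ℝ) :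
    𝓕 (cv f g) ξ = 𝓕 f ξ * 𝓕 g ξ :=
  Real.fourier_mul_convolution_eq hf hg ξ

theorem cv_congr_ae {f f' g g' : ℝ → ℂ} (hf : f =ᵐ[volume] f') (hg : g =ᵐ[volume] g') :
    cv f g = cv f' g' :=
  convolution_congr (ContinuousLinearMap.mul ℂ ℂ) hf hg

theorem fourier_congr_ae {f g : ℝ → ℂ} (h : f =ᵐ[volume] g) : 𝓕 f = 𝓕 g := by
  funext ξ
  rw [Real.fourier_eq, Real.fourier_eq]
  exact integral_congr_ae (h.mono fun x hx => by simp [hx])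

theorem fourier_add' {f g : ℝ → ℂ} (hf : Integrable f) (hg : Integrable g) (ξ : ℝ) :
    𝓕 (fun x => f x + g x) ξ = 𝓕 f ξ + 𝓕 g ξ := by
  simp only [Real.fourier_eq, smul_add]
  exact integral_add ((Real.fourierIntegral_convergent_iff ξ).2 hf)
    ((Real.fourierIntegral_convergent_iff ξ).2 hg)

theorem fourier_const_mul' (c : ℂ) (f : ℝ → ℂ) (ξ : ℝ) :
    𝓕 (fun x => c * f x) ξ = c * 𝓕 f ξ := by
  simp only [Real.fourier_eq]
  rw [← integral_const_mul]
  congr 1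
  funext v
  simp only [Circle.smul_def, smul_eq_mul]
  ring

theorem fourier_sub' {f g : ℝ → ℂ} (hf : Integrable f) (hg : Integrable g) (ξ : ℝ) :
    𝓕 (fun x => f x - g x) ξ = 𝓕 f ξ - 𝓕 g ξ := by
  simp only [Real.fourier_eq, smul_sub]
  exact integral_sub ((Real.fourierIntegral_convergent_iff ξ).2 hf)
    ((Real.fourierIntegral_convergent_iff ξ).2 hg)

theorem fourier_sum' {ι : Type*} (s : Finset ι) {f : ι → ℝ → ℂ} (hf : ∀ i ∈ s, Integrable (f i))
    (ξ : ℝ) : 𝓕 (fun x => ∑ i ∈ s, f i x) ξ = ∑ i ∈ s, 𝓕 (f i) ξ := by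
  simp only [Real.fourier_eq, Finset.smul_sum]
  exact integral_finsetSum _ fun i hi => (Real.fourierIntegral_convergent_iff ξ).2 (hf i hi)

/-- The Fourier transform is injective on integrable functions. -/
theorem ae_eq_of_fourier_eq {f g : ℝ → ℂ} (hf : Integrable f) (hg : Integrable g)
    (h : ∀ ξ, 𝓕 f ξ = 𝓕 g ξ) : f =ᵐ[volume] g := by
  refine ae_eq_of_integral_contDiff_smul_eq hf.locallyIntegrable hg.locallyIntegrable ?_
  intro t ht hc
  have hc' : HasCompactSupport (Complex.ofRealCLM ∘ t) := hc.comp_left rfl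
  have ht' : ContDiff ℝ ∞ (Complex.ofRealCLM ∘ t) := by fun_prop
  set T := hc'.toSchwartzMap ht' with hT
  -- A test function $t$ is the transform of the Schwartz function $\mathcal F^{-1}t$; the
  -- multiplication formula moves this transform onto $u$, so the pairing sees only $\hat u$.
  have key : ∀ u : ℝ → ℂ, Integrable u →
      ∫ x, t x • u x = ∫ ξ, (𝓕⁻ T : SchwartzMap ℝ ℂ) ξ * 𝓕 u ξ := by
    intro u hu
    have e1 : ∀ x, t x • u x = 𝓕 ((𝓕⁻ T : SchwartzMap ℝ ℂ) : ℝ → ℂ) x • u x := by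
      intro x
      rw [← SchwartzMap.fourier_coe, FourierTransform.fourier_fourierInv_eq]
      simp [hT]
    simp_rw [e1]
    have := VectorFourier.integral_fourierIntegral_smul_eq_flip (L := innerₗ ℝ)
      (μ := volume) (ν := volume) Real.continuous_fourierChar continuous_inner
      (𝓕⁻ T : SchwartzMap ℝ ℂ).integrable hu
    simpa using! this
  rw [key f hf, key g hg]
  simp_rw [h]

theorem Integrable.scl {g : ℝ → ℂ} (hg : Integrable g) {r : ℝ} (hr : 0 < r) :
    Integrable (scl r g) :=
  (hg.comp_mul_left' hr.ne').const_mul _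

theorem integral_scl (g : ℝ → ℂ) {r : ℝ} (hr : 0 < r) : ∫ x, scl r g x = ∫ x, g x := by
  unfold scl
  rw [integral_const_mul, Measure.integral_comp_mul_left, abs_of_pos (inv_pos.2 hr),
    Complex.real_smul, ← mul_assoc]
  simp [hr.ne']

theorem fourier_scl (g : ℝ → ℂ) {r : ℝ} (hr : 0 < r) (ξ : ℝ) :
    𝓕 (scl r g) ξ = 𝓕 g (ξ / r) := by
  rw [Real.fourier_eq, Real.fourier_eq,
    ← integral_scl (fun v => Real.fourierChar (-(inner ℝ v (ξ / r))) • g v) hr]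
  congr 1
  funext v
  have : (inner ℝ (r * v) (ξ / r) : ℝ) = inner ℝ v ξ := by
    simp
    field_simp
  simp only [scl, this, Circle.smul_def, smul_eq_mul]
  ring

theorem cv_scl (f g : ℝ → ℂ) {r : ℝ} (hr : 0 < r) : cv (scl r f) (scl r g) = scl r (cv f g) := by
  funext x
  show ∫ t, _ = (r : ℂ) * ∫ t, _
  rw [← integral_scl (fun t => f t * g (r * x - t)) hr, ← integral_const_mul]
  congr 1
  funext t
  simp only [scl]
  rw [mul_sub]
  ring

theorem scl_scl (g : ℝ → ℂ) (r s : ℝ) : scl r (scl s g) = scl (s * r) g := by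
  funext x
  simp only [scl]
  rw [mul_assoc s r x]
  push_cast
  ring

theorem scl_one (g : ℝ → ℂ) : scl 1 g = g := by
  funext x
  simp [scl]

theorem scl_congr_ae {f g : ℝ → ℂ} (h : f =ᵐ[volume] g) {r : ℝ} (hr : 0 < r) :
    scl r f =ᵐ[volume] scl r g := by
  have hq : Measure.QuasiMeasurePreserving (fun x : ℝ => r * x) volume volume := by
    refine ⟨by fun_prop, ?_⟩
    rw [show (fun x : ℝ => r * x) = (r * ·) from rfl, Real.map_volume_mul_left hr.ne']
    exact Measure.smul_absolutelyContinuous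
  filter_upwards [hq.ae h] with x hx
  simp [scl, hx]

/-! ### Chains of successive primitives -/

/-- `G s` is the primitive, vanishing at `-∞`, of `G (s + 1)`, for `s < n`. -/
structure Chain (n : ℕ) (G : ℕ → ℝ → ℂ) : Prop where
  integrable : ∀ s ≤ n, Integrable (G s)
  eq_integral : ∀ s < n, ∀ x, G s x = ∫ y in Set.Iic x, G (s + 1) y

theorem Chain.mono {m n : ℕ} {G : ℕ → ℝ → ℂ} (h : Chain n G) (hm : m ≤ n) : Chain m G :=
  ⟨fun s hs => h.integrable s (hs.trans hm), fun s hs => h.eq_integral s (hs.trans_le hm)⟩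

/-- Both sides are the double integral of $f'(y)g'(x-t)$ over $y\le t$. This is integration by parts
with neither differentiability nor boundary terms. -/
theorem cv_primitive {f f' g g' : ℝ → ℂ} (hf' : Integrable f') (hg' : Integrable g')
    (hf : ∀ x, f x = ∫ y in Set.Iic x, f' y) (hg : ∀ x, g x = ∫ y in Set.Iic x, g' y) :
    cv f g' = cv f' g := by
  funext x
  unfold cv
  have hint : Integrable (fun p : ℝ × ℝ => (Set.Iic p.1).indicator f' p.2 * g' (x - p.1))
      (volume.prod volume) := by
    have h1 : Integrable (fun p : ℝ × ℝ => g' (x - p.1) * f' p.2) (volume.prod volume) :=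
      (hg'.comp_sub_left x).mul_prod hf'
    have hs : MeasurableSet {p : ℝ × ℝ | p.2 ≤ p.1} := measurableSet_le measurable_snd measurable_fst
    refine (h1.indicator hs).congr (Eventually.of_forall fun p => ?_)
    by_cases hp : p.2 ≤ p.1
    · simp [Set.indicator, hp, mul_comm]
    · simp [Set.indicator, hp]
  calc ∫ t, f t * g' (x - t)
      = ∫ t, ∫ y, (Set.Iic t).indicator f' y * g' (x - t) := by
        congr 1
        funext t
        rw [hf, integral_mul_const, integral_indicator measurableSet_Iic]
    _ = ∫ y, ∫ t, (Set.Iic t).indicator f' y * g' (x - t) := integral_integral_swap hint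
    _ = ∫ y, f' y * g (x - y) := by
        congr 1
        funext y
        rw [hg, ← integral_indicator measurableSet_Iic,
          ← integral_sub_left_eq_self (fun t => (Set.Iic (x - y)).indicator g' t) volume x,
          ← integral_const_mul]
        congr 1
        funext t
        by_cases h : y ≤ t
        · have : x - t ≤ x - y := by linarith
          simp only [Set.indicator, Set.mem_Iic, h, this, if_true]
        · have : ¬ x - t ≤ x - y := by linarith
          simp only [Set.indicator, Set.mem_Iic, h, this, if_false, zero_mul, mul_zero]

/-- `cv_primitive` applied $n$ times. It serves both to trade moments for decay and to move the
derivatives in the reproducing formula from one factor to another. -/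
theorem Chain.cv_swap {n : ℕ} {G H : ℕ → ℝ → ℂ} (hG : Chain n G) (hH : Chain n H) :
    cv (G 0) (H n) = cv (G n) (H 0) := by
  have : ∀ k ≤ n, cv (G 0) (H n) = cv (G k) (H (n - k)) := by
    intro k
    induction k with
    | zero => simp
    | succ k ih =>
      intro hk
      rw [ih (by omega), show n - k = n - (k + 1) + 1 by omega]
      exact cv_primitive (hG.integrable _ hk) (hH.integrable _ (by omega))
        (hG.eq_integral k (by omega)) (hH.eq_integral _ (by omega))
  simpa using this n le_rfl

theorem Chain.cv {n : ℕ} {G : ℕ → ℝ → ℂ} (hG : Chain n G) {P : ℝ → ℂ} (hP : Integrable P) :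
    Chain n (fun s => cv P (G s)) := by
  refine ⟨fun s hs => integrable_cv hP (hG.integrable s hs), fun s hs x => ?_⟩
  have hint : Integrable (fun p : ℝ × ℝ => P p.2 * G (s + 1) (p.1 - p.2))
      ((volume.restrict (Set.Iic x)).prod volume) := by
    have h := hP.convolution_integrand (ContinuousLinearMap.mul ℂ ℂ) (hG.integrable (s + 1) hs)
    have h2 := h.restrict (s := Set.Iic x ×ˢ (Set.univ : Set ℝ))
    rwa [← Measure.prod_restrict, Measure.restrict_univ] at h2
  unfold ExpBesov.cv
  rw [integral_integral_swap hint]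
  congr 1
  funext t
  rw [integral_const_mul, hG.eq_integral s hs]
  congr 1
  rw [← integral_indicator measurableSet_Iic, ← integral_indicator measurableSet_Iic,
    ← integral_sub_right_eq_self (fun z => (Set.Iic (x - t)).indicator (G (s + 1)) z) t]
  congr 1
  funext z
  simp [Set.indicator]

theorem Chain.const_mul {n : ℕ} {G : ℕ → ℝ → ℂ} (hG : Chain n G) (c : ℂ) :
    Chain n (fun s x => c * G s x) :=
  ⟨fun s hs => (hG.integrable s hs).const_mul c, fun s hs x => by
    rw [integral_const_mul, hG.eq_integral s hs]⟩

theorem Chain.add {n : ℕ} {G H : ℕ → ℝ → ℂ} (hG : Chain n G) (hH : Chain n H) :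
    Chain n (fun s x => G s x + H s x) :=
  ⟨fun s hs => (hG.integrable s hs).add (hH.integrable s hs), fun s hs x => by
    rw [integral_add (hG.integrable _ hs).integrableOn (hH.integrable _ hs).integrableOn,
      hG.eq_integral s hs, hH.eq_integral s hs]⟩

theorem Chain.sub {n : ℕ} {G H : ℕ → ℝ → ℂ} (hG : Chain n G) (hH : Chain n H) :
    Chain n (fun s x => G s x - H s x) :=
  ⟨fun s hs => (hG.integrable s hs).sub (hH.integrable s hs), fun s hs x => by
    rw [integral_sub (hG.integrable _ hs).integrableOn (hH.integrable _ hs).integrableOn,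
      hG.eq_integral s hs, hH.eq_integral s hs]⟩

/-- Each derivative of a dilation brings out a factor $r$. These powers are the source of the decay
in the ratio of two scales. -/
theorem Chain.scl {n : ℕ} {G : ℕ → ℝ → ℂ} (hG : Chain n G) {r : ℝ} (hr : 0 < r) :
    Chain n (fun s x => (r : ℂ) ^ s * scl r (G s) x) := by
  refine ⟨fun s hs => (Integrable.scl (hG.integrable s hs) hr).const_mul _, fun s hs x => ?_⟩
  have h := integral_scl ((Set.Iic (r * x)).indicator (G (s + 1))) hr
  rw [integral_indicator measurableSet_Iic, ← hG.eq_integral s hs] at h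
  rw [integral_const_mul, ExpBesov.scl, ← h, ← integral_indicator measurableSet_Iic, pow_succ,
    mul_assoc]
  congr 2
  refine integral_congr_ae (Eventually.of_forall fun y => ?_)
  by_cases hy : y ≤ x
  · simp [Set.indicator, ExpBesov.scl, hy, hr]
  · simp [Set.indicator, ExpBesov.scl, hy, hr]

theorem integral_Iic_eq_add {f : ℝ → ℂ} (hf : Integrable f) (x : ℝ) :
    ∫ y in Set.Iic x, f y = (∫ y in Set.Iic 0, f y) + ∫ y in (0 : ℝ)..x, f y := by
  rw [← intervalIntegral.integral_Iic_sub_Iic hf.integrableOn hf.integrableOn]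
  ring

theorem continuous_integral_Iic {f : ℝ → ℂ} (hf : Integrable f) :
    Continuous (fun x => ∫ y in Set.Iic x, f y) := by
  rw [funext (integral_Iic_eq_add hf)]
  exact continuous_const.add (intervalIntegral.continuous_primitive
    (fun a b => hf.intervalIntegrable) 0)

theorem hasDerivAt_integral_Iic {f : ℝ → ℂ} (hf : Integrable f) (hc : Continuous f) (x : ℝ) :
    HasDerivAt (fun x => ∫ y in Set.Iic x, f y) (f x) x := by
  rw [funext (integral_Iic_eq_add hf)]
  exact (intervalIntegral.integral_hasDerivAt_right hf.intervalIntegrable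
    (hc.stronglyMeasurableAtFilter _ _) hc.continuousAt).const_add _

theorem tendsto_integral_Iic_atTop {f : ℝ → ℂ} (hf : Integrable f) :
    Tendsto (fun x => ∫ y in Set.Iic x, f y) atTop (𝓝 (∫ y, f y)) := by
  have := (aecover_Iic (μ := volume) (tendsto_id (α := ℝ) (x := atTop))).integral_tendsto_of_countably_generated hf
  simpa using this

theorem Chain.continuous {n : ℕ} {G : ℕ → ℝ → ℂ} (hG : Chain n G) {s : ℕ} (hs : s < n) :
    Continuous (G s) := by
  rw [show G s = fun x => ∫ y in Set.Iic x, G (s + 1) y from funext (hG.eq_integral s hs)]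
  exact continuous_integral_Iic (hG.integrable _ hs)

/-- The integral is the limit of $G_s$ at $+\infty$, and an integrable function has no nonzero limit
there. -/
theorem Chain.integral_eq_zero {n : ℕ} {G : ℕ → ℝ → ℂ} (hG : Chain n G) {s : ℕ} (hs : s < n) :
    ∫ y, G (s + 1) y = 0 := by
  by_contra hne
  have h := tendsto_integral_Iic_atTop (hG.integrable (s + 1) hs)
  simp_rw [← hG.eq_integral s hs] at h
  have hpos : 0 < ‖∫ y, G (s + 1) y‖ := norm_pos_iff.2 hne
  obtain ⟨R, hR⟩ := eventually_atTop.1 (h.norm.eventually (lt_mem_nhds (half_lt_self hpos)))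
  have h1 : IntegrableOn (fun x => ‖G s x‖) (Set.Ioi R) :=
    (hG.integrable s hs.le).norm.integrableOn
  have h2 : IntegrableOn (fun _ => ‖∫ y, G (s + 1) y‖ / 2) (Set.Ioi R) := by
    refine Integrable.mono' h1 aestronglyMeasurable_const ?_
    filter_upwards [ae_restrict_mem measurableSet_Ioi] with x hx
    rw [Real.norm_of_nonneg (by positivity)]
    exact (hR x (le_of_lt hx)).le
  rw [integrableOn_const_iff (by simp)] at h2
  rcases h2 with h2 | h2
  · rw [enorm_eq_zero] at h2
    linarith
  · simp at h2

/-- The members of a chain are successive weak derivatives. -/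
theorem Chain.integral_mul_deriv {n : ℕ} {G : ℕ → ℝ → ℂ} (hG : Chain n G) {s : ℕ} (hs : s < n)
    {t : ℝ → ℝ} (ht : ContDiff ℝ ∞ t) (hc : HasCompactSupport t) :
    ∫ x, G s x * ((deriv t x : ℝ) : ℂ) = - ∫ x, G (s + 1) x * (t x : ℂ) := by
  have hd : Continuous (deriv t) := ht.continuous_deriv (by simp)
  have hdi : Integrable (fun x => ((deriv t x : ℝ) : ℂ)) :=
    (hd.integrable_of_hasCompactSupport hc.deriv).ofReal
  have hint : Integrable (fun p : ℝ × ℝ => (Set.Iic p.1).indicator (G (s + 1)) p.2 *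
      ((deriv t p.1 : ℝ) : ℂ)) (volume.prod volume) := by
    have h1 := hdi.mul_prod (hG.integrable (s + 1) hs)
    have hm : MeasurableSet {p : ℝ × ℝ | p.2 ≤ p.1} := measurableSet_le measurable_snd measurable_fst
    refine (h1.indicator hm).congr (Eventually.of_forall fun p => ?_)
    by_cases hp : p.2 ≤ p.1
    · simp [Set.indicator, hp, mul_comm]
    · simp [Set.indicator, hp]
  calc ∫ x, G s x * ((deriv t x : ℝ) : ℂ)
      = ∫ x, ∫ y, (Set.Iic x).indicator (G (s + 1)) y * ((deriv t x : ℝ) : ℂ) := by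
        congr 1
        funext x
        rw [hG.eq_integral s hs, integral_mul_const, integral_indicator measurableSet_Iic]
    _ = ∫ y, ∫ x, (Set.Iic x).indicator (G (s + 1)) y * ((deriv t x : ℝ) : ℂ) :=
        integral_integral_swap hint
    _ = ∫ y, - (G (s + 1) y * (t y : ℂ)) := by
        congr 1
        funext y
        have e : ∫ x in Set.Ioi y, deriv t x = 0 - t y :=
          integral_Ioi_of_hasDerivAt_of_tendsto' (fun x _ => (ht.differentiable (by simp) x).hasDerivAt)
            (hd.integrable_of_hasCompactSupport hc.deriv).integrableOn
            (hc.is_zero_at_infty.mono_left atTop_le_cocompact)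
        rw [← integral_Ici_eq_integral_Ioi, ← integral_indicator measurableSet_Ici] at e
        have e2 : ∀ x, (Set.Iic x).indicator (G (s + 1)) y * ((deriv t x : ℝ) : ℂ) =
            G (s + 1) y * (((Set.Ici y).indicator (deriv t) x : ℝ) : ℂ) := by
          intro x
          by_cases h : y ≤ x <;> simp [Set.indicator, h]
        simp_rw [e2]
        rw [integral_const_mul, integral_complex_ofReal, e]
        push_cast
        ring
    _ = _ := integral_neg _

/-! ### Exponentially bounded functions -/

theorem integral_exp_neg_abs {β : ℝ} (hβ : 0 < β) : ∫ x : ℝ, Real.exp (-(β * |x|)) = 2 / β := by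
  rw [integral_comp_abs (f := fun x => Real.exp (-(β * x)))]
  have := integral_exp_mul_Ioi (a := -β) (by linarith) 0
  simp only [neg_mul] at this
  rw [this]
  simp
  field_simp

theorem integrable_exp_neg_abs {β : ℝ} (hβ : 0 < β) :
    Integrable (fun x : ℝ => Real.exp (-(β * |x|))) := by
  -- The Bochner integral of a non-integrable function is $0$ by convention, but the value already
  -- computed is positive.
  by_contra h
  have := integral_undef h
  rw [integral_exp_neg_abs hβ] at this
  have : 0 < 2 / β := by positivity
  linarith

theorem exists_pow_le_exp (s : ℕ) {ε : ℝ} (hε : 0 < ε) :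
    ∃ C : ℝ, 0 ≤ C ∧ ∀ x : ℝ, |x| ^ s ≤ C * Real.exp (ε * |x|) := by
  refine ⟨s.factorial / ε ^ s, by positivity, fun x => ?_⟩
  have h := Real.pow_div_factorial_le_exp (ε * |x|) (by positivity) s
  rw [div_le_iff₀ (by positivity), mul_pow] at h
  rw [div_mul_eq_mul_div, le_div_iff₀ (by positivity)]
  linarith

/-- `g` is measurable and `|g(x)| ≤ C e^{-β|x|}`. -/
def Bd (β : ℝ) (g : ℝ → ℂ) : Prop :=
  AEStronglyMeasurable g volume ∧ ∃ C : ℝ, 0 ≤ C ∧ ∀ x, ‖g x‖ ≤ C * Real.exp (-(β * |x|))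

theorem Bd.integrable {β : ℝ} {g : ℝ → ℂ} (hg : Bd β g) (hβ : 0 < β) : Integrable g := by
  obtain ⟨hm, C, -, hC⟩ := hg
  exact ((integrable_exp_neg_abs hβ).const_mul C).mono' hm (Eventually.of_forall hC)

theorem Bd.mono {β β' : ℝ} {g : ℝ → ℂ} (hg : Bd β g) (h : β' ≤ β) : Bd β' g := by
  obtain ⟨hm, C, h0, hC⟩ := hg
  refine ⟨hm, C, h0, fun x => (hC x).trans ?_⟩
  gcongr

theorem Bd.add {β : ℝ} {g h : ℝ → ℂ} (hg : Bd β g) (hh : Bd β h) :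
    Bd β (fun x => g x + h x) := by
  obtain ⟨hm, C, h0, hC⟩ := hg
  obtain ⟨hm', C', h0', hC'⟩ := hh
  refine ⟨hm.add hm', C + C', by positivity, fun x => (norm_add_le _ _).trans ?_⟩
  rw [add_mul]
  exact add_le_add (hC x) (hC' x)

theorem Bd.const_mul {β : ℝ} {g : ℝ → ℂ} (hg : Bd β g) (c : ℂ) :
    Bd β (fun x => c * g x) := by
  obtain ⟨hm, C, h0, hC⟩ := hg
  refine ⟨hm.const_mul c, ‖c‖ * C, by positivity, fun x => ?_⟩
  rw [norm_mul, mul_assoc]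
  gcongr
  exact hC x

theorem Bd.sub {β : ℝ} {g h : ℝ → ℂ} (hg : Bd β g) (hh : Bd β h) :
    Bd β (fun x => g x - h x) := by
  have := hg.add (hh.const_mul (-1))
  simpa [sub_eq_add_neg] using this

theorem Bd.scl {β : ℝ} {g : ℝ → ℂ} (hg : Bd β g) (hβ : 0 ≤ β) {r : ℝ} (hr : 1 ≤ r) :
    Bd β (scl r g) := by
  have hr0 : 0 < r := by linarith
  obtain ⟨hm, C, h0, hC⟩ := hg
  refine ⟨?_, r * C, by positivity, fun x => ?_⟩
  · have hq : Measure.QuasiMeasurePreserving (fun x : ℝ => r * x) volume volume := by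
      refine ⟨by fun_prop, ?_⟩
      rw [show (fun x : ℝ => r * x) = (r * ·) from rfl, Real.map_volume_mul_left hr0.ne']
      exact Measure.smul_absolutelyContinuous
    exact (hm.comp_quasiMeasurePreserving hq).const_mul _
  · rw [ExpBesov.scl, norm_mul, Complex.norm_real, Real.norm_of_nonneg hr0.le, mul_assoc]
    gcongr
    refine (hC _).trans (mul_le_mul_of_nonneg_left (Real.exp_le_exp.2 ?_) h0)
    rw [abs_mul, abs_of_pos hr0]
    nlinarith [mul_nonneg (mul_nonneg hβ (abs_nonneg x)) (sub_nonneg.2 hr)]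

theorem exp_neg_abs_sub_le {β : ℝ} (hβ : 0 ≤ β) (x t : ℝ) :
    Real.exp (-(β * |x - t|)) ≤ Real.exp (-(β * |x|)) * Real.exp (β * |t|) := by
  rw [← Real.exp_add]
  gcongr
  have : |x| ≤ |x - t| + |t| := by simpa using abs_add_le (x - t) t
  nlinarith

/-- Convolution of exponentially bounded functions at scales `r ≥ 1` and `1`. -/
theorem norm_cv_scl_le {β β' C C' : ℝ} (hβ' : 0 < β') (hβ : β' < β) (hC0 : 0 ≤ C)
    {f g : ℝ → ℂ} (hf : ∀ x, ‖f x‖ ≤ C * Real.exp (-(β * |x|)))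
    (hg : ∀ x, ‖g x‖ ≤ C' * Real.exp (-(β' * |x|))) {r : ℝ} (hr : 1 ≤ r) (x : ℝ) :
    ‖cv (scl r f) g x‖ ≤ C * C' * (2 / (β - β')) * Real.exp (-(β' * |x|)) := by
  have hr0 : 0 < r := by linarith
  have hC0' : 0 ≤ C' := by
    have := (norm_nonneg _).trans (hg 0)
    simpa using this
  have hd : 0 < β - β' := by linarith
  have hdr : 0 < (β - β') * r := by positivity
  -- Since $r\ge1$, $\beta'|t|\le\beta' r|t|$, which leaves the rate $(\beta-\beta')r$. Integrating
  -- in $t$ gives $2/((\beta-\beta')r)$ and cancels the factor $r$ of the dilation, hence a bound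
  -- uniform in $r$.
  have hb : ∀ t, ‖scl r f t * g (x - t)‖ ≤
      C * C' * Real.exp (-(β' * |x|)) * r * Real.exp (-((β - β') * r * |t|)) := by
    intro t
    rw [norm_mul, scl, norm_mul, Complex.norm_real, Real.norm_of_nonneg hr0.le]
    calc r * ‖f (r * t)‖ * ‖g (x - t)‖
        ≤ r * (C * Real.exp (-(β * |r * t|))) * (C' * Real.exp (-(β' * |x - t|))) := by
          gcongr
          · exact hf _
          · exact hg _
      _ ≤ r * (C * Real.exp (-(β * |r * t|))) *
          (C' * (Real.exp (-(β' * |x|)) * Real.exp (β' * |t|))) := by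
          gcongr
          exact exp_neg_abs_sub_le hβ'.le x t
      _ = C * C' * Real.exp (-(β' * |x|)) * r *
          (Real.exp (-(β * |r * t|)) * Real.exp (β' * |t|)) := by ring
      _ ≤ _ := by
          rw [← Real.exp_add, abs_mul, abs_of_pos hr0]
          gcongr
          have := abs_nonneg t
          nlinarith [mul_nonneg (mul_nonneg hβ'.le this) (sub_nonneg.2 hr)]
  calc ‖cv (scl r f) g x‖ ≤ ∫ t, C * C' * Real.exp (-(β' * |x|)) * r *
        Real.exp (-((β - β') * r * |t|)) :=
        norm_integral_le_of_norm_le ((integrable_exp_neg_abs hdr).const_mul _)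
          (Eventually.of_forall hb)
    _ = _ := by
        rw [integral_const_mul, integral_exp_neg_abs hdr]
        field_simp

/-- The gap between the rates is essential: the convolution of $e^{-\beta|x|}$ with itself carries
an additional factor of order $|x|$. -/
theorem Bd.cv {β β' : ℝ} (hβ' : 0 < β') (hβ : β' < β) {f g : ℝ → ℂ} (hf : Bd β f)
    (hg : Bd β' g) : Bd β' (cv f g) := by
  have hm := (integrable_cv (hf.integrable (hβ'.trans hβ)) (hg.integrable hβ')).aestronglyMeasurable
  obtain ⟨-, C, h0, hC⟩ := hf
  obtain ⟨-, C', h0', hC'⟩ := hg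
  have hd : 0 < β - β' := by linarith
  refine ⟨hm, C * C' * (2 / (β - β')), by positivity, fun x => ?_⟩
  have := norm_cv_scl_le hβ' hβ h0 hC hC' le_rfl x
  rwa [scl_one] at this

theorem Bd.pow_mul {β β' : ℝ} (hβ : β' < β) {g : ℝ → ℂ} (hg : Bd β g) (s : ℕ) :
    Bd β' (fun x => (x : ℂ) ^ s * g x) := by
  obtain ⟨hm, C, h0, hC⟩ := hg
  obtain ⟨K, hK0, hK⟩ := exists_pow_le_exp s (sub_pos.2 hβ)
  refine ⟨AEStronglyMeasurable.mul (by fun_prop) hm, K * C, by positivity, fun x => ?_⟩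
  rw [norm_mul, norm_pow, Complex.norm_real, Real.norm_eq_abs]
  calc |x| ^ s * ‖g x‖ ≤ (K * Real.exp ((β - β') * |x|)) * (C * Real.exp (-(β * |x|))) :=
        mul_le_mul (hK x) (hC x) (norm_nonneg _) (by positivity)
    _ = K * C * (Real.exp ((β - β') * |x|) * Real.exp (-(β * |x|))) := by ring
    _ = _ := by
        rw [← Real.exp_add]
        ring_nf

/-- A primitive of a function of integral zero is controlled by the tail towards either side. -/
theorem norm_integral_Iic_le {g : ℝ → ℂ} (hg : Integrable g) (h0 : ∫ y, g y = 0) {k : ℝ → ℝ}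
    (hk : Integrable k) (hk0 : ∀ y, 0 ≤ k y) (x A : ℝ) (hA : 0 ≤ A)
    (h : ∀ y, |x| ≤ |y| → 0 ≤ x * y → ‖g y‖ ≤ A * k y) :
    ‖∫ y in Set.Iic x, g y‖ ≤ A * ∫ y, k y := by
  have main : ∀ S : Set ℝ, MeasurableSet S → (∀ y ∈ S, ‖g y‖ ≤ A * k y) →
      ‖∫ y in S, g y‖ ≤ A * ∫ y, k y := by
    intro S hS hb
    rw [← integral_const_mul]
    refine (norm_integral_le_of_norm_le (hk.const_mul A).integrableOn
      ((ae_restrict_mem hS).mono hb)).trans ?_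
    exact setIntegral_le_integral (hk.const_mul A)
      (Eventually.of_forall fun y => mul_nonneg hA (hk0 y))
  rcases le_total x 0 with hx | hx
  · refine main _ measurableSet_Iic fun y (hy : y ≤ x) => h y ?_ ?_
    · rw [abs_of_nonpos hx, abs_of_nonpos (hy.trans hx)]
      linarith
    · nlinarith
  -- Because the total integral vanishes, the left tail may be replaced by the right one when
  -- $x\ge0$; the domain of integration then always lies beyond $x$ as seen from $0$.
  · have e : ∫ y in Set.Iic x, g y = - ∫ y in Set.Ioi x, g y := by
      have := integral_add_compl (measurableSet_Iic (a := x)) hg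
      rw [Set.compl_Iic, h0] at this
      exact eq_neg_of_add_eq_zero_left this
    rw [e, norm_neg]
    refine main _ measurableSet_Ioi fun y (hy : x < y) => h y ?_ ?_
    · rw [abs_of_nonneg hx, abs_of_nonneg (hx.trans hy.le)]
      linarith
    · nlinarith

/-- Beyond $x$ one has $e^{\beta|x|}\le e^{\beta|y|}$. One order of the chain is spent to turn
weighted integrability into a pointwise bound. -/
theorem Chain.bd_of_integrable {n : ℕ} {G : ℕ → ℝ → ℂ} (hG : Chain n G) {s : ℕ} (hs : s < n)
    {β : ℝ} (hβ : 0 ≤ β) (h : Integrable (fun x => Real.exp (β * |x|) * ‖G (s + 1) x‖)) :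
    Bd β (G s) := by
  refine ⟨(hG.integrable s hs.le).aestronglyMeasurable, ∫ x, Real.exp (β * |x|) * ‖G (s + 1) x‖,
    integral_nonneg fun x => by positivity, fun x => ?_⟩
  rw [hG.eq_integral s hs, mul_comm]
  refine norm_integral_Iic_le (hG.integrable _ hs) (hG.integral_eq_zero hs) h
    (fun y => by positivity) x _ (Real.exp_pos _).le fun y hy _ => ?_
  rw [← mul_assoc, ← Real.exp_add]
  refine le_mul_of_one_le_left (norm_nonneg _) (Real.one_le_exp ?_)
  nlinarith

/-- Beyond $x$ one has $|y|=|x|+|y-x|$, so $e^{-\beta|x|}$ factors out exactly and the primitive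
keeps the full rate. -/
theorem Bd.integral_Iic {β : ℝ} (hβ : 0 < β) {g : ℝ → ℂ} (hg : Bd β g) (h0 : ∫ y, g y = 0) :
    Bd β (fun x => ∫ y in Set.Iic x, g y) := by
  have hi := hg.integrable hβ
  obtain ⟨hm, C, hC0, hC⟩ := hg
  refine ⟨(continuous_integral_Iic hi).aestronglyMeasurable, C * (2 / β), by positivity,
    fun x => ?_⟩
  have hk : Integrable (fun y => Real.exp (-(β * |y - x|))) :=
    (integrable_exp_neg_abs hβ).comp_sub_right x
  have := norm_integral_Iic_le hi h0 hk (fun y => (Real.exp_pos _).le) x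
    (C * Real.exp (-(β * |x|))) (by positivity) (fun y hy hxy => ?_)
  · rw [integral_sub_right_eq_self (fun y => Real.exp (-(β * |y|))), integral_exp_neg_abs hβ] at this
    linarith
  · refine (hC y).trans (le_of_eq ?_)
    rw [mul_assoc, ← Real.exp_add]
    congr 2
    have : |y - x| = |y| - |x| := by
      rcases le_total 0 x with hx | hx
      · rcases eq_or_lt_of_le hx with rfl | hx'
        · simp
        · have hy0 : 0 ≤ y := by
            by_contra hn
            push Not at hn
            nlinarith
          rw [abs_of_nonneg hx, abs_of_nonneg hy0] at *
          rw [abs_of_nonneg (by linarith)]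
      · rcases eq_or_lt_of_le hx with rfl | hx'
        · simp
        · have hy0 : y ≤ 0 := by
            by_contra hn
            push Not at hn
            nlinarith
          rw [abs_of_nonpos hx, abs_of_nonpos hy0] at *
          rw [abs_of_nonpos (by linarith)]
          ring
    rw [this]
    ring

/-- A function with `n` vanishing moments is the top of a chain of length `n`. -/
theorem exists_chain_of_moments {β : ℝ} (hβ : 0 < β) (n : ℕ) : ∀ h : ℝ → ℂ, Continuous h →
    Bd β h → (∀ s < n, ∫ x : ℝ, (x : ℂ) ^ s * h x = 0) →
    ∃ Θ : ℕ → ℝ → ℂ, Chain n Θ ∧ Θ n = h ∧ ∀ s ≤ n, Bd β (Θ s) := by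
  induction n with
  | zero =>
    intro h _ hb _
    refine ⟨fun _ => h, ⟨fun s _ => hb.integrable hβ, fun s hs => absurd hs (by simp)⟩, rfl,
      fun _ _ => hb⟩
  | succ n ih =>
    intro h hc hb hm
    have hi := hb.integrable hβ
    have h0 : ∫ x, h x = 0 := by simpa using hm 0 (by simp)
    set h1 : ℝ → ℂ := fun x => ∫ y in Set.Iic x, h y with hh1
    have hb1 : Bd β h1 := hb.integral_Iic hβ h0
    -- Integration by parts gives $\int x^sh_1=-\int\frac{x^{s+1}}{s+1}h$: the zeroth moment of $h$
    -- makes $h_1$ decay, and the remaining moments shift down by one.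
    have hm1 : ∀ s < n, ∫ x : ℝ, (x : ℂ) ^ s * h1 x = 0 := by
      intro s hs
      have hd : ∀ x : ℝ, HasDerivAt (fun x : ℝ => (x : ℂ) ^ (s + 1) / (s + 1)) ((x : ℂ) ^ s) x := by
        intro x
        have h1 := ((hasDerivAt_id x).ofReal_comp.pow (s + 1)).div_const ((s : ℂ) + 1)
        refine h1.congr_deriv ?_
        have : (s : ℂ) + 1 ≠ 0 := by exact_mod_cast Nat.succ_ne_zero s
        field_simp
        simp
      have hhalf : β / 2 < β := by linarith
      have i1 : Integrable (fun x : ℝ => (x : ℂ) ^ s * h1 x) :=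
        (hb1.pow_mul hhalf s).integrable (by positivity)
      have i2 : Integrable (fun x : ℝ => (x : ℂ) ^ (s + 1) / (s + 1) * h x) := by
        refine (((hb.pow_mul hhalf (s + 1)).integrable (by positivity)).mul_const
          (((s : ℂ) + 1)⁻¹)).congr (Eventually.of_forall fun x => ?_)
        simp only [div_eq_mul_inv]
        ring
      have i3 : Integrable (fun x : ℝ => (x : ℂ) ^ (s + 1) / (s + 1) * h1 x) := by
        refine (((hb1.pow_mul hhalf (s + 1)).integrable (by positivity)).mul_const
          (((s : ℂ) + 1)⁻¹)).congr (Eventually.of_forall fun x => ?_)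
        simp only [div_eq_mul_inv]
        ring
      have := integral_mul_deriv_eq_deriv_mul_of_integrable (fun x _ => hd x)
        (fun x _ => hasDerivAt_integral_Iic hi hc x) i2 i1 i3
      have e : ∫ x : ℝ, (x : ℂ) ^ (s + 1) / (s + 1) * h x = 0 := by
        have := hm (s + 1) (by omega)
        simp_rw [div_mul_eq_mul_div]
        rw [integral_div, this, zero_div]
      rw [e] at this
      simpa using this.symm
    obtain ⟨Θ, hΘ, hΘn, hΘb⟩ := ih h1 (continuous_integral_Iic hi) hb1 hm1
    -- The chain ending in the primitive $h_1$ at index $n$ is extended by $h$ at index $n+1$.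
    refine ⟨Function.update Θ (n + 1) h, ⟨?_, ?_⟩, by simp, ?_⟩
    · intro s hs
      rcases eq_or_lt_of_le hs with rfl | hs
      · simpa using hi
      · rw [Function.update_of_ne hs.ne]
        exact hΘ.integrable s (by omega)
    · intro s hs x
      rw [Function.update_of_ne hs.ne]
      rcases eq_or_lt_of_le (Nat.le_of_lt_succ hs) with rfl | hs'
      · simp [hΘn, hh1]
      · rw [Function.update_of_ne (by omega)]
        exact hΘ.eq_integral s hs' x
    · intro s hs
      rcases eq_or_lt_of_le hs with rfl | hs
      · simpa using hb
      · rw [Function.update_of_ne hs.ne]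
        exact hΘb s (by omega)

/-- Decay in the ratio of the scales for the convolution of a function with vanishing moments and
a smooth one. -/
theorem exists_norm_cv_scl_le {β β' : ℝ} (hβ' : 0 < β') (hβ : β' < β) {n : ℕ} {h : ℝ → ℂ}
    (hc : Continuous h) (hb : Bd β h) (hm : ∀ s < n, ∫ x : ℝ, (x : ℂ) ^ s * h x = 0)
    {G : ℕ → ℝ → ℂ} (hG : Chain n G) (hGb : Bd β (G n)) :
    ∃ C : ℝ, 0 ≤ C ∧ ∀ r : ℝ, 1 ≤ r → ∀ x,
      ‖cv (scl r h) (G 0) x‖ ≤ C * (r ^ n)⁻¹ * Real.exp (-(β' * |x|)) := by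
  obtain ⟨Θ, hΘ, rfl, hΘb⟩ := exists_chain_of_moments (hβ'.trans hβ) n h hc hb hm
  obtain ⟨-, C, h0, hC⟩ := hΘb 0 (Nat.zero_le _)
  obtain ⟨-, C', h0', hC'⟩ := hGb.mono hβ.le
  have hd : 0 < β - β' := by linarith
  refine ⟨C * C' * (2 / (β - β')), by positivity, fun r hr x => ?_⟩
  have hr0 : 0 < r := by linarith
  -- With $h=\Theta_n$, the dilated chain has $r^n\cdot r\,h(r\cdot)$ on top and
  -- $r\,\Theta_0(r\cdot)$ at the bottom. Swapping against $G$ yields $r^n$ times the wanted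
  -- convolution on one side and, on the other, a convolution bounded uniformly in $r$.
  have e := congrFun ((hΘ.scl hr0).cv_swap hG) x
  have e1 : cv (fun x => (r : ℂ) ^ n * scl r (Θ n) x) (G 0) x =
      (r : ℂ) ^ n * cv (scl r (Θ n)) (G 0) x := by
    unfold cv
    rw [← integral_const_mul]
    simp_rw [mul_assoc]
  have e2 : cv (fun x => (r : ℂ) ^ 0 * scl r (Θ 0) x) (G n) x = cv (scl r (Θ 0)) (G n) x := by
    simp
  rw [e1, e2] at e
  have hb := norm_cv_scl_le hβ' hβ h0 hC hC' hr x
  rw [e, norm_mul, norm_pow, Complex.norm_real, Real.norm_of_nonneg hr0.le] at hb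
  rw [mul_right_comm, ← div_eq_mul_inv, le_div_iff₀ (by positivity)]
  linarith

/-! ### The weighted classes on the line -/

/-- Jensen's inequality for an average with weight `k`. -/
theorem lintegral_mul_rpow_le {α : Type*} [MeasurableSpace α] {μ : Measure α} {k g : α → ℝ≥0∞}
    (hk : AEMeasurable k μ) (hg : AEMeasurable g μ) {p : ℝ} (hp : 1 ≤ p) :
    (∫⁻ x, k x * g x ∂μ) ^ p ≤ (∫⁻ x, k x ∂μ) ^ (p - 1) * ∫⁻ x, k x * g x ^ p ∂μ := by
  rcases eq_or_lt_of_le hp with rfl | hp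
  · simp
  have hp0 : 0 < p := by linarith
  have hpq := Real.HolderConjugate.conjExponent hp
  set q := p.conjExponent with hq
  have hsum : 1 / p + 1 / q = 1 := by simpa using hpq.inv_add_inv_eq_one
  have hq0 : 0 < q := hpq.symm.pos
  -- The splitting $k=k^{1/p}k^{1/q}$ prepares Hölder's inequality.
  have e : ∀ x, k x * g x = (fun x => k x ^ (1 / p) * g x) x * (fun x => k x ^ (1 / q)) x := by
    intro x
    simp only
    rw [mul_right_comm, ← ENNReal.rpow_add_of_nonneg _ _ (by positivity) (by positivity), hsum,
      ENNReal.rpow_one]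
  have h := ENNReal.lintegral_mul_le_Lp_mul_Lq μ hpq ((hk.pow_const (1 / p)).mul hg)
    (hk.pow_const (1 / q))
  simp only [Pi.mul_apply] at h
  simp_rw [e]
  have h2 := ENNReal.rpow_le_rpow h hp0.le
  refine h2.trans (le_of_eq ?_)
  rw [ENNReal.mul_rpow_of_nonneg _ _ hp0.le, ← ENNReal.rpow_mul, ← ENNReal.rpow_mul,
    one_div_mul_cancel hp0.ne', ENNReal.rpow_one, mul_comm]
  congr 1
  · have e3 : 1 / q * p = p - 1 := by
      have : 1 / q = 1 - 1 / p := by linarith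
      rw [this]
      field_simp
    rw [e3]
    congr 1
    refine lintegral_congr fun x => ?_
    rw [← ENNReal.rpow_mul, one_div_mul_cancel hq0.ne', ENNReal.rpow_one]
  · refine lintegral_congr fun x => ?_
    rw [ENNReal.mul_rpow_of_nonneg _ _ hp0.le, ← ENNReal.rpow_mul, one_div_mul_cancel hp0.ne',
      ENNReal.rpow_one]

/-- The weight `e^{b|x|}(1 + |x|)^n`. -/
noncomputable def wt (b : ℝ) (n : ℕ) (x : ℝ) : ℝ := Real.exp (b * |x|) * (1 + |x|) ^ n

theorem wt_pos (b : ℝ) (n : ℕ) (x : ℝ) : 0 < wt b n x := by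
  unfold wt
  positivity

theorem continuous_wt (b : ℝ) (n : ℕ) : Continuous (wt b n) := by
  unfold wt
  fun_prop

theorem one_le_wt {b : ℝ} (hb : 0 ≤ b) (n : ℕ) (x : ℝ) : 1 ≤ wt b n x :=
  one_le_mul_of_one_le_of_one_le (Real.one_le_exp (by positivity))
    (one_le_pow₀ (by linarith [abs_nonneg x]))

theorem wt_neg (b : ℝ) (n : ℕ) (x : ℝ) : wt b n (-x) = wt b n x := by
  simp [wt]

theorem wt_add_le {b : ℝ} (hb : 0 ≤ b) (n : ℕ) (x y : ℝ) :
    wt b n (x + y) ≤ wt b n x * wt b n y := by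
  have h := abs_add_le x y
  have h1 : wt b n x * wt b n y =
      Real.exp (b * (|x| + |y|)) * ((1 + |x|) * (1 + |y|)) ^ n := by
    unfold wt
    rw [mul_add, Real.exp_add, mul_pow]
    ring
  rw [h1, wt]
  gcongr
  nlinarith [abs_nonneg x, abs_nonneg y, mul_nonneg (abs_nonneg x) (abs_nonneg y)]

/-- Unlike in `wt_add_le`, the polynomial factor falls on one argument at a time. The other argument
keeps a pure exponential, against which the functions of the weighted class are $L^1$ and not merely
$L^2$. -/
theorem wt_add_le_add {b : ℝ} (hb : 0 ≤ b) (n : ℕ) (x y : ℝ) :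
    wt b n (x + y) ≤ 2 ^ n * (wt b n x * Real.exp (b * |y|) + Real.exp (b * |x|) * wt b n y) := by
  have h := abs_add_le x y
  have h1 : (1 + |x + y|) ^ n ≤ 2 ^ n * ((1 + |x|) ^ n + (1 + |y|) ^ n) := by
    have hm : 1 + |x + y| ≤ 2 * max (1 + |x|) (1 + |y|) := by
      have h1 := le_max_left (1 + |x|) (1 + |y|)
      have h2 := le_max_right (1 + |x|) (1 + |y|)
      linarith
    calc (1 + |x + y|) ^ n ≤ (2 * max (1 + |x|) (1 + |y|)) ^ n := by gcongr
      _ = 2 ^ n * (max (1 + |x|) (1 + |y|)) ^ n := mul_pow _ _ _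
      _ ≤ _ := by
        gcongr
        rcases le_total (1 + |x|) (1 + |y|) with h | h
        · rw [max_eq_right h]
          linarith [pow_nonneg (by positivity : 0 ≤ 1 + |x|) n]
        · rw [max_eq_left h]
          linarith [pow_nonneg (by positivity : 0 ≤ 1 + |y|) n]
  calc wt b n (x + y) ≤ Real.exp (b * (|x| + |y|)) * (2 ^ n * ((1 + |x|) ^ n + (1 + |y|) ^ n)) := by
        unfold wt
        gcongr
    _ = _ := by
        unfold wt
        rw [mul_add, Real.exp_add]
        ring

theorem wt_mono {b : ℝ} (hb : 0 ≤ b) (n : ℕ) {x y : ℝ} (h : |x| ≤ |y|) : wt b n x ≤ wt b n y := by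
  unfold wt
  gcongr

/-- `g` is measurable and `e^{b|x|}(1 + |x|)^n g ∈ L²`. -/
def MemW (b : ℝ) (n : ℕ) (g : ℝ → ℂ) : Prop :=
  MemLp (fun x => (wt b n x : ℂ) * g x) 2 volume

theorem MemW.aestronglyMeasurable {b : ℝ} {n : ℕ} {g : ℝ → ℂ} (hg : MemW b n g) :
    AEStronglyMeasurable g volume := by
  have h1 : Continuous fun x => ((wt b n x)⁻¹ : ℝ) :=
    (continuous_wt b n).inv₀ fun x => (wt_pos b n x).ne'
  have h2 : AEStronglyMeasurable (fun x => (((wt b n x)⁻¹ : ℝ) : ℂ)) volume :=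
    (Complex.continuous_ofReal.comp h1).aestronglyMeasurable
  refine (h2.mul hg.1).congr (Eventually.of_forall fun x => ?_)
  have : (wt b n x : ℂ) ≠ 0 := by exact_mod_cast (wt_pos b n x).ne'
  simp only [Pi.mul_apply]
  push_cast
  field_simp

theorem MemW.congr_ae {b : ℝ} {n : ℕ} {g h : ℝ → ℂ} (hg : MemW b n g) (e : g =ᵐ[volume] h) :
    MemW b n h :=
  (memLp_congr_ae (e.mono fun x hx => by simp [hx])).1 hg

theorem MemW.add {b : ℝ} {n : ℕ} {g h : ℝ → ℂ} (hg : MemW b n g) (hh : MemW b n h) :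
    MemW b n (fun x => g x + h x) := by
  have := MemLp.add hg hh
  refine (memLp_congr_ae (Eventually.of_forall fun x => ?_)).1 this
  simp only [Pi.add_apply]
  ring

theorem MemW.const_mul {b : ℝ} {n : ℕ} {g : ℝ → ℂ} (hg : MemW b n g) (c : ℂ) :
    MemW b n (fun x => c * g x) := by
  have := MemLp.const_mul hg c
  refine (memLp_congr_ae (Eventually.of_forall fun x => ?_)).1 this
  simp only
  ring

theorem MemW.sub {b : ℝ} {n : ℕ} {g h : ℝ → ℂ} (hg : MemW b n g) (hh : MemW b n h) :
    MemW b n (fun x => g x - h x) := by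
  have := hg.add (hh.const_mul (-1))
  simpa [sub_eq_add_neg] using this

theorem MemW.norm {b : ℝ} {n : ℕ} {g : ℝ → ℂ} (hg : MemW b n g) :
    MemW b n (fun x => ((‖g x‖ : ℝ) : ℂ)) := by
  have h2 : AEStronglyMeasurable (fun x => ((‖g x‖ : ℝ) : ℂ)) volume :=
    Complex.continuous_ofReal.comp_aestronglyMeasurable hg.aestronglyMeasurable.norm
  refine MemLp.mono hg (AEStronglyMeasurable.mul
    (Complex.continuous_ofReal.comp (continuous_wt b n)).aestronglyMeasurable h2) ?_
  exact Eventually.of_forall fun x => by simp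

theorem MemW.memLp {b : ℝ} (hb : 0 ≤ b) {n : ℕ} {g : ℝ → ℂ} (hg : MemW b n g) :
    MemLp g 2 volume := by
  refine MemLp.mono hg hg.aestronglyMeasurable (Eventually.of_forall fun x => ?_)
  rw [norm_mul, Complex.norm_real, Real.norm_of_nonneg (wt_pos b n x).le]
  exact le_mul_of_one_le_left (norm_nonneg _) (one_le_wt hb n x)

/-- Cauchy–Schwarz with $(1+|x|)^{-1}\in L^2$: the polynomial weights in the norm buy integrability
at the full exponential rate $b$. -/
theorem MemW.integrable_exp {b : ℝ} {n : ℕ} (hn : 1 ≤ n) {g : ℝ → ℂ} (hg : MemW b n g) :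
    Integrable (fun x => Real.exp (b * |x|) * ‖g x‖) := by
  have h1 : MemLp (fun x : ℝ => (1 + ‖x‖) ^ (-1 : ℝ)) 2 volume := by
    rw [memLp_two_iff_integrable_sq_norm]
    · have h0 : Integrable (fun x : ℝ => (1 + ‖x‖) ^ (-2 : ℝ)) :=
        integrable_one_add_norm (E := ℝ) (r := 2) (by simp)
      refine h0.congr (Eventually.of_forall fun y => ?_)
      have : 0 < 1 + ‖y‖ := by positivity
      show (1 + ‖y‖) ^ (-2 : ℝ) = ‖(1 + ‖y‖) ^ (-1 : ℝ)‖ ^ 2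
      rw [Real.norm_of_nonneg (Real.rpow_nonneg this.le _), ← Real.rpow_natCast, ← Real.rpow_mul this.le]
      norm_num
    · exact Measurable.aestronglyMeasurable (by fun_prop)
  have h2 := MemLp.integrable_mul h1 (MemLp.norm hg)
  refine h2.mono' ?_ (Eventually.of_forall fun x => ?_)
  · exact (by fun_prop : Continuous fun x : ℝ => Real.exp (b * |x|)).aestronglyMeasurable.mul
      hg.aestronglyMeasurable.norm
  · simp only [Pi.mul_apply, norm_mul, norm_norm, Complex.norm_real,
      Real.norm_of_nonneg (wt_pos b n x).le, Real.norm_of_nonneg (Real.exp_pos _).le]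
    rw [← mul_assoc]
    gcongr
    have h0 : 0 < 1 + |x| := by positivity
    rw [Real.norm_eq_abs, Real.rpow_neg_one, wt, mul_left_comm]
    refine le_mul_of_one_le_right (Real.exp_pos _).le ?_
    rw [inv_mul_eq_div, le_div_iff₀ h0, one_mul]
    exact le_self_pow₀ (by linarith [abs_nonneg x]) (by omega)

theorem MemW.integrable {b : ℝ} (hb : 0 ≤ b) {n : ℕ} (hn : 1 ≤ n) {g : ℝ → ℂ} (hg : MemW b n g) :
    Integrable g := by
  refine (hg.integrable_exp hn).mono' hg.aestronglyMeasurable (Eventually.of_forall fun x => ?_)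
  exact le_mul_of_one_le_left (norm_nonneg _) (Real.one_le_exp (by positivity))

theorem MemW.scl {b : ℝ} (hb : 0 ≤ b) {n : ℕ} {g : ℝ → ℂ} (hg : MemW b n g) {r : ℝ}
    (hr : 1 ≤ r) : MemW b n (scl r g) := by
  have hr0 : 0 < r := by linarith
  have hq : Measure.QuasiMeasurePreserving (fun x : ℝ => r * x) volume volume := by
    refine ⟨by fun_prop, ?_⟩
    rw [show (fun x : ℝ => r * x) = (r * ·) from rfl, Real.map_volume_mul_left hr0.ne']
    exact Measure.smul_absolutelyContinuous
  have hm : AEStronglyMeasurable (ExpBesov.scl r g) volume :=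
    (hg.aestronglyMeasurable.comp_quasiMeasurePreserving hq).const_mul _
  have hm2 : AEStronglyMeasurable (fun x => (wt b n x : ℂ) * ExpBesov.scl r g x) volume :=
    AEStronglyMeasurable.mul
      (Complex.continuous_ofReal.comp (continuous_wt b n)).aestronglyMeasurable hm
  unfold MemW at hg ⊢
  rw [memLp_two_iff_integrable_sq_norm hg.1] at hg
  rw [memLp_two_iff_integrable_sq_norm hm2]
  refine ((hg.comp_mul_left' hr0.ne').const_mul (r ^ 2)).mono' (hm2.norm.pow 2)
    (Eventually.of_forall fun x => ?_)
  rw [Real.norm_of_nonneg (by positivity), ExpBesov.scl]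
  simp only [norm_mul, Complex.norm_real, Real.norm_of_nonneg hr0.le,
    Real.norm_of_nonneg (wt_pos b n _).le]
  have : wt b n x ≤ wt b n (r * x) := by
    refine wt_mono hb n ?_
    rw [abs_mul, abs_of_pos hr0]
    exact le_mul_of_one_le_left (abs_nonneg x) hr
  calc (wt b n x * (r * ‖g (r * x)‖)) ^ 2 ≤ (wt b n (r * x) * (r * ‖g (r * x)‖)) ^ 2 := by
        have := (wt_pos b n x).le
        gcongr
    _ = _ := by ring

/-- The `L²` norm of `|f| * |g|` is at most the `L¹` norm of `f` times the `L²` norm of `g`. -/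
theorem lintegral_conv_sq_le {f g : ℝ → ℂ} (hf : AEStronglyMeasurable f volume)
    (hg : AEStronglyMeasurable g volume) :
    ∫⁻ x, (∫⁻ t, ‖f t‖ₑ * ‖g (x - t)‖ₑ) ^ (2 : ℝ) ≤
      (∫⁻ t, ‖f t‖ₑ) ^ (2 : ℝ) * ∫⁻ t, ‖g t‖ₑ ^ (2 : ℝ) := by
  have hm : AEMeasurable (fun p : ℝ × ℝ => ‖f p.2‖ₑ * ‖g (p.1 - p.2)‖ₑ ^ (2 : ℝ))
      (volume.prod volume) := by
    have h1 : AEMeasurable (fun p : ℝ × ℝ => ‖f p.2‖ₑ) (volume.prod volume) :=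
      hf.enorm.comp_snd
    have h2 : AEMeasurable (fun p : ℝ × ℝ => ‖g (p.1 - p.2)‖ₑ) (volume.prod volume) :=
      hg.enorm.comp_quasiMeasurePreserving (quasiMeasurePreserving_sub_of_right_invariant volume volume)
    exact h1.mul (h2.pow_const _)
  calc ∫⁻ x, (∫⁻ t, ‖f t‖ₑ * ‖g (x - t)‖ₑ) ^ (2 : ℝ)
      ≤ ∫⁻ x, (∫⁻ t, ‖f t‖ₑ) ^ ((2 : ℝ) - 1) * ∫⁻ t, ‖f t‖ₑ * ‖g (x - t)‖ₑ ^ (2 : ℝ) := by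
        refine lintegral_mono fun x => lintegral_mul_rpow_le hf.enorm ?_ (by norm_num)
        exact hg.enorm.comp_quasiMeasurePreserving
          (quasiMeasurePreserving_sub_left_of_right_invariant volume x)
    _ = (∫⁻ t, ‖f t‖ₑ) ^ ((2 : ℝ) - 1) * ∫⁻ x, ∫⁻ t, ‖f t‖ₑ * ‖g (x - t)‖ₑ ^ (2 : ℝ) :=
        lintegral_const_mul'' _ hm.lintegral_prod_right'
    _ = (∫⁻ t, ‖f t‖ₑ) ^ ((2 : ℝ) - 1) * ∫⁻ t, ‖f t‖ₑ * ∫⁻ x, ‖g x‖ₑ ^ (2 : ℝ) := by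
        rw [lintegral_lintegral_swap hm]
        congr 1
        refine lintegral_congr fun t => ?_
        rw [lintegral_const_mul' _ _ enorm_ne_top,
          lintegral_sub_right_eq_self (fun x => ‖g x‖ₑ ^ (2 : ℝ)) t]
    _ = _ := by
        rw [lintegral_mul_const'' _ hf.enorm, ← mul_assoc]
        congr 1
        rw [show (2 : ℝ) - 1 = 1 by norm_num, ENNReal.rpow_one]
        simp [sq]

/-- By `wt_add_le_add` the weighted convolution is at most $2^n$ times the sum of two convolutions,
each of an exponentially weighted $L^1$ function with a fully weighted $L^2$ function; Young's
inequality bounds both in $L^2$. -/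
theorem MemW.cv {b : ℝ} (hb : 0 ≤ b) {n : ℕ} (hn : 1 ≤ n) {f g : ℝ → ℂ} (hf : MemW b n f)
    (hg : MemW b n g) : MemW b n (cv f g) := by
  have hfi := hf.integrable_exp hn
  have hgi := hg.integrable_exp hn
  set ef : ℝ → ℂ := fun x => ((Real.exp (b * |x|) : ℝ) : ℂ) * f x with hef
  set eg : ℝ → ℂ := fun x => ((Real.exp (b * |x|) : ℝ) : ℂ) * g x with heg
  set wf : ℝ → ℂ := fun x => (wt b n x : ℂ) * f x with hwf
  set wg : ℝ → ℂ := fun x => (wt b n x : ℂ) * g x with hwg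
  have hec : AEStronglyMeasurable (fun x : ℝ => ((Real.exp (b * |x|) : ℝ) : ℂ)) volume :=
    (by fun_prop : Continuous fun x : ℝ => ((Real.exp (b * |x|) : ℝ) : ℂ)).aestronglyMeasurable
  have hef' : Integrable ef := by
    refine hfi.mono' (hec.mul hf.aestronglyMeasurable) (Eventually.of_forall fun x => ?_)
    rw [hef, norm_mul, Complex.norm_real, Real.norm_of_nonneg (Real.exp_pos _).le]
  have heg' : Integrable eg := by
    refine hgi.mono' (hec.mul hg.aestronglyMeasurable) (Eventually.of_forall fun x => ?_)
    rw [heg, norm_mul, Complex.norm_real, Real.norm_of_nonneg (Real.exp_pos _).le]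
  have hwf2 : ∫⁻ t, ‖wf t‖ₑ ^ (2 : ℝ) < ⊤ := by
    have := (eLpNorm_lt_top_iff_lintegral_rpow_enorm_lt_top (by norm_num) (by norm_num)).1 hf.2
    rwa [show (2 : ℝ≥0∞).toReal = 2 by norm_num] at this
  have hwg2 : ∫⁻ t, ‖wg t‖ₑ ^ (2 : ℝ) < ⊤ := by
    have := (eLpNorm_lt_top_iff_lintegral_rpow_enorm_lt_top (by norm_num) (by norm_num)).1 hg.2
    rwa [show (2 : ℝ≥0∞).toReal = 2 by norm_num] at this
  have hcm : AEStronglyMeasurable (ExpBesov.cv f g) volume :=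
    (integrable_cv (hf.integrable hb hn) (hg.integrable hb hn)).aestronglyMeasurable
  set A : ℝ → ℝ≥0∞ := fun x => ∫⁻ t, ‖eg t‖ₑ * ‖wf (x - t)‖ₑ with hA
  set B : ℝ → ℝ≥0∞ := fun x => ∫⁻ t, ‖ef t‖ₑ * ‖wg (x - t)‖ₑ with hB
  have hAB : ∀ x, ‖(wt b n x : ℂ) * ExpBesov.cv f g x‖ₑ ≤ 2 ^ n * (A x + B x) := by
    intro x
    have e1 : A x = ∫⁻ t, ‖wf t‖ₑ * ‖eg (x - t)‖ₑ := by
      rw [hA]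
      simp only
      rw [← lintegral_sub_left_eq_self (fun t => ‖wf t‖ₑ * ‖eg (x - t)‖ₑ) x]
      refine lintegral_congr fun t => ?_
      rw [sub_sub_cancel, mul_comm]
    have mwf : AEMeasurable (fun t => ‖wf t‖ₑ * ‖eg (x - t)‖ₑ) volume :=
      hf.1.enorm.mul (heg'.1.enorm.comp_quasiMeasurePreserving
          (quasiMeasurePreserving_sub_left_of_right_invariant volume x))
    rw [e1, hB]
    simp only
    rw [← lintegral_add_left' mwf, ← lintegral_const_mul' _ _ (by simp), enorm_mul]
    unfold ExpBesov.cv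
    refine (mul_le_mul_right (enorm_integral_le_lintegral_enorm _) _).trans ?_
    rw [← lintegral_const_mul' _ _ enorm_ne_top]
    refine lintegral_mono fun t => ?_
    simp only [hwf, hwg, hef, heg, enorm_mul]
    have hw : ∀ y, ‖(wt b n y : ℂ)‖ₑ = ENNReal.ofReal (wt b n y) := fun y => by
      rw [← ofReal_norm, Complex.norm_real, Real.norm_of_nonneg (wt_pos b n y).le]
    have he : ∀ y : ℝ, ‖((Real.exp (b * |y|) : ℝ) : ℂ)‖ₑ = ENNReal.ofReal (Real.exp (b * |y|)) :=
      fun y => by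
        rw [← ofReal_norm, Complex.norm_real, Real.norm_of_nonneg (Real.exp_pos _).le]
    rw [hw, hw, hw, he, he]
    have key : ENNReal.ofReal (wt b n x) ≤ 2 ^ n * (ENNReal.ofReal (wt b n t) *
        ENNReal.ofReal (Real.exp (b * |x - t|)) + ENNReal.ofReal (Real.exp (b * |t|)) *
        ENNReal.ofReal (wt b n (x - t))) := by
      have h := wt_add_le_add hb n t (x - t)
      rw [add_sub_cancel] at h
      have h0 := (wt_pos b n t).le
      have h1 := (wt_pos b n (x - t)).le
      have := ENNReal.ofReal_le_ofReal h
      rw [ENNReal.ofReal_mul (by positivity), ENNReal.ofReal_add (by positivity) (by positivity),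
        ENNReal.ofReal_mul h0, ENNReal.ofReal_mul (by positivity),
        ENNReal.ofReal_pow (by norm_num)] at this
      simpa using this
    calc ENNReal.ofReal (wt b n x) * (‖f t‖ₑ * ‖g (x - t)‖ₑ)
        ≤ _ := mul_le_mul_left key _
      _ = _ := by ring
  refine ⟨AEStronglyMeasurable.mul
    (Complex.continuous_ofReal.comp (continuous_wt b n)).aestronglyMeasurable hcm, ?_⟩
  rw [eLpNorm_lt_top_iff_lintegral_rpow_enorm_lt_top (by norm_num) (by norm_num),
    show (2 : ℝ≥0∞).toReal = 2 by norm_num]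
  have hA2 : ∫⁻ x, A x ^ (2 : ℝ) < ⊤ :=
    (lintegral_conv_sq_le heg'.1 hf.1).trans_lt (ENNReal.mul_lt_top
      (ENNReal.rpow_lt_top_of_nonneg (by norm_num) heg'.2.ne) hwf2)
  have hB2 : ∫⁻ x, B x ^ (2 : ℝ) < ⊤ :=
    (lintegral_conv_sq_le hef'.1 hg.1).trans_lt (ENNReal.mul_lt_top
      (ENNReal.rpow_lt_top_of_nonneg (by norm_num) hef'.2.ne) hwg2)
  have hbd : ∀ x, ‖(wt b n x : ℂ) * ExpBesov.cv f g x‖ₑ ^ (2 : ℝ) ≤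
      (2 ^ n) ^ (2 : ℝ) * (2 ^ ((2 : ℝ) - 1) * (A x ^ (2 : ℝ) + B x ^ (2 : ℝ))) := by
    intro x
    refine (ENNReal.rpow_le_rpow (hAB x) (by norm_num)).trans ?_
    rw [ENNReal.mul_rpow_of_nonneg _ _ (by norm_num)]
    gcongr
    exact ENNReal.rpow_add_le_mul_rpow_add_rpow _ _ (by norm_num)
  refine (lintegral_mono hbd).trans_lt ?_
  have c1 : ((2 : ℝ≥0∞) ^ n) ^ (2 : ℝ) ≠ ⊤ := ENNReal.rpow_ne_top_of_nonneg (by norm_num) (by simp)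
  have c2 : (2 : ℝ≥0∞) ^ ((2 : ℝ) - 1) ≠ ⊤ := ENNReal.rpow_ne_top_of_nonneg (by norm_num) (by simp)
  rw [lintegral_const_mul' _ _ c1, lintegral_const_mul' _ _ c2]
  refine ENNReal.mul_lt_top c1.lt_top (ENNReal.mul_lt_top c2.lt_top ?_)
  have mA : AEMeasurable (fun x => A x ^ (2 : ℝ)) volume := by
    refine AEMeasurable.pow_const ?_ _
    have h1 : AEMeasurable (fun p : ℝ × ℝ => ‖eg p.2‖ₑ) (volume.prod volume) :=
      heg'.1.enorm.comp_snd
    have h2 : AEMeasurable (fun p : ℝ × ℝ => ‖wf (p.1 - p.2)‖ₑ) (volume.prod volume) :=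
      hf.1.enorm.comp_quasiMeasurePreserving
        (quasiMeasurePreserving_sub_of_right_invariant volume volume)
    exact (h1.mul h2).lintegral_prod_right'
  rw [lintegral_add_left' mA]
  exact ENNReal.add_lt_top.2 ⟨hA2, hB2⟩

/-- The convolution of functions of the weighted class converges absolutely everywhere. -/
theorem MemW.integrable_conv {b : ℝ} (hb : 0 ≤ b) {n : ℕ} {f g : ℝ → ℂ} (hf : MemW b n f)
    (hg : MemW b n g) (x : ℝ) : Integrable (fun t => f t * g (x - t)) :=
  MemLp.integrable_mul (hf.memLp hb)
    ((hg.memLp hb).comp_measurePreserving (Measure.measurePreserving_sub_left volume x))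

/-! ### Functions with weak derivatives as chains of primitives -/

theorem partialD_comp_apply (τ : ℝ → ℝ) :
    partialD (0 : Fin 1) (fun x : Fin 1 → ℝ => τ (x 0)) = fun x => deriv τ (x 0) := by
  funext x
  unfold partialD lineDeriv
  have : (fun t : ℝ => τ ((x + t • (Pi.single (0 : Fin 1) (1 : ℝ) : Fin 1 → ℝ)) 0)) =
      fun t => τ (x 0 + t) := by
    funext t
    simp
  rw [this]
  simpa using deriv_comp_const_add (f := τ) (x 0) 0

theorem multiD_comp_apply (τ : ℝ → ℝ) (s : ℕ) :
    multiD (fun _ : Fin 1 => s) (fun x : Fin 1 → ℝ => τ (x 0)) = fun x => deriv^[s] τ (x 0) := by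
  unfold multiD
  have e : List.finRange 1 = [0] := rfl
  rw [e, List.foldr_cons, List.foldr_nil]
  induction s with
  | zero => rfl
  | succ s ih =>
    rw [Function.iterate_succ_apply', ih,
      partialD_comp_apply, Function.iterate_succ_apply']

theorem hasCompactSupport_comp_apply {τ : ℝ → ℝ} (hτ : HasCompactSupport τ) :
    HasCompactSupport (fun x : Fin 1 → ℝ => τ (x 0)) := by
  have := hτ.comp_homeomorph (Homeomorph.funUnique (Fin 1) ℝ)
  exact this

theorem integral_comp_apply (F : ℝ → ℂ) : ∫ x : Fin 1 → ℝ, F (x 0) = ∫ t, F t :=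
  (volume_preserving_funUnique (Fin 1) ℝ).integral_comp
    (MeasurableEquiv.funUnique (Fin 1) ℝ).measurableEmbedding F

theorem apply_zero_eta {γ : Type*} (F : (Fin 1 → ℝ) → γ) : (fun x : Fin 1 → ℝ => F fun _ => x 0) = F := by
  funext x
  congr 1
  funext i
  rw [Subsingleton.elim i 0]

theorem measurePreserving_const : MeasurePreserving (fun t : ℝ => fun _ : Fin 1 => t) volume volume :=
  (volume_preserving_funUnique (Fin 1) ℝ).symm

/-- The powers $0$ and $n$ of $x$ suffice, because $(1+|x|)^n\le2^n(1+|x|^n)$. -/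
theorem memW_of_eLpNorm {b : ℝ} {n : ℕ} {g : ℝ → ℂ} (hg : AEStronglyMeasurable g volume)
    (h0 : eLpNorm (fun x => ((Real.exp (b * |x|) : ℝ) : ℂ) * g x) 2 volume < ⊤)
    (hn : eLpNorm (fun x => ((Real.exp (b * |x|) * x ^ n : ℝ) : ℂ) * g x) 2 volume < ⊤) :
    MemW b n g := by
  have m0 : MemLp (fun x => ((Real.exp (b * |x|) : ℝ) : ℂ) * g x) 2 volume :=
    ⟨AEStronglyMeasurable.mul (by fun_prop) hg, h0⟩
  have mn : MemLp (fun x => ((Real.exp (b * |x|) * x ^ n : ℝ) : ℂ) * g x) 2 volume :=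
    ⟨AEStronglyMeasurable.mul (by fun_prop) hg, hn⟩
  have ms := (m0.norm.add mn.norm).const_mul (2 ^ n : ℝ)
  refine ms.mono' (AEStronglyMeasurable.mul
    (Complex.continuous_ofReal.comp (continuous_wt b n)).aestronglyMeasurable hg)
    (Eventually.of_forall fun x => ?_)
  simp only [Pi.add_apply, norm_mul, Complex.norm_real, Real.norm_of_nonneg (wt_pos b n x).le,
    Real.norm_of_nonneg (Real.exp_pos _).le, norm_pow]
  rw [Real.norm_eq_abs, wt]
  have h1 : (1 + |x|) ^ n ≤ 2 ^ n * (1 + |x| ^ n) := by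
    have hm : 1 + |x| ≤ 2 * max 1 |x| := by
      have h1 := le_max_left 1 |x|
      have h2 := le_max_right 1 |x|
      linarith
    calc (1 + |x|) ^ n ≤ (2 * max 1 |x|) ^ n := by gcongr
      _ = 2 ^ n * (max 1 |x|) ^ n := mul_pow _ _ _
      _ ≤ _ := by
        gcongr
        rcases le_total 1 |x| with h | h
        · rw [max_eq_right h]
          linarith
        · rw [max_eq_left h, one_pow]
          linarith [pow_nonneg (abs_nonneg x) n]
  calc Real.exp (b * |x|) * (1 + |x|) ^ n * ‖g x‖
      ≤ Real.exp (b * |x|) * (2 ^ n * (1 + |x| ^ n)) * ‖g x‖ := by gcongr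
    _ = _ := by ring

/-- The weak derivative relation extends to bounded smooth test functions. -/
theorem integral_mul_deriv_of_bounded {u v : ℝ → ℂ} (hu : Integrable u) (hv : Integrable v)
    (h : ∀ t : ℝ → ℝ, ContDiff ℝ ∞ t → HasCompactSupport t →
      ∫ x, u x * ((deriv t x : ℝ) : ℂ) = - ∫ x, v x * (t x : ℂ))
    {T : ℝ → ℝ} (hT : ContDiff ℝ ∞ T) {B : ℝ} (hB : ∀ x, |T x| ≤ B) (hB' : ∀ x, |deriv T x| ≤ B) :
    ∫ x, u x * ((deriv T x : ℝ) : ℂ) = - ∫ x, v x * (T x : ℂ) := by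
  have hB0 : 0 ≤ B := (abs_nonneg _).trans (hB 0)
  -- Cut-off by $\chi(x/(m+1))$: the derivative that falls on the cut-off is $O(1/m)$, and dominated
  -- convergence removes the cut-off.
  let χ : ContDiffBump (0 : ℝ) := ⟨1, 2, by norm_num, by norm_num⟩
  have hχ : ContDiff ℝ ∞ χ := χ.contDiff
  have hχc : HasCompactSupport χ := χ.hasCompactSupport
  have hχ1 : ∀ x, |χ x| ≤ 1 := fun x => by
    rw [abs_of_nonneg χ.nonneg]
    exact χ.le_one
  have hχ0 : χ 0 = 1 := χ.one_of_mem_closedBall (by simp [χ])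
  have hχd : Continuous (deriv χ) := hχ.continuous_deriv (by simp)
  obtain ⟨D, hD⟩ := hχc.deriv.exists_bound_of_continuous hχd
  have hD0 : 0 ≤ D := (norm_nonneg _).trans (hD 0)
  set ε : ℕ → ℝ := fun m => 1 / ((m : ℝ) + 1) with hε
  have hε0 : Tendsto ε atTop (𝓝 0) := tendsto_one_div_add_atTop_nhds_zero_nat
  have hεp : ∀ m, 0 < ε m := fun m => by rw [hε]; positivity
  have hε1 : ∀ m, ε m ≤ 1 := fun m => by
    rw [hε]
    simp only
    rw [div_le_one (by positivity)]
    linarith [Nat.cast_nonneg (α := ℝ) m]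
  set c : ℕ → ℝ → ℝ := fun m x => χ (ε m * x) with hc
  have hcd : ∀ m, ContDiff ℝ ∞ (c m) := fun m => hχ.comp (contDiff_const.mul contDiff_id)
  have hcc : ∀ m, HasCompactSupport (c m) := fun m =>
    hχc.comp_homeomorph (Homeomorph.mulLeft₀ (ε m) (hεp m).ne')
  have hder : ∀ m x, deriv (fun y => T y * c m y) x =
      deriv T x * c m x + T x * (ε m * deriv χ (ε m * x)) := by
    intro m x
    have h1 : HasDerivAt T (deriv T x) x := (hT.differentiable (by simp) x).hasDerivAt
    have h2 : HasDerivAt (c m) (ε m * deriv χ (ε m * x)) x := by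
      have h3 : HasDerivAt χ (deriv χ (ε m * x)) (ε m * x) :=
        (hχ.differentiable (by simp) _).hasDerivAt
      have := h3.comp x ((hasDerivAt_id x).const_mul (ε m))
      exact this.congr_deriv (by simp [mul_comm])
    exact (h1.mul h2).deriv
  have hcl : ∀ x, Tendsto (fun m => c m x) atTop (𝓝 1) := by
    intro x
    have : Tendsto (fun m => ε m * x) atTop (𝓝 0) := by simpa using hε0.mul_const x
    have h2 := (hχ.continuous.tendsto 0).comp this
    rwa [hχ0] at h2
  have hTc : Continuous T := hT.continuous
  have hTd : Continuous (deriv T) := hT.continuous_deriv (by simp)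
  have hdl : ∀ x, Tendsto (fun m => deriv (fun y => T y * c m y) x) atTop (𝓝 (deriv T x)) := by
    intro x
    simp_rw [hder]
    have h1 : Tendsto (fun m => deriv T x * c m x) atTop (𝓝 (deriv T x * 1)) :=
      (hcl x).const_mul _
    have h2 : Tendsto (fun m => T x * (ε m * deriv χ (ε m * x))) atTop (𝓝 0) := by
      refine squeeze_zero_norm (a := fun m => B * (ε m * D)) (fun m => ?_) ?_
      · rw [norm_mul, norm_mul, Real.norm_of_nonneg (hεp m).le]
        have := (hεp m).le
        gcongr
        · exact hB x
        · exact hD _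
      · simpa using (hε0.mul_const D).const_mul B
    simpa using h1.add h2
  have L1 : Tendsto (fun m => ∫ x, u x * ((deriv (fun y => T y * c m y) x : ℝ) : ℂ)) atTop
      (𝓝 (∫ x, u x * ((deriv T x : ℝ) : ℂ))) := by
    refine tendsto_integral_of_dominated_convergence (fun x => ‖u x‖ * (B + B * D)) ?_
      (hu.norm.mul_const _) ?_ ?_
    · intro m
      have hcont : Continuous (deriv (fun y => T y * c m y)) :=
        (hT.mul (hcd m)).continuous_deriv (by simp)
      exact hu.1.mul (Complex.continuous_ofReal.comp hcont).aestronglyMeasurable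
    · intro m
      refine Eventually.of_forall fun x => ?_
      rw [norm_mul, Complex.norm_real]
      gcongr
      rw [hder]
      refine (norm_add_le _ _).trans ?_
      rw [norm_mul, norm_mul, norm_mul, Real.norm_of_nonneg (hεp m).le]
      have h1 : ‖deriv T x‖ * ‖c m x‖ ≤ B * 1 :=
        mul_le_mul (hB' x) (hχ1 _) (norm_nonneg _) hB0
      have h2 : ‖T x‖ * (ε m * ‖deriv χ (ε m * x)‖) ≤ B * (1 * D) :=
        mul_le_mul (hB x) (mul_le_mul (hε1 m) (hD _) (norm_nonneg _) (by norm_num))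
          (mul_nonneg (hεp m).le (norm_nonneg _)) hB0
      linarith
    · refine Eventually.of_forall fun x => ?_
      exact ((Complex.continuous_ofReal.tendsto _).comp (hdl x)).const_mul _
  have L2 : Tendsto (fun m => - ∫ x, v x * ((T x * c m x : ℝ) : ℂ)) atTop
      (𝓝 (- ∫ x, v x * (T x : ℂ))) := by
    refine Tendsto.neg (tendsto_integral_of_dominated_convergence (fun x => ‖v x‖ * B) ?_
      (hv.norm.mul_const _) ?_ ?_)
    · intro m
      exact hv.1.mul (Complex.continuous_ofReal.comp
        (hTc.mul (hcd m).continuous)).aestronglyMeasurable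
    · intro m
      refine Eventually.of_forall fun x => ?_
      rw [norm_mul, Complex.norm_real, norm_mul]
      have : ‖T x‖ * ‖c m x‖ ≤ B * 1 := mul_le_mul (hB x) (hχ1 _) (norm_nonneg _) hB0
      rw [mul_one] at this
      gcongr
    · refine Eventually.of_forall fun x => ?_
      have h1 : Tendsto (fun m => T x * c m x) atTop (𝓝 (T x * 1)) := (hcl x).const_mul _
      rw [mul_one] at h1
      exact ((Complex.continuous_ofReal.tendsto _).comp h1).const_mul _
  refine tendsto_nhds_unique L1 ?_
  refine L2.congr fun m => ?_
  exact (h _ (hT.mul (hcd m)) ((hcc m).mul_left)).symm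

/-- An integrable function with integrable weak derivative is a primitive of it. -/
theorem ae_eq_integral_Iic {u v : ℝ → ℂ} (hu : Integrable u) (hv : Integrable v)
    (h : ∀ t : ℝ → ℝ, ContDiff ℝ ∞ t → HasCompactSupport t →
      ∫ x, u x * ((deriv t x : ℝ) : ℂ) = - ∫ x, v x * (t x : ℂ)) :
    u =ᵐ[volume] fun x => ∫ y in Set.Iic x, v y := by
  refine ae_eq_of_integral_contDiff_smul_eq hu.locallyIntegrable
    (continuous_integral_Iic hv).locallyIntegrable fun t ht hc => ?_
  have hti : Integrable t := ht.continuous.integrable_of_hasCompactSupport hc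
  -- $T$ satisfies $T'=-t$ but is constant, in general nonzero, near $-\infty$. It is therefore only
  -- a bounded test function, covered by `integral_mul_deriv_of_bounded`.
  set T : ℝ → ℝ := fun y => ∫ z in Set.Ici y, t z with hT
  have hTe : ∀ y, T y = (∫ z, t z) - ∫ z in Set.Iic y, t z := by
    intro y
    have := integral_add_compl (measurableSet_Iic (a := y)) hti
    rw [Set.compl_Iic] at this
    simp only [hT, integral_Ici_eq_integral_Ioi]
    linarith
  have hTd : ∀ y, HasDerivAt T (- t y) y := by
    intro y
    have e : T = fun y => (∫ z, t z) - ((∫ z in Set.Iic 0, t z) + ∫ z in (0 : ℝ)..y, t z) := by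
      funext y
      rw [hTe, ← intervalIntegral.integral_Iic_sub_Iic hti.integrableOn hti.integrableOn]
      ring
    rw [e]
    have := (intervalIntegral.integral_hasDerivAt_right (hti.intervalIntegrable (a := 0) (b := y))
      (ht.continuous.stronglyMeasurableAtFilter _ _) ht.continuous.continuousAt)
    exact (this.const_add _).const_sub _
  have hdT : deriv T = fun y => - t y := funext fun y => (hTd y).deriv
  have hTs : ContDiff ℝ ∞ T := by
    rw [contDiff_infty_iff_deriv, hdT]
    exact ⟨fun y => (hTd y).differentiableAt, ht.neg⟩
  obtain ⟨D, hD⟩ := hc.exists_bound_of_continuous ht.continuous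
  have hTb : ∀ y, |T y| ≤ ∫ z, ‖t z‖ := by
    intro y
    rw [← Real.norm_eq_abs]
    refine (norm_integral_le_integral_norm _).trans ?_
    exact setIntegral_le_integral hti.norm (Eventually.of_forall fun z => norm_nonneg _)
  have key := integral_mul_deriv_of_bounded hu hv h hTs (B := max D (∫ z, ‖t z‖))
    (fun x => (hTb x).trans (le_max_right _ _)) (fun x => by
      rw [hdT, abs_neg, ← Real.norm_eq_abs]
      exact (hD x).trans (le_max_left _ _))
  rw [hdT] at key
  have e1 : ∫ x, t x • u x = ∫ x, v x * (T x : ℂ) := by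
    have e : ∫ x, u x * (((- t x : ℝ)) : ℂ) = - ∫ x, t x • u x := by
      rw [← integral_neg]
      congr 1
      funext x
      simp [mul_comm]
    rw [e] at key
    exact neg_injective key
  rw [e1]
  have hint : Integrable (fun p : ℝ × ℝ => v p.1 * (((Set.Ici p.1).indicator t p.2 : ℝ) : ℂ))
      (volume.prod volume) := by
    have h1 : Integrable (fun p : ℝ × ℝ => v p.1 * ((t p.2 : ℝ) : ℂ)) (volume.prod volume) :=
      hv.mul_prod hti.ofReal
    have hs : MeasurableSet {p : ℝ × ℝ | p.1 ≤ p.2} := measurableSet_le measurable_fst measurable_snd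
    refine (h1.indicator hs).congr (Eventually.of_forall fun p => ?_)
    by_cases hp : p.1 ≤ p.2
    · simp [Set.indicator, hp]
    · simp [Set.indicator, hp]
  calc ∫ x, v x * (T x : ℂ)
      = ∫ x, ∫ z, v x * (((Set.Ici x).indicator t z : ℝ) : ℂ) := by
        congr 1
        funext x
        rw [integral_const_mul, integral_complex_ofReal, integral_indicator measurableSet_Ici]
    _ = ∫ z, ∫ x, v x * (((Set.Ici x).indicator t z : ℝ) : ℂ) := integral_integral_swap hint
    _ = _ := by
        congr 1
        funext z
        rw [← integral_indicator measurableSet_Iic, ← integral_smul]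
        congr 1
        funext x
        by_cases hxz : x ≤ z
        · simp [Set.indicator, hxz, mul_comm]
        · simp [Set.indicator, hxz]

/-- Integrable weak derivatives are replaced by representatives that are primitives of one another
at every point; only $\varphi$ itself remains known up to a null set. -/
theorem MemTestSpace1.exists_chain {b : ℝ} (hb : 0 ≤ b) {n : ℕ} (hn : 1 ≤ n) {φ : ℝ → ℂ}
    (h : MemTestSpace1 b n φ) :
    ∃ G : ℕ → ℝ → ℂ, Chain n G ∧ φ =ᵐ[volume] G 0 ∧ ∀ s ≤ n, MemW b n (G s) := by
  obtain ⟨D, hD, hfin⟩ := h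
  set E : ℕ → ℝ → ℂ := fun s t => D (fun _ => s) (fun _ => t) with hE
  have hDE : ∀ s, ∀ x : Fin 1 → ℝ, D (fun _ => s) x = E s (x 0) := fun s x =>
    (congrFun (apply_zero_eta (D fun _ => s)) x).symm
  have hle : ∀ {s}, s ≤ n → (fun _ : Fin 1 => s) ≤ fun _ => n := fun hs _ => hs
  have hweak : ∀ s ≤ n, ∀ t : ℝ → ℝ, ContDiff ℝ ∞ t → HasCompactSupport t →
      ∫ x, φ x * ((deriv^[s] t x : ℝ) : ℂ) = (-1) ^ s * ∫ x, E s x * (t x : ℂ) := by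
    intro s hs t ht hc
    have h1 := (hD _ (hle hs)).2.2 (fun x => t (x 0)) (ht.comp (contDiff_apply ℝ ℝ 0))
      (hasCompactSupport_comp_apply hc)
    rw [multiD_comp_apply t] at h1
    simp_rw [hDE] at h1
    rw [integral_comp_apply (fun y => φ y * ((deriv^[s] t y : ℝ) : ℂ)),
      integral_comp_apply (fun y => E s y * ((t y : ℝ) : ℂ))] at h1
    simpa using h1
  have hterm : ∀ s ≤ n, ∀ β ≤ n,
      eLpNorm (fun x => ((Real.exp (b * |x|) * x ^ β : ℝ) : ℂ) * E s x) 2 volume < ⊤ := by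
    intro s hs β hβ
    unfold expSum at hfin
    rw [ENNReal.sum_lt_top] at hfin
    have h1 := hfin (fun _ => s) (Finset.mem_Icc.2 ⟨fun _ => Nat.zero_le _, hle hs⟩)
    rw [ENNReal.sum_lt_top] at h1
    have h2 := h1 (fun _ => β) (Finset.mem_Icc.2 ⟨fun _ => Nat.zero_le _, hle hβ⟩)
    have hm : AEStronglyMeasurable (fun x : Fin 1 → ℝ =>
        ((Real.exp (b * l1Norm x) * ∏ i, x i ^ β : ℝ) : ℂ) * D (fun _ => s) x) volume := by
      refine AEStronglyMeasurable.mul ?_ (hD _ (hle hs)).2.1.aestronglyMeasurable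
      refine Continuous.aestronglyMeasurable ?_
      unfold l1Norm
      fun_prop
    rw [← eLpNorm_comp_measurePreserving hm measurePreserving_const] at h2
    refine lt_of_eq_of_lt ?_ h2
    congr 1
    funext x
    simp [l1Norm, hE]
  have hEm : ∀ s ≤ n, AEStronglyMeasurable (E s) volume := fun s hs =>
    (hD _ (hle hs)).2.1.aestronglyMeasurable.comp_measurePreserving measurePreserving_const
  have hEW : ∀ s ≤ n, MemW b n (E s) := fun s hs => by
    refine memW_of_eLpNorm (hEm s hs) ?_ (hterm s hs n le_rfl)
    simpa using hterm s hs 0 (Nat.zero_le _)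
  have hEi : ∀ s ≤ n, Integrable (E s) := fun s hs => (hEW s hs).integrable hb hn
  have hφloc : LocallyIntegrable φ volume := by
    have h1 := (hD _ (hle (Nat.zero_le n))).1
    intro x
    obtain ⟨U, hU, hUi⟩ := h1 (fun _ => x)
    refine ⟨(fun t : ℝ => fun _ : Fin 1 => t) ⁻¹' U,
      (by fun_prop : Continuous fun t : ℝ => fun _ : Fin 1 => t).continuousAt hU, ?_⟩
    have he : MeasurableEmbedding (fun t : ℝ => fun _ : Fin 1 => t) :=
      (MeasurableEquiv.funUnique (Fin 1) ℝ).symm.measurableEmbedding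
    exact (measurePreserving_const.integrableOn_comp_preimage he).2 hUi
  have hφE : φ =ᵐ[volume] E 0 := by
    refine ae_eq_of_integral_contDiff_smul_eq hφloc (hEi 0 (Nat.zero_le _)).locallyIntegrable
      fun t ht hc => ?_
    have := hweak 0 (Nat.zero_le _) t ht hc
    simpa [mul_comm] using this
  have hstep : ∀ s < n, E s =ᵐ[volume] fun x => ∫ y in Set.Iic x, E (s + 1) y := by
    intro s hs
    refine ae_eq_integral_Iic (hEi s hs.le) (hEi (s + 1) hs) fun t ht hc => ?_
    have h1 := hweak s hs.le (deriv t) (contDiff_infty_iff_deriv.1 ht).2 hc.deriv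
    have h2 := hweak (s + 1) hs t ht hc
    rw [Function.iterate_succ_apply, h1, pow_succ, mul_assoc] at h2
    have h3 := mul_left_cancel₀ (pow_ne_zero s (by norm_num : (-1 : ℂ) ≠ 0)) h2
    rw [h3]
    ring
  -- Below the top each member is redefined as the primitive of the next weak derivative. This
  -- changes it on a null set, which the next integral does not notice.
  set G : ℕ → ℝ → ℂ := fun s x => if s < n then ∫ y in Set.Iic x, E (s + 1) y else E s x with hG
  have hGE : ∀ s ≤ n, E s =ᵐ[volume] G s := by
    intro s hs
    by_cases h : s < n
    · have : G s = fun x => ∫ y in Set.Iic x, E (s + 1) y := by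
        funext x
        simp [hG, h]
      rw [this]
      exact hstep s h
    · have : G s = E s := by
        funext x
        simp [hG, h]
      rw [this]
  refine ⟨G, ⟨fun s hs => (hEi s hs).congr (hGE s hs), fun s hs x => ?_⟩,
    hφE.trans (hGE 0 (Nat.zero_le _)), fun s hs => (hEW s hs).congr_ae (hGE s hs)⟩
  have : G s x = ∫ y in Set.Iic x, E (s + 1) y := by simp [hG, hs]
  rw [this]
  exact integral_congr_ae (ae_restrict_of_ae (hGE (s + 1) hs))

/-! ### The reproducing system on the line -/

theorem Bd.integrable_pow {β : ℝ} (hβ : 0 < β) {g : ℝ → ℂ} (hg : Bd β g) (s : ℕ) :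
    Integrable (fun x : ℝ => (x : ℂ) ^ s * g x) :=
  (hg.pow_mul (half_lt_self hβ) s).integrable (by positivity)

theorem Bd.contDiff_fourier {β : ℝ} (hβ : 0 < β) {g : ℝ → ℂ} (hg : Bd β g) :
    ContDiff ℝ ∞ (𝓕 g) := by
  refine Real.contDiff_fourier fun s _ => ?_
  have := (hg.integrable_pow hβ s).norm
  refine this.congr (Eventually.of_forall fun x => ?_)
  simp [norm_pow]

theorem Bd.iteratedDeriv_fourier_zero {β : ℝ} (hβ : 0 < β) {g : ℝ → ℂ} (hg : Bd β g) (s : ℕ) :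
    iteratedDeriv s (𝓕 g) 0 = (-2 * Real.pi * Complex.I) ^ s * ∫ x : ℝ, (x : ℂ) ^ s * g x := by
  have h1 : ∀ k : ℕ, (k : ℕ∞) ≤ ⊤ → Integrable (fun x : ℝ => x ^ k • g x) := fun k _ => by
    refine (hg.integrable_pow hβ k).congr (Eventually.of_forall fun x => ?_)
    simp
  rw [Real.iteratedDeriv_fourier h1 le_top, Real.fourier_eq, ← integral_const_mul]
  congr 1
  funext x
  simp only [inner_zero_right, neg_zero, AddChar.map_zero_eq_one, one_smul, smul_eq_mul]
  ring

theorem Bd.fourierVanishes_iff {β : ℝ} (hβ : 0 < β) {g : ℝ → ℂ} (hg : Bd β g) (L : ℕ) :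
    FourierVanishes L g ↔ ∀ s ≤ L, ∫ x : ℝ, (x : ℂ) ^ s * g x = 0 := by
  unfold FourierVanishes
  simp_rw [hg.iteratedDeriv_fourier_zero hβ]
  simp

theorem iteratedDeriv_mul_eq_zero {L : ℕ} {f h : ℝ → ℂ} (hf : ContDiff ℝ ∞ f)
    (hh : ContDiff ℝ ∞ h) (h0 : ∀ s ≤ L, iteratedDeriv s h 0 = 0) :
    ∀ s ≤ L, iteratedDeriv s (f * h) 0 = 0 := by
  intro s hs
  rw [iteratedDeriv_mul (hf.contDiffAt.of_le (by exact_mod_cast le_top))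
    (hh.contDiffAt.of_le (by exact_mod_cast le_top))]
  exact Finset.sum_eq_zero fun i _ => by rw [h0 (s - i) (by omega), mul_zero]

/-- For $s\ge1$ every term in Leibniz' formula for $x\cdot x$ contains a derivative of $x$ of some
order between $1$ and $L$. -/
theorem iteratedDeriv_one_sub_sq {L : ℕ} {x : ℝ → ℂ} (hx : ContDiff ℝ ∞ x)
    (h0 : x 0 * x 0 = 1) (h : ∀ s, 1 ≤ s → s ≤ L → iteratedDeriv s x 0 = 0) :
    ∀ s ≤ L, iteratedDeriv s (fun ξ => 1 - x ξ * x ξ) 0 = 0 := by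
  intro s hs
  rcases Nat.eq_zero_or_pos s with rfl | hs0
  · simp [h0]
  · have hc : ContDiffAt ℝ s x 0 := hx.contDiffAt.of_le (by exact_mod_cast le_top)
    rw [iteratedDeriv_fun_sub contDiffAt_const (hc.mul hc), iteratedDeriv_const, if_neg hs0.ne',
      iteratedDeriv_fun_mul hc hc, zero_sub, neg_eq_zero]
    refine Finset.sum_eq_zero fun i hi => ?_
    rcases Nat.eq_zero_or_pos i with rfl | hi0
    · rw [h (s - 0) hs0 (by omega), mul_zero]
    · rw [h i hi0 (by have := Finset.mem_range.1 hi; omega), mul_zero, zero_mul]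

/-- The chain `2 G - P * G`. -/
noncomputable def damp (P : ℝ → ℂ) (G : ℕ → ℝ → ℂ) (s : ℕ) (x : ℝ) : ℂ := 2 * G s x - cv P (G s) x

theorem damp_chain {n : ℕ} {P : ℝ → ℂ} {G : ℕ → ℝ → ℂ} (hP : Integrable P) (hG : Chain n G) :
    Chain n (damp P G) :=
  (hG.const_mul 2).sub (hG.cv hP)

theorem damp_bd {β β' : ℝ} (hβ' : 0 < β') (hβ : β' < β) {P : ℝ → ℂ} {G : ℕ → ℝ → ℂ} {s : ℕ}
    (hP : Bd β' P) (hG : Bd β (G s)) : Bd β' (damp P G s) := by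
  refine ((hG.mono hβ.le).const_mul 2).sub ?_
  rw [cv_comm]
  exact hG.cv hβ' hβ hP

theorem damp_memW {b : ℝ} (hb : 0 ≤ b) {n : ℕ} (hn : 1 ≤ n) {P : ℝ → ℂ} {G : ℕ → ℝ → ℂ} {s : ℕ}
    (hP : MemW b n P) (hG : MemW b n (G s)) : MemW b n (damp P G s) :=
  (hG.const_mul 2).sub (hP.cv hb hn hG)

theorem fourier_damp {P : ℝ → ℂ} {G : ℕ → ℝ → ℂ} {s : ℕ} (hP : Integrable P)
    (hG : Integrable (G s)) (ξ : ℝ) : 𝓕 (damp P G s) ξ = (2 - 𝓕 P ξ) * 𝓕 (G s) ξ := by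
  unfold damp
  rw [fourier_sub' (hG.const_mul 2) (integrable_cv hP hG), fourier_const_mul', fourier_cv hP hG]
  ring

/-- The chain of the dilation `r g(r ·)`. -/
noncomputable def sclChain (r : ℝ) (G : ℕ → ℝ → ℂ) (s : ℕ) (x : ℝ) : ℂ := (r : ℂ) ^ s * scl r (G s) x

theorem sclChain_zero (r : ℝ) (G : ℕ → ℝ → ℂ) : sclChain r G 0 = scl r (G 0) := by
  funext x
  simp [sclChain]

theorem sclChain_chain {n : ℕ} {G : ℕ → ℝ → ℂ} (hG : Chain n G) {r : ℝ} (hr : 0 < r) :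
    Chain n (sclChain r G) := hG.scl hr

theorem sclChain_memW {b : ℝ} (hb : 0 ≤ b) {n : ℕ} {G : ℕ → ℝ → ℂ} {s : ℕ} (hG : MemW b n (G s))
    {r : ℝ} (hr : 1 ≤ r) : MemW b n (sclChain r G s) :=
  (hG.scl hb hr).const_mul _

theorem sclChain_bd {β : ℝ} (hβ : 0 ≤ β) {G : ℕ → ℝ → ℂ} {s : ℕ} (hG : Bd β (G s))
    {r : ℝ} (hr : 1 ≤ r) : Bd β (sclChain r G s) :=
  (hG.scl hβ hr).const_mul _

/-- The chain of `Φ_1 + Φ_0`, where `Φ_k = 2^k G(2^k ·)`. -/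
noncomputable def sumChain (G : ℕ → ℝ → ℂ) (s : ℕ) (x : ℝ) : ℂ := sclChain 2 G s x + G s x

/-- `Φ_1 * Φ_1 + Φ_0 * Φ_0`. -/
noncomputable def sumSq (g : ℝ → ℂ) (x : ℝ) : ℂ := cv (scl 2 g) (scl 2 g) x + cv g g x

/-- The chain of `(Φ_1 + Φ_0) * (2δ - Φ_1 * Φ_1 - Φ_0 * Φ_0)`. -/
noncomputable def bandChain (G : ℕ → ℝ → ℂ) : ℕ → ℝ → ℂ := damp (sumSq (G 0)) (sumChain G)

/-- The dual system `Λ_k` of the differences `Φ_k - Φ_{k-1}`. -/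
noncomputable def dualSeq (G : ℕ → ℝ → ℂ) (k : ℕ) : ℝ → ℂ :=
  if k = 0 then damp (cv (G 0) (G 0)) G 0 else scl (2 ^ (k - 1)) (bandChain G 0)

/-- The chains of `Φ_0` and of `Φ_k - Φ_{k-1}`, `k ≥ 1`. -/
noncomputable def diffChain (G : ℕ → ℝ → ℂ) (k s : ℕ) (x : ℝ) : ℂ :=
  if k = 0 then G s x else sclChain (2 ^ k) G s x - sclChain (2 ^ (k - 1)) G s x

/-- `2 Φ_0^{*2} - Φ_0^{*4}`. -/
noncomputable def approxId (g : ℝ → ℂ) (x : ℝ) : ℂ := 2 * cv g g x - cv (cv g g) (cv g g) x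

theorem fourier_bandChain {G : ℕ → ℝ → ℂ} (hG : Integrable (G 0)) (ξ : ℝ) :
    𝓕 (bandChain G 0) ξ = (2 - (𝓕 (G 0) (ξ / 2) ^ 2 + 𝓕 (G 0) ξ ^ 2)) *
      (𝓕 (G 0) (ξ / 2) + 𝓕 (G 0) ξ) := by
  have h2 : Integrable (scl 2 (G 0)) := Integrable.scl hG (by norm_num)
  have hs : sumChain G 0 = fun x => scl 2 (G 0) x + G 0 x := by
    funext x
    simp [sumChain, sclChain]
  have hq : Integrable (sumSq (G 0)) := (integrable_cv h2 h2).add (integrable_cv hG hG)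
  unfold bandChain
  rw [fourier_damp hq (by rw [hs]; exact h2.add hG), hs, fourier_add' h2 hG]
  unfold sumSq
  rw [fourier_add' (integrable_cv h2 h2) (integrable_cv hG hG), fourier_cv h2 h2, fourier_cv hG hG,
    fourier_scl _ (by norm_num)]
  ring

theorem fourier_dualSeq {G : ℕ → ℝ → ℂ} (hG : Integrable (G 0)) (k : ℕ) (ξ : ℝ) :
    𝓕 (dualSeq G (k + 1)) ξ =
      (2 - (𝓕 (G 0) (ξ / 2 ^ (k + 1)) ^ 2 + 𝓕 (G 0) (ξ / 2 ^ k) ^ 2)) *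
      (𝓕 (G 0) (ξ / 2 ^ (k + 1)) + 𝓕 (G 0) (ξ / 2 ^ k)) := by
  have e : dualSeq G (k + 1) = scl (2 ^ k) (bandChain G 0) := by simp [dualSeq]
  rw [e, fourier_scl _ (by positivity), fourier_bandChain hG, div_div, ← pow_succ]

theorem fourier_diffChain {G : ℕ → ℝ → ℂ} (hG : Integrable (G 0)) (k : ℕ) (ξ : ℝ) :
    𝓕 (diffChain G (k + 1) 0) ξ = 𝓕 (G 0) (ξ / 2 ^ (k + 1)) - 𝓕 (G 0) (ξ / 2 ^ k) := by
  have e : diffChain G (k + 1) 0 = fun x => scl (2 ^ (k + 1)) (G 0) x - scl (2 ^ k) (G 0) x := by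
    funext x
    simp [diffChain, sclChain]
  rw [e, fourier_sub' (Integrable.scl hG (by positivity)) (Integrable.scl hG (by positivity)),
    fourier_scl _ (by positivity), fourier_scl _ (by positivity)]

theorem fourier_approxId {g : ℝ → ℂ} (hg : Integrable g) (ξ : ℝ) :
    𝓕 (approxId g) ξ = 2 * 𝓕 g ξ ^ 2 - 𝓕 g ξ ^ 4 := by
  have h2 := integrable_cv hg hg
  unfold approxId
  rw [fourier_sub' (h2.const_mul 2) (integrable_cv h2 h2), fourier_const_mul', fourier_cv h2 h2,
    fourier_cv hg hg]
  ring

/-- With $P(y)=2y^2-y^4$ the term $k=0$ is $P(y_0)$ and the term $k\ge1$ is $P(y_k)-P(y_{k-1})$,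
where $y_k=\hat G_0(\xi/2^k)$; the sum telescopes. -/
theorem sum_dualSeq_diffChain {G : ℕ → ℝ → ℂ} (hG : Integrable (G 0)) (N : ℕ) (ξ : ℝ) :
    ∑ k ∈ Finset.range (N + 1), 𝓕 (dualSeq G k) ξ * 𝓕 (diffChain G k 0) ξ =
      2 * 𝓕 (G 0) (ξ / 2 ^ N) ^ 2 - 𝓕 (G 0) (ξ / 2 ^ N) ^ 4 := by
  induction N with
  | zero =>
    have e1 : dualSeq G 0 = damp (cv (G 0) (G 0)) G 0 := by simp [dualSeq]
    have e2 : diffChain G 0 0 = G 0 := by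
      funext x
      simp [diffChain]
    rw [Finset.sum_range_one, e1, e2, fourier_damp (integrable_cv hG hG) hG, fourier_cv hG hG]
    simp
    ring
  | succ N ih =>
    rw [Finset.sum_range_succ, ih, fourier_dualSeq hG, fourier_diffChain hG]
    ring

theorem diffChain_chain {n : ℕ} {G : ℕ → ℝ → ℂ} (hG : Chain n G) (k : ℕ) :
    Chain n (diffChain G k) := by
  by_cases hk : k = 0
  · have : diffChain G k = G := by
      funext s x
      simp [diffChain, hk]
    rwa [this]
  · have : diffChain G k = fun s x => sclChain (2 ^ k) G s x - sclChain (2 ^ (k - 1)) G s x := by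
      funext s x
      simp [diffChain, hk]
    rw [this]
    exact (sclChain_chain hG (by positivity)).sub (sclChain_chain hG (by positivity))

theorem diffChain_memW {b : ℝ} (hb : 0 ≤ b) {n : ℕ} {G : ℕ → ℝ → ℂ} {s : ℕ} (hG : MemW b n (G s))
    (k : ℕ) : MemW b n (diffChain G k s) := by
  by_cases hk : k = 0
  · have : diffChain G k s = G s := by
      funext x
      simp [diffChain, hk]
    rwa [this]
  · have : diffChain G k s = fun x => sclChain (2 ^ k) G s x - sclChain (2 ^ (k - 1)) G s x := by
      funext x
      simp [diffChain, hk]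
    rw [this]
    exact (sclChain_memW hb hG (one_le_pow₀ (by norm_num))).sub
      (sclChain_memW hb hG (one_le_pow₀ (by norm_num)))

theorem dyadicSeq_dyadicDiff (φ₀ : ℝ → ℂ) (k : ℕ) :
    dyadicSeq φ₀ (dyadicDiff φ₀) (k + 1) = fun x => scl (2 ^ (k + 1)) φ₀ x - scl (2 ^ k) φ₀ x := by
  funext x
  have : (2 : ℝ)⁻¹ * (2 ^ (k + 1) * x) = 2 ^ k * x := by
    rw [pow_succ]
    ring
  simp only [dyadicSeq, dyadicDiff, scl, this, Nat.add_eq_zero_iff, one_ne_zero, and_false, if_false]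
  push_cast
  rw [pow_succ]
  ring

theorem dyadicSeq_dyadicDiff_ae {φ₀ : ℝ → ℂ} {G : ℕ → ℝ → ℂ} (h : φ₀ =ᵐ[volume] G 0) (k : ℕ) :
    dyadicSeq φ₀ (dyadicDiff φ₀) k =ᵐ[volume] diffChain G k 0 := by
  cases k with
  | zero =>
    filter_upwards [h] with x hx
    simp [dyadicSeq, diffChain, hx]
  | succ k =>
    rw [dyadicSeq_dyadicDiff]
    filter_upwards [scl_congr_ae h (r := 2 ^ (k + 1)) (by positivity),
      scl_congr_ae h (r := 2 ^ k) (by positivity)] with x h1 h2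
    simp [diffChain, sclChain, h1, h2]

theorem memW_dualSeq {b : ℝ} (hb : 0 ≤ b) {n : ℕ} (hn : 1 ≤ n) {G : ℕ → ℝ → ℂ}
    (hG : MemW b n (G 0)) (k : ℕ) : MemW b n (dualSeq G k) := by
  unfold dualSeq
  split_ifs with hk
  · exact damp_memW hb hn (hG.cv hb hn hG) hG
  · have h2 : MemW b n (scl 2 (G 0)) := hG.scl hb (by norm_num)
    refine MemW.scl hb (damp_memW hb hn ((h2.cv hb hn h2).add (hG.cv hb hn hG)) ?_)
      (one_le_pow₀ (by norm_num))
    exact (sclChain_memW hb hG (by norm_num)).add hG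

/-- The reproducing formula, convolved with the members of a chain. -/
theorem approxId_cv_ae_eq {b : ℝ} (hb : 0 ≤ b) {n : ℕ} (hn : 1 ≤ n) {G H : ℕ → ℝ → ℂ}
    (hG : Chain n G) (hH : Chain n H) (hGW : MemW b n (G 0)) (N : ℕ) {s : ℕ} (hs : s ≤ n) :
    cv (scl (2 ^ N) (approxId (G 0))) (H s) =ᵐ[volume]
      fun x => ∑ k ∈ Finset.range (N + 1), cv (cv (dualSeq G k) (H 0)) (diffChain G k s) x := by
  have hG0 : Integrable (G 0) := hG.integrable 0 (Nat.zero_le _)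
  have hH0 : Integrable (H 0) := hH.integrable 0 (Nat.zero_le _)
  have hHs : Integrable (H s) := hH.integrable s hs
  have h2 := integrable_cv hG0 hG0
  have hS : Integrable (approxId (G 0)) := (h2.const_mul 2).sub (integrable_cv h2 h2)
  have hΛ : ∀ k, Integrable (dualSeq G k) := fun k => (memW_dualSeq hb hn hGW k).integrable hb hn
  have hF : ∀ k, Integrable (diffChain G k s) := fun k => (diffChain_chain hG k).integrable s hs
  have hF0 : ∀ k, Integrable (diffChain G k 0) := fun k =>
    (diffChain_chain hG k).integrable 0 (Nat.zero_le _)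
  have hi : ∀ k ∈ Finset.range (N + 1),
      Integrable (cv (cv (dualSeq G k) (H 0)) (diffChain G k s)) := fun k _ =>
    integrable_cv (integrable_cv (hΛ k) hH0) (hF k)
  refine ae_eq_of_fourier_eq (integrable_cv (Integrable.scl hS (by positivity)) hHs)
    (integrable_finsetSum _ hi) fun ξ => ?_
  rw [fourier_sum' _ hi, fourier_cv (Integrable.scl hS (by positivity)) hHs,
    fourier_scl _ (by positivity), fourier_approxId hG0, ← sum_dualSeq_diffChain hG0 N,
    Finset.sum_mul]
  refine Finset.sum_congr rfl fun k _ => ?_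
  rw [fourier_cv (integrable_cv (hΛ k) hH0) (hF k), fourier_cv (hΛ k) hH0]
  -- On the Fourier side it remains to exchange $\hat H_s\hat F_{k,0}$ for $\hat H_0\hat F_{k,s}$,
  -- where $F_{k,s}$ are the members of `diffChain G k`. The $s$ derivatives thus fall on the
  -- difference, and the kernel $\Lambda_k*H_0$ is the same for all $s$.
  have h1 := congrArg (fun f : ℝ → ℂ => (𝓕 f : ℝ → ℂ) ξ) ((hH.mono hs).cv_swap ((diffChain_chain hG k).mono hs))
  simp only [fourier_cv hH0 (hF k), fourier_cv hHs (hF0 k)] at h1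
  rw [mul_assoc, mul_assoc, h1]
  ring

/-! ### Kernel estimates on the line -/

theorem chain_bd_of_memW {b : ℝ} (hb : 0 ≤ b) {n : ℕ} (hn : 1 ≤ n) {G : ℕ → ℝ → ℂ}
    (hG : Chain n G) (hW : ∀ s ≤ n, MemW b n (G s)) {s : ℕ} (hs : s < n) : Bd b (G s) :=
  hG.bd_of_integrable hs hb ((hW (s + 1) hs).integrable_exp hn)

theorem fourierVanishes_congr_ae {L : ℕ} {f g : ℝ → ℂ} (h : f =ᵐ[volume] g)
    (hf : FourierVanishes L f) : FourierVanishes L g := by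
  unfold FourierVanishes at *
  rwa [← fourier_congr_ae h]

theorem dyadicDiff_ae {φ₀ g : ℝ → ℂ} (h : φ₀ =ᵐ[volume] g) :
    dyadicDiff φ₀ =ᵐ[volume] fun x => g x - scl 2⁻¹ g x := by
  filter_upwards [h, scl_congr_ae h (r := 2⁻¹) (by norm_num)] with x h1 h2
  simp only [scl] at h2
  simp only [dyadicDiff, scl, h1, ← h2]
  push_cast
  rfl

/-- The transform of the dyadic difference is $\hat g(\xi)-\hat g(2\xi)$, whose $s$-th derivative at
$0$ is $(1-2^s)\hat g^{(s)}(0)$; for $s\ge1$ the factor is not zero. -/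
theorem iteratedDeriv_fourier_eq_zero {β : ℝ} (hβ : 0 < β) {L : ℕ} {φ₀ g : ℝ → ℂ} (hg : Bd β g)
    (h : φ₀ =ᵐ[volume] g) (hv : FourierVanishes L (dyadicDiff φ₀)) {s : ℕ} (h1 : 1 ≤ s)
    (hs : s ≤ L) : iteratedDeriv s (𝓕 g) 0 = 0 := by
  have hv' := fourierVanishes_congr_ae (dyadicDiff_ae h) hv s hs
  have hgi := hg.integrable hβ
  have e : 𝓕 (fun x => g x - scl 2⁻¹ g x) = fun ξ => 𝓕 g ξ - 𝓕 g (2 * ξ) := by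
    funext ξ
    rw [fourier_sub' hgi (Integrable.scl hgi (by norm_num)), fourier_scl _ (by norm_num), div_inv_eq_mul,
      mul_comm ξ]
  have hc : ContDiff ℝ s (𝓕 g) := (hg.contDiff_fourier hβ).of_le (by exact_mod_cast le_top)
  have hc2 : ContDiff ℝ s (fun ξ : ℝ => 𝓕 g (2 * ξ)) := hc.comp (contDiff_const.mul contDiff_id)
  rw [e, iteratedDeriv_fun_sub hc.contDiffAt hc2.contDiffAt, iteratedDeriv_comp_const_smul hc] at hv'
  simp only [mul_zero] at hv'
  rw [Complex.real_smul] at hv'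
  have h2 : (1 - (2 : ℂ) ^ s) ≠ 0 := by
    have : (1 : ℝ) < 2 ^ s := one_lt_pow₀ (by norm_num) (by omega)
    have h3 : (1 - (2 : ℝ) ^ s) ≠ 0 := by linarith
    exact_mod_cast h3
  have h3 : (1 - (2 : ℂ) ^ s) * iteratedDeriv s (𝓕 g) 0 = 0 := by
    push_cast at hv'
    linear_combination hv'
  exact (mul_eq_zero.1 h3).resolve_left h2

theorem sq_integral_eq_one {φ₀ g : ℝ → ℂ} (hg : Integrable g) (h : φ₀ =ᵐ[volume] g)
    (h1 : ∫ x, ∫ y, φ₀ (x - y) * φ₀ y = 1) : (∫ x, g x) * (∫ x, g x) = 1 := by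
  have e : ∀ x, ∫ y, φ₀ (x - y) * φ₀ y = cv g g x := by
    intro x
    have : ∫ y, φ₀ (x - y) * φ₀ y = cv φ₀ φ₀ x := by
      unfold cv
      simp_rw [mul_comm]
    rw [this, cv_congr_ae h h]
  simp_rw [e] at h1
  have := integral_convolution (ContinuousLinearMap.mul ℂ ℂ) (μ := volume) (ν := volume) hg hg
  rw [← cv_eq_convolution, h1] at this
  simpa using this.symm

theorem fourier_zero_eq (g : ℝ → ℂ) : 𝓕 g 0 = ∫ x, g x := by
  rw [Real.fourier_eq]
  simp

/-- The factor $2-x^2-y^2=(1-x^2)+(1-y^2)$ vanishes at $0$ together with its derivatives up to order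
$L$, and by Leibniz' rule a smooth multiple does the same. -/
theorem fourierVanishes_bandChain {β : ℝ} (hβ : 0 < β) {L : ℕ} {G : ℕ → ℝ → ℂ} (hg : Bd β (G 0))
    (h1 : (∫ x, G 0 x) * (∫ x, G 0 x) = 1)
    (hv : ∀ s, 1 ≤ s → s ≤ L → iteratedDeriv s (𝓕 (G 0)) 0 = 0) :
    FourierVanishes L (bandChain G 0) := by
  have hi := hg.integrable hβ
  set x : ℝ → ℂ := fun ξ => 𝓕 (G 0) (2⁻¹ * ξ) with hx
  set y : ℝ → ℂ := 𝓕 (G 0) with hy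
  have hyc : ContDiff ℝ ∞ y := hg.contDiff_fourier hβ
  have hxc : ContDiff ℝ ∞ x := hyc.comp (contDiff_const.mul contDiff_id)
  have hxv : ∀ s, 1 ≤ s → s ≤ L → iteratedDeriv s x 0 = 0 := by
    intro s h1 hs
    have hc : ContDiff ℝ s y := hyc.of_le (by exact_mod_cast le_top)
    rw [hx, iteratedDeriv_comp_const_smul hc]
    simp [hv s h1 hs]
  have hy0 : y 0 * y 0 = 1 := by rw [hy, fourier_zero_eq, h1]
  have hx0 : x 0 * x 0 = 1 := by
    have : x 0 = y 0 := by simp [hx]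
    rw [this, hy0]
  have e : 𝓕 (bandChain G 0) =
      (fun ξ => x ξ + y ξ) * fun ξ => (1 - x ξ * x ξ) + (1 - y ξ * y ξ) := by
    funext ξ
    rw [fourier_bandChain hi, Pi.mul_apply, hx, hy, div_eq_inv_mul]
    ring
  intro s hs
  rw [e]
  have c1 : ContDiff ℝ ∞ (fun ξ => 1 - x ξ * x ξ) := contDiff_const.sub (hxc.mul hxc)
  have c2 : ContDiff ℝ ∞ (fun ξ => 1 - y ξ * y ξ) := contDiff_const.sub (hyc.mul hyc)
  refine iteratedDeriv_mul_eq_zero (hxc.add hyc) (c1.add c2) (fun k hk => ?_) s hs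
  rw [iteratedDeriv_fun_add (c1.contDiffAt.of_le (by exact_mod_cast le_top))
    (c2.contDiffAt.of_le (by exact_mod_cast le_top)),
    iteratedDeriv_one_sub_sq hxc hx0 hxv k hk, iteratedDeriv_one_sub_sq hyc hy0 hv k hk, add_zero]

theorem memW_approxId {b : ℝ} (hb : 0 ≤ b) {n : ℕ} (hn : 1 ≤ n) {g : ℝ → ℂ} (hg : MemW b n g) :
    MemW b n (approxId g) :=
  ((hg.cv hb hn hg).const_mul 2).sub ((hg.cv hb hn hg).cv hb hn (hg.cv hb hn hg))

/-- The normalization determines $\int g$ only up to sign. The even powers in $2y^2-y^4$ make this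
harmless: the value is $2\cdot1-1$. -/
theorem integral_approxId {g : ℝ → ℂ} (hg : Integrable g) (h1 : (∫ x, g x) * (∫ x, g x) = 1) :
    ∫ x, approxId g x = 1 := by
  rw [← fourier_zero_eq, fourier_approxId hg, fourier_zero_eq]
  linear_combination (1 - (∫ x, g x) * (∫ x, g x)) * h1

/-- The chains of a dyadic sequence. -/
noncomputable def dyadicChain (G₀ G : ℕ → ℝ → ℂ) (j : ℕ) : ℕ → ℝ → ℂ :=
  if j = 0 then G₀ else sclChain (2 ^ j) G

theorem dyadicChain_chain {n : ℕ} {G₀ G : ℕ → ℝ → ℂ} (h₀ : Chain n G₀) (h : Chain n G) (j : ℕ) :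
    Chain n (dyadicChain G₀ G j) := by
  unfold dyadicChain
  split_ifs
  · exact h₀
  · exact sclChain_chain h (by positivity)

theorem dyadicChain_memW {b : ℝ} (hb : 0 ≤ b) {n : ℕ} {G₀ G : ℕ → ℝ → ℂ} {s : ℕ}
    (h₀ : MemW b n (G₀ s)) (h : MemW b n (G s)) (j : ℕ) : MemW b n (dyadicChain G₀ G j s) := by
  unfold dyadicChain
  split_ifs
  · exact h₀
  · exact sclChain_memW hb h (one_le_pow₀ (by norm_num))

theorem dyadicSeq_ae {ψ₀ ψ : ℝ → ℂ} {G₀ G : ℕ → ℝ → ℂ} (h₀ : ψ₀ =ᵐ[volume] G₀ 0)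
    (h : ψ =ᵐ[volume] G 0) (j : ℕ) : dyadicSeq ψ₀ ψ j =ᵐ[volume] dyadicChain G₀ G j 0 := by
  by_cases hj : j = 0
  · simpa [dyadicSeq, dyadicChain, hj] using h₀
  · simp only [dyadicSeq, dyadicChain, hj, if_false, sclChain_zero]
    filter_upwards [scl_congr_ae h (r := 2 ^ j) (by positivity)] with x hx
    rw [← hx]
    simp [scl]

/-- The `L¹`-normalized exponential at the dyadic level `m`. -/
noncomputable def expKer (γ : ℝ) (m : ℕ) (x : ℝ) : ℝ := 2 ^ m * Real.exp (-(γ * (2 ^ m * |x|)))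

/-- The kernel is rescaled to the coarser of its two scales, and `exists_norm_cv_scl_le` is applied
to the ratio: for $k\le j$ the moments of $\psi$ act on the derivatives of $\Lambda_k$, for $k>j$
the roles are reversed. For $k\ge1$ the function $\Lambda_k$ is a dilation by $2^{k-1}$, which
explains `k - 1` (truncated to $0$ at $k=0$) and the factor $2^L$ in the constant. -/
theorem exists_kernel_bound {b b' : ℝ} (hb' : 0 < b') (hb : b' < b) {L : ℕ}
    {G Ψ₀ Ψ : ℕ → ℝ → ℂ} (hG : Chain (L + 1) G) (hΨ₀ : Chain (L + 1) Ψ₀) (hΨ : Chain (L + 1) Ψ)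
    (hGb : ∀ s ≤ L, Bd b (G s)) (hΨ₀b : ∀ s ≤ L, Bd b (Ψ₀ s)) (hΨb : ∀ s ≤ L, Bd b (Ψ s))
    (hvan : FourierVanishes L (Ψ 0)) (hband : FourierVanishes L (bandChain G 0)) :
    ∃ C : ℝ, 0 ≤ C ∧ ∀ j k x, ‖cv (dualSeq G k) (dyadicChain Ψ₀ Ψ j 0) x‖ ≤
      C * (((2 : ℝ) ^ L) ^ ((j - k) + (k - j)))⁻¹ * expKer b' (min j (k - 1)) x := by
  -- Two losses of rate are available: from $b$ to $\beta$ for the convolutions inside $\Lambda_k$,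
  -- and from $\beta$ to $b'$ for the convolution with $\psi_j$.
  set β := (b + b') / 2 with hβdef
  have hβ1 : b' < β := by rw [hβdef]; linarith
  have hβ2 : β < b := by rw [hβdef]; linarith
  have hβ0 : 0 < β := hb'.trans hβ1
  have hb0 : 0 < b := hb'.trans hb
  have hg := hGb 0 (Nat.zero_le _)
  have h2g : Bd b (scl 2 (G 0)) := hg.scl hb0.le (by norm_num)
  have hsum : ∀ s ≤ L, Bd b (sumChain G s) := fun s hs =>
    (sclChain_bd hb0.le (hGb s hs) (by norm_num)).add (hGb s hs)
  have hsumC : Chain (L + 1) (sumChain G) := (sclChain_chain hG (by norm_num)).add hG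
  have hP0 : Bd β (cv (G 0) (G 0)) := hg.cv hβ0 hβ2 (hg.mono hβ2.le)
  have hP1 : Bd β (sumSq (G 0)) := (h2g.cv hβ0 hβ2 (h2g.mono hβ2.le)).add hP0
  have hband_c : Chain (L + 1) (bandChain G) := damp_chain (hP1.integrable hβ0) hsumC
  have hband_b : ∀ s ≤ L, Bd β (bandChain G s) := fun s hs => damp_bd hβ0 hβ2 hP1 (hsum s hs)
  have hlow_c : Chain (L + 1) (damp (cv (G 0) (G 0)) G) := damp_chain (hP0.integrable hβ0) hG
  have hlow_b : ∀ s ≤ L, Bd β (damp (cv (G 0) (G 0)) G s) := fun s hs =>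
    damp_bd hβ0 hβ2 hP0 (hGb s hs)
  -- A gain of order $L$ uses the moments of order below $L$ and the chain members up to index $L$,
  -- the last one with a pointwise bound.
  have mband : ∀ s < L, ∫ x : ℝ, (x : ℂ) ^ s * bandChain G 0 x = 0 := fun s hs =>
    ((hband_b 0 (Nat.zero_le _)).fourierVanishes_iff hβ0 L).1 hband s hs.le
  have mΨ : ∀ s < L, ∫ x : ℝ, (x : ℂ) ^ s * Ψ 0 x = 0 := fun s hs =>
    ((hΨb 0 (Nat.zero_le _)).fourierVanishes_iff hb0 L).1 hvan s hs.le
  have hΨβ := (hΨb 0 (Nat.zero_le _)).mono hβ2.le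
  have cΨ := hΨ.continuous (Nat.succ_pos L)
  have cband := hband_c.continuous (Nat.succ_pos L)
  obtain ⟨-, C0, hC0, hC0'⟩ := (hΨ₀b 0 (Nat.zero_le _)).cv hb' hb ((hlow_b 0 (Nat.zero_le _)).mono hβ1.le)
  obtain ⟨C1, hC1, hC1'⟩ := exists_norm_cv_scl_le hb' hβ1 cΨ hΨβ mΨ
    (hlow_c.mono (Nat.le_succ L)) (hlow_b L le_rfl)
  obtain ⟨C2, hC2, hC2'⟩ := exists_norm_cv_scl_le hb' hβ1 cband (hband_b 0 (Nat.zero_le _)) mband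
    (hΨ₀.mono (Nat.le_succ L)) ((hΨ₀b L le_rfl).mono hβ2.le)
  obtain ⟨C3, hC3, hC3'⟩ := exists_norm_cv_scl_le hb' hβ1 cΨ hΨβ mΨ
    (hband_c.mono (Nat.le_succ L)) (hband_b L le_rfl)
  obtain ⟨C4, hC4, hC4'⟩ := exists_norm_cv_scl_le hb' hβ1 cband (hband_b 0 (Nat.zero_le _)) mband
    (hΨ.mono (Nat.le_succ L)) ((hΨb L le_rfl).mono hβ2.le)
  set Q : ℝ := 2 ^ L with hQ
  have hQ1 : 1 ≤ Q := one_le_pow₀ (by norm_num)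
  have hQp : ∀ m : ℕ, ((2 : ℝ) ^ m) ^ L = Q ^ m := fun m => by
    rw [hQ, ← pow_mul, ← pow_mul, mul_comm]
  have hQs : ∀ m : ℕ, (Q ^ m)⁻¹ = Q * (Q ^ (m + 1))⁻¹ := fun m => by
    have : Q ≠ 0 := by positivity
    rw [pow_succ]
    field_simp
  have h1m : ∀ m : ℕ, (1 : ℝ) ≤ 2 ^ m := fun m => one_le_pow₀ (by norm_num)
  have hle : ∀ {A B E : ℝ}, 0 ≤ E → A ≤ B → A * E ≤ B * E := fun hE h =>
    mul_le_mul_of_nonneg_right h hE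
  refine ⟨(C0 + C1 + C2 + C3 + C4) * Q, by positivity, fun j k x => ?_⟩
  have main : ∀ (s : ℝ) (h : ℝ → ℂ) (x A : ℝ), 0 < s →
      (∀ x, ‖h x‖ ≤ A * Real.exp (-(b' * |x|))) →
      ‖scl s h x‖ ≤ A * (s * Real.exp (-(b' * (s * |x|)))) := by
    intro s h x A hs hh
    rw [scl, norm_mul, Complex.norm_real, Real.norm_of_nonneg hs.le, mul_left_comm]
    have := hh (s * x)
    rw [abs_mul, abs_of_pos hs] at this
    exact mul_le_mul_of_nonneg_left this hs.le
  rcases Nat.eq_zero_or_pos k with rfl | hk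
  · have e1 : dualSeq G 0 = damp (cv (G 0) (G 0)) G 0 := by simp [dualSeq]
    rw [e1, cv_comm]
    rcases Nat.eq_zero_or_pos j with rfl | hj
    · have := hC0' x
      simp only [dyadicChain, expKer, if_true, pow_zero, Nat.sub_self, Nat.zero_sub, Nat.min_self,
        add_zero, inv_one, one_mul, mul_one]
      refine this.trans (hle (Real.exp_pos _).le ?_)
      have : C0 ≤ C0 * Q := le_mul_of_one_le_right hC0 hQ1
      nlinarith
    · have e2 : dyadicChain Ψ₀ Ψ j 0 = scl (2 ^ j) (Ψ 0) := by
        simp [dyadicChain, hj.ne', sclChain_zero]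
      rw [e2]
      have := hC1' (2 ^ j) (h1m j) x
      rw [hQp] at this
      simp only [expKer, Nat.zero_sub, Nat.sub_zero, Nat.min_zero, pow_zero, one_mul, add_zero]
      refine this.trans (hle (Real.exp_pos _).le (hle (by positivity) ?_))
      have : C1 ≤ C1 * Q := le_mul_of_one_le_right hC1 hQ1
      nlinarith
  · have e1 : dualSeq G k = scl (2 ^ (k - 1)) (bandChain G 0) := by simp [dualSeq, hk.ne']
    rw [e1]
    rcases Nat.eq_zero_or_pos j with rfl | hj
    · have e2 : dyadicChain Ψ₀ Ψ 0 0 = Ψ₀ 0 := by simp [dyadicChain]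
      rw [e2]
      have := hC2' (2 ^ (k - 1)) (h1m _) x
      rw [hQp, hQs, Nat.sub_add_cancel hk] at this
      simp only [expKer, Nat.zero_sub, Nat.sub_zero, Nat.zero_min, pow_zero, one_mul, zero_add]
      refine this.trans (hle (Real.exp_pos _).le ?_)
      rw [← mul_assoc]
      exact hle (by positivity) (hle (by positivity) (by linarith))
    · have e2 : dyadicChain Ψ₀ Ψ j 0 = scl (2 ^ j) (Ψ 0) := by
        simp [dyadicChain, hj.ne', sclChain_zero]
      rw [e2]
      rcases le_or_gt k j with hkj | hkj
      -- The common dilation by $2^{k-1}$ is extracted; the ratio $2^{j-k+1}$ is at least $2^{j-k}$,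
      -- so the gain is better than claimed.
      · have e3 : scl (2 ^ j) (Ψ 0) = scl (2 ^ (k - 1)) (scl (2 ^ (j - (k - 1))) (Ψ 0)) := by
          rw [scl_scl, ← pow_add]
          congr 2
          omega
        rw [e3, cv_scl _ _ (by positivity), cv_comm]
        have := main (2 ^ (k - 1)) _ x _ (by positivity) (hC3' (2 ^ (j - (k - 1))) (h1m _))
        have hmin : min j (k - 1) = k - 1 := by omega
        have hd : (j - k) + (k - j) = j - k := by omega
        rw [hQp] at this
        rw [hmin, hd, expKer]
        refine this.trans (hle (by positivity) ?_)
        have h5 : (Q ^ (j - (k - 1)))⁻¹ ≤ (Q ^ (j - k))⁻¹ := by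
          apply inv_anti₀ (by positivity)
          exact pow_le_pow_right₀ hQ1 (by omega)
        have h6 : C3 ≤ (C0 + C1 + C2 + C3 + C4) * Q := by
          have : C3 ≤ C3 * Q := le_mul_of_one_le_right hC3 hQ1
          nlinarith
        exact mul_le_mul h6 h5 (by positivity) (by positivity)
      -- Here the ratio $2^{k-1-j}$ falls short of $2^{k-j}$ by a factor $2$; `hQs` pays for it with
      -- the extra $2^L$.
      · have e3 : scl (2 ^ (k - 1)) (bandChain G 0) =
            scl (2 ^ j) (scl (2 ^ (k - 1 - j)) (bandChain G 0)) := by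
          rw [scl_scl, ← pow_add]
          congr 2
          omega
        rw [e3, cv_scl _ _ (by positivity)]
        have := main (2 ^ j) _ x _ (by positivity) (hC4' (2 ^ (k - 1 - j)) (h1m _))
        have hmin : min j (k - 1) = j := by omega
        have hd : (j - k) + (k - j) = k - 1 - j + 1 := by omega
        rw [hQp, hQs] at this
        rw [hmin, hd, expKer]
        refine this.trans (hle (by positivity) ?_)
        rw [← mul_assoc]
        exact hle (by positivity) (hle (by positivity) (by linarith))

/-- A system on the line that reproduces the chains `Ψ j` from the chains `F k` of a dyadic
resolution, with kernels `K j k` and the approximate identity generated by `S`. -/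
structure RepSystem (b b' C : ℝ) (L : ℕ) (Ψ F : ℕ → ℕ → ℝ → ℂ) (S : ℝ → ℂ)
    (K : ℕ → ℕ → ℝ → ℂ) : Prop where
  chain_left : ∀ j, Chain (L + 1) (Ψ j)
  memW_left : ∀ j, ∀ s ≤ L + 1, MemW b (L + 1) (Ψ j s)
  chain_right : ∀ k, Chain (L + 1) (F k)
  memW_right : ∀ k, ∀ s ≤ L + 1, MemW b (L + 1) (F k s)
  memW_approx : MemW b (L + 1) S
  integral_approx : ∫ x, S x = 1
  memW_kernel : ∀ j k, MemW b (L + 1) (K j k)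
  reproduce : ∀ j N, ∀ s ≤ L + 1, cv (scl (2 ^ N) S) (Ψ j s) =ᵐ[volume]
    fun x => ∑ k ∈ Finset.range (N + 1), cv (K j k) (F k s) x
  const_nonneg : 0 ≤ C
  kernel_le : ∀ j k x, ‖K j k x‖ ≤
    C * (((2 : ℝ) ^ L) ^ ((j - k) + (k - j)))⁻¹ * expKer b' (min j (k - 1)) x

theorem exists_repSystem {b b' : ℝ} (hb' : 0 < b') (hb : b' < b) {L : ℕ} {ψ₀ ψ φ₀ : ℝ → ℂ}
    (hψ₀ : MemTestSpace1 b (L + 1) ψ₀) (hψ : MemTestSpace1 b (L + 1) ψ)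
    (hφ₀ : MemTestSpace1 b (L + 1) φ₀) (hint : ∫ x, ∫ y, φ₀ (x - y) * φ₀ y = 1)
    (hψv : FourierVanishes L ψ) (hφv : FourierVanishes L (dyadicDiff φ₀)) :
    ∃ C Ψ F S K, RepSystem b b' C L Ψ F S K ∧ (∀ j, dyadicSeq ψ₀ ψ j =ᵐ[volume] Ψ j 0) ∧
      ∀ k, dyadicSeq φ₀ (dyadicDiff φ₀) k =ᵐ[volume] F k 0 := by
  have hb0 : 0 < b := hb'.trans hb
  have hn : 1 ≤ L + 1 := Nat.le_add_left 1 L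
  obtain ⟨A₀, hA₀, eA₀, wA₀⟩ := hψ₀.exists_chain hb0.le hn
  obtain ⟨A, hA, eA, wA⟩ := hψ.exists_chain hb0.le hn
  obtain ⟨G, hG, eG, wG⟩ := hφ₀.exists_chain hb0.le hn
  have bd : ∀ {H : ℕ → ℝ → ℂ}, Chain (L + 1) H → (∀ s ≤ L + 1, MemW b (L + 1) (H s)) →
      ∀ s ≤ L, Bd b (H s) := fun hH hW s hs => chain_bd_of_memW hb0.le hn hH hW (by omega)
  have hGi : Integrable (G 0) := hG.integrable 0 (Nat.zero_le _)
  have h1 := sq_integral_eq_one hGi eG hint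
  have hband : FourierVanishes L (bandChain G 0) :=
    fourierVanishes_bandChain hb0 (bd hG wG 0 (Nat.zero_le _)) h1 fun s hs1 hs =>
      iteratedDeriv_fourier_eq_zero hb0 (bd hG wG 0 (Nat.zero_le _)) eG hφv hs1 hs
  obtain ⟨C, hC, hCK⟩ := exists_kernel_bound hb' hb hG hA₀ hA (bd hG wG) (bd hA₀ wA₀) (bd hA wA)
    (fourierVanishes_congr_ae eA hψv) hband
  have wG0 := wG 0 (Nat.zero_le _)
  refine ⟨C, dyadicChain A₀ A, diffChain G, approxId (G 0),
    fun j k => cv (dualSeq G k) (dyadicChain A₀ A j 0), ?_, dyadicSeq_ae eA₀ eA,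
    dyadicSeq_dyadicDiff_ae eG⟩
  exact
    { chain_left := dyadicChain_chain hA₀ hA
      memW_left := fun j s hs => dyadicChain_memW hb0.le (wA₀ s hs) (wA s hs) j
      chain_right := diffChain_chain hG
      memW_right := fun k s hs => diffChain_memW hb0.le (wG s hs) k
      memW_approx := memW_approxId hb0.le hn wG0
      integral_approx := integral_approxId hGi h1
      memW_kernel := fun j k => (memW_dualSeq hb0.le hn wG0 k).cv hb0.le hn
        (dyadicChain_memW hb0.le (wA₀ 0 (Nat.zero_le _)) (wA 0 (Nat.zero_le _)) j)
      reproduce := fun j N s hs =>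
        approxId_cv_ae_eq hb0.le hn hG (dyadicChain_chain hA₀ hA j) wG0 N hs
      const_nonneg := hC
      kernel_le := hCK }

/-! ### Tensor products -/

variable {d : ℕ}

/-- The tensor product of functions on the line. -/
def tens (u : Fin d → ℝ → ℂ) (x : Fin d → ℝ) : ℂ := ∏ i, u i (x i)

/-- The tensor product of the weights. -/
noncomputable def wtd (b : ℝ) (n : ℕ) (x : Fin d → ℝ) : ℝ := ∏ i, wt b n (x i)

theorem wtd_pos (b : ℝ) (n : ℕ) (x : Fin d → ℝ) : 0 < wtd b n x :=
  Finset.prod_pos fun i _ => wt_pos b n (x i)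

theorem continuous_wtd (b : ℝ) (n : ℕ) : Continuous (wtd b n : (Fin d → ℝ) → ℝ) :=
  continuous_finsetProd _ fun i _ => (continuous_wt b n).comp (continuous_apply i)

theorem wtd_add_le {b : ℝ} (hb : 0 ≤ b) (n : ℕ) (x y : Fin d → ℝ) :
    wtd b n (x + y) ≤ wtd b n x * wtd b n y := by
  unfold wtd
  rw [← Finset.prod_mul_distrib]
  exact Finset.prod_le_prod (fun i _ => (wt_pos b n _).le) fun i _ => wt_add_le hb n _ _

theorem wtd_neg (b : ℝ) (n : ℕ) (x : Fin d → ℝ) : wtd b n (-x) = wtd b n x :=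
  Finset.prod_congr rfl fun i _ => wt_neg b n (x i)

theorem wtd_le_mul_sub {b : ℝ} (hb : 0 ≤ b) (n : ℕ) (x y : Fin d → ℝ) :
    wtd b n y ≤ wtd b n x * wtd b n (x - y) := by
  have := wtd_add_le hb n x (-(x - y))
  rwa [wtd_neg, neg_sub, add_sub_cancel] at this

theorem one_le_wtd {b : ℝ} (hb : 0 ≤ b) (n : ℕ) (x : Fin d → ℝ) : 1 ≤ wtd b n x := by
  unfold wtd
  exact Finset.one_le_prod fun i _ => one_le_wt hb n (x i)

theorem aestronglyMeasurable_tens {u : Fin d → ℝ → ℂ}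
    (hu : ∀ i, AEStronglyMeasurable (u i) volume) : AEStronglyMeasurable (tens u) volume := by
  unfold tens
  refine Finset.aestronglyMeasurable_fun_prod _ fun i _ => ?_
  exact (hu i).comp_quasiMeasurePreserving (Measure.quasiMeasurePreserving_eval _ i)

/-- `g` is measurable and `W g ∈ L²`, where `W` is the tensor product of the weights. -/
def MemWd (b : ℝ) (n : ℕ) (g : (Fin d → ℝ) → ℂ) : Prop :=
  MemLp (fun x => (wtd b n x : ℂ) * g x) 2 volume

theorem memWd_tens {b : ℝ} {n : ℕ} {u : Fin d → ℝ → ℂ} (hu : ∀ i, MemW b n (u i)) :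
    MemWd b n (tens u) := by
  have hm : AEStronglyMeasurable (fun x => (wtd b n x : ℂ) * tens u x) volume :=
    AEStronglyMeasurable.mul
      (Complex.continuous_ofReal.comp (continuous_wtd b n)).aestronglyMeasurable
      (aestronglyMeasurable_tens fun i => (hu i).aestronglyMeasurable)
  unfold MemWd
  rw [memLp_two_iff_integrable_sq_norm hm]
  have h1 : ∀ i, Integrable (fun x => ‖(wt b n x : ℂ) * u i x‖ ^ 2) := fun i =>
    (memLp_two_iff_integrable_sq_norm (hu i).1).1 (hu i)
  refine (Integrable.fintype_prod h1).congr (Eventually.of_forall fun x => ?_)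
  simp only [wtd, tens]
  push_cast
  rw [← Finset.prod_mul_distrib, norm_prod, Finset.prod_pow]

theorem MemWd.aestronglyMeasurable {b : ℝ} {n : ℕ} {g : (Fin d → ℝ) → ℂ} (hg : MemWd b n g) :
    AEStronglyMeasurable g volume := by
  have h1 : Continuous fun x : Fin d → ℝ => ((wtd b n x)⁻¹ : ℝ) :=
    (continuous_wtd b n).inv₀ fun x => (wtd_pos b n x).ne'
  have h2 : AEStronglyMeasurable (fun x : Fin d → ℝ => (((wtd b n x)⁻¹ : ℝ) : ℂ)) volume :=
    (Complex.continuous_ofReal.comp h1).aestronglyMeasurable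
  refine (h2.mul hg.1).congr (Eventually.of_forall fun x => ?_)
  have : (wtd b n x : ℂ) ≠ 0 := by exact_mod_cast (wtd_pos b n x).ne'
  simp only [Pi.mul_apply]
  push_cast
  field_simp

theorem MemWd.memLp {b : ℝ} (hb : 0 ≤ b) {n : ℕ} {g : (Fin d → ℝ) → ℂ} (hg : MemWd b n g) :
    MemLp g 2 volume := by
  refine MemLp.mono hg hg.aestronglyMeasurable (Eventually.of_forall fun x => ?_)
  rw [norm_mul, Complex.norm_real, Real.norm_of_nonneg (wtd_pos b n x).le]
  exact le_mul_of_one_le_left (norm_nonneg _) (one_le_wtd hb n x)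

theorem MemWd.comp_sub {b : ℝ} (hb : 0 ≤ b) {n : ℕ} {g : (Fin d → ℝ) → ℂ} (hg : MemWd b n g)
    (x : Fin d → ℝ) : MemWd b n (fun y => g (x - y)) := by
  have mp := Measure.measurePreserving_sub_left (volume : Measure (Fin d → ℝ)) x
  have h1 := (MemLp.comp_measurePreserving hg mp).const_mul (wtd b n x : ℂ)
  refine MemLp.mono h1 (AEStronglyMeasurable.mul
      (Complex.continuous_ofReal.comp (continuous_wtd b n)).aestronglyMeasurable
      (hg.aestronglyMeasurable.comp_measurePreserving mp)) (Eventually.of_forall fun y => ?_)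
  simp only [norm_mul, Complex.norm_real, Real.norm_of_nonneg (wtd_pos b n _).le, Function.comp]
  rw [← mul_assoc]
  gcongr
  exact wtd_le_mul_sub hb n x y

theorem MemWd.const_mul {b : ℝ} {n : ℕ} {g : (Fin d → ℝ) → ℂ} (hg : MemWd b n g) (c : ℂ) :
    MemWd b n (fun x => c * g x) := by
  have := MemLp.const_mul hg c
  refine (memLp_congr_ae (Eventually.of_forall fun x => ?_)).1 this
  simp only
  ring

/-! ### Weak derivatives of tensor products -/

theorem multiD_foldr_regular (α : Fin d → ℕ) {t : (Fin d → ℝ) → ℝ} (h : ContDiff ℝ ∞ t)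
    (hc : HasCompactSupport t) (l : List (Fin d)) :
    ContDiff ℝ ∞ (l.foldr (fun i u => (partialD i)^[α i] u) t) ∧
      HasCompactSupport (l.foldr (fun i u => (partialD i)^[α i] u) t) := by
  induction l with
  | nil => exact ⟨h, hc⟩
  | cons i l ih =>
    rw [List.foldr_cons]
    generalize l.foldr (fun i u => (partialD i)^[α i] u) t = u at ih
    induction α i with
    | zero => exact ih
    | succ n ih2 =>
      rw [Function.iterate_succ_apply']
      exact partialD_regular i ih2.1 ih2.2

theorem integral_mul_multiD {s : Fin d → ℕ} {A : (Fin d → ℕ) → (Fin d → ℝ) → ℂ}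
    (hA : ∀ β i, β + Pi.single i 1 ≤ s → ∀ t : (Fin d → ℝ) → ℝ, ContDiff ℝ ∞ t →
      HasCompactSupport t → ∫ x, A β x * (partialD i t x : ℂ) =
        - ∫ x, A (β + Pi.single i 1) x * (t x : ℂ))
    {α : Fin d → ℕ} (hα : α ≤ s) {t : (Fin d → ℝ) → ℝ} (ht : ContDiff ℝ ∞ t)
    (hc : HasCompactSupport t) :
    ∫ x, A 0 x * (multiD α t x : ℂ) = (-1) ^ (∑ i, α i) * ∫ x, A α x * (t x : ℂ) := by
  have one : ∀ (i : Fin d) (m : ℕ) (β : Fin d → ℕ), β + Pi.single i m ≤ s →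
      ∀ t : (Fin d → ℝ) → ℝ, ContDiff ℝ ∞ t → HasCompactSupport t →
      ∫ x, A β x * ((partialD i)^[m] t x : ℂ) =
        (-1) ^ m * ∫ x, A (β + Pi.single i m) x * (t x : ℂ) := by
    intro i m
    induction m with
    | zero =>
      intro β _ t _ _
      simp
    | succ m ih =>
      intro β hβ t ht hc
      obtain ⟨ht', hc'⟩ := partialD_regular i ht hc
      have hs : Pi.single i (m + 1) = (Pi.single i m + Pi.single i 1 : Fin d → ℕ) := by
        funext k
        by_cases h : k = i
        · subst h
          simp
        · simp [h]
      have hβ' : β + Pi.single i m ≤ s := by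
        refine le_trans ?_ hβ
        rw [hs, ← add_assoc]
        exact le_self_add
      rw [Function.iterate_succ_apply, ih β hβ' _ ht' hc', hA _ i (by rwa [add_assoc, ← hs]) t ht hc,
        hs, ← add_assoc, pow_succ]
      ring
  -- The induction on the list of coordinates needs an arbitrary starting index $\beta$: it holds
  -- the derivatives already transferred and vanishes on the coordinates still to be treated.
  have main : ∀ l : List (Fin d), l.Nodup → ∀ β : Fin d → ℕ, (∀ i ∈ l, β i = 0) →
      (fun i => if i ∈ l then α i else β i) ≤ s →
      ∫ x, A β x * (l.foldr (fun i u => (partialD i)^[α i] u) t x : ℂ) =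
        (-1) ^ (l.map α).sum * ∫ x, A (fun i => if i ∈ l then α i else β i) x * (t x : ℂ) := by
    intro l
    induction l with
    | nil =>
      intro _ β _ _
      simp
    | cons i l ih =>
      intro hl β hβ hs
      obtain ⟨hil, hl'⟩ := List.nodup_cons.1 hl
      obtain ⟨hu, hcu⟩ := multiD_foldr_regular α ht hc l
      have e : (fun k => if k ∈ l then α k else (β + (Pi.single i (α i) : Fin d → ℕ)) k) =
          fun k => if k ∈ i :: l then α k else β k := by
        funext k
        by_cases hk : k ∈ l
        · simp [hk]
        · by_cases hki : k = i
          · subst hki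
            simp [hil, hβ k (by simp)]
          · simp [hk, hki]
      have hle : β + Pi.single i (α i) ≤ s := by
        intro k
        have h1 := hs k
        by_cases hki : k = i
        · subst hki
          simpa [hβ k (by simp)] using hα k
        · by_cases hk : k ∈ l
          · simp [hβ k (by simp [hk]), hki]
          · simpa [hk, hki] using h1
      rw [List.foldr_cons, one i (α i) β hle _ hu hcu, ih hl' _ (fun k hk => ?_) (by rw [e]; exact hs),
        e, List.map_cons, List.sum_cons, pow_add, mul_assoc]
      have : k ≠ i := fun h => hil (h ▸ hk)
      simp [hβ k (by simp [hk]), this]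
  have := main (List.finRange d) (List.nodup_finRange d) 0 (fun _ _ => rfl) (by simpa using hα)
  simp only [List.mem_finRange, if_true] at this
  unfold multiD
  rw [this]
  rw [← List.ofFn_eq_map, List.sum_ofFn]

theorem Chain.integral_sub_mul_deriv {n : ℕ} {G : ℕ → ℝ → ℂ} (hG : Chain n G) {s : ℕ} (hs : s < n)
    (a : ℝ) {t : ℝ → ℝ} (ht : ContDiff ℝ ∞ t) (hc : HasCompactSupport t) :
    ∫ x, G s (a - x) * ((deriv t x : ℝ) : ℂ) = ∫ x, G (s + 1) (a - x) * (t x : ℂ) := by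
  have h1 := hG.integral_mul_deriv hs (t := fun x => t (a - x))
    (ht.comp (contDiff_const.sub contDiff_id)) (hc.comp_homeomorph (Homeomorph.subLeft a))
  rw [← integral_sub_left_eq_self (fun x => G s (a - x) * ((deriv t x : ℝ) : ℂ)) volume a,
    ← integral_sub_left_eq_self (fun x => G (s + 1) (a - x) * (t x : ℂ)) volume a]
  simp only [sub_sub_cancel]
  have e : ∀ x, deriv (fun x => t (a - x)) x = - deriv t (a - x) := fun x =>
    deriv_comp_const_sub t a x
  simp only [e] at h1
  push_cast at h1
  simp only [mul_neg, integral_neg] at h1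
  exact neg_injective h1

/-- The weak derivatives of `y ↦ ∏ i, G_i(x_i - y_i)`. -/
noncomputable def tensDeriv (G : Fin d → ℕ → ℝ → ℂ) (x : Fin d → ℝ) (α : Fin d → ℕ)
    (y : Fin d → ℝ) : ℂ := (-1) ^ (∑ i, α i) * tens (fun i => G i (α i)) (x - y)

theorem memWd_tensDeriv {b : ℝ} (hb : 0 ≤ b) {n : ℕ} {G : Fin d → ℕ → ℝ → ℂ}
    (hG : ∀ i, ∀ s ≤ n, MemW b n (G i s)) (x : Fin d → ℝ) {α : Fin d → ℕ}
    (hα : α ≤ fun _ => n) : MemWd b n (tensDeriv G x α) :=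
  ((memWd_tens fun i => hG i (α i) (hα i)).comp_sub hb x).const_mul _

theorem MemWd.locallyIntegrable {b : ℝ} (hb : 0 ≤ b) {n : ℕ} {g : (Fin d → ℝ) → ℂ}
    (hg : MemWd b n g) : LocallyIntegrable g volume :=
  (hg.memLp hb).locallyIntegrable (by norm_num)

/-- By Fubini all coordinates but the $i$-th are frozen. On each line the other factors are
constants, and the identity is that for a chain in one variable. -/
theorem integral_tensDeriv_partialD {b : ℝ} (hb : 0 ≤ b) {n : ℕ} {G : Fin d → ℕ → ℝ → ℂ}
    (hC : ∀ i, Chain n (G i)) (hG : ∀ i, ∀ s ≤ n, MemW b n (G i s)) (x : Fin d → ℝ)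
    (β : Fin d → ℕ) (i : Fin d) (hβ : β + Pi.single i 1 ≤ fun _ => n) {t : (Fin d → ℝ) → ℝ}
    (ht : ContDiff ℝ ∞ t) (hc : HasCompactSupport t) :
    ∫ y, tensDeriv G x β y * (partialD i t y : ℂ) =
      - ∫ y, tensDeriv G x (β + Pi.single i 1) y * (t y : ℂ) := by
  have hβ0 : β ≤ fun _ => n := le_trans le_self_add hβ
  obtain ⟨ht', hc'⟩ := partialD_regular i ht hc
  have I1 := integrable_mul_test ((memWd_tensDeriv hb hG x hβ0).locallyIntegrable hb) ht' hc'
  have I2 := integrable_mul_test ((memWd_tensDeriv hb hG x hβ).locallyIntegrable hb) ht hc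
  obtain ⟨m, rfl⟩ : ∃ m, d = m + 1 := ⟨d - 1, by have := i.pos; omega⟩
  have mp := (volume_preserving_piFinSuccAbove (fun _ : Fin (m + 1) => ℝ) i).symm
  have split : ∀ f : (Fin (m + 1) → ℝ) → ℂ, Integrable f →
      ∫ y, f y = ∫ z : Fin m → ℝ, ∫ r : ℝ, f (i.insertNth r z) := by
    intro f hf
    have h1 := mp.integral_comp (MeasurableEquiv.measurableEmbedding _) f
    have h2 : Integrable (fun p : ℝ × (Fin m → ℝ) => f (i.insertNth p.1 p.2))
        (volume.prod volume) := by
      have := (mp.integrable_comp_emb (MeasurableEquiv.measurableEmbedding _)).2 hf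
      exact this
    rw [← h1]
    exact integral_prod_symm _ h2
  rw [split _ I1, split _ I2, ← integral_neg]
  congr 1
  funext z
  set τ : ℝ → ℝ := fun r => t (i.insertNth r z) with hτ
  have hins : ∀ r, (i.insertNth r z : Fin (m + 1) → ℝ) =
      i.insertNth 0 z + r • (Pi.single i (1 : ℝ) : Fin (m + 1) → ℝ) := by
    intro r
    funext k
    refine Fin.succAboveCases i ?_ (fun l => ?_) k
    · simp
    · simp
  have hτs : ContDiff ℝ ∞ τ := by
    have : τ = fun r => t (i.insertNth 0 z + r • (Pi.single i (1 : ℝ) : Fin (m + 1) → ℝ)) :=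
      funext fun r => by rw [hτ]; simp only; rw [hins]
    rw [this]
    exact ht.comp (contDiff_const.add (contDiff_id.smul contDiff_const))
  have hτc : HasCompactSupport τ := by
    refine hc.comp_isClosedEmbedding (f := t) (g := fun r => i.insertNth r z) ?_
    refine Function.LeftInverse.isClosedEmbedding (f := fun y : Fin (m + 1) → ℝ => y i) (fun r => by simp)
      (continuous_apply i) ?_
    rw [show (fun r : ℝ => (i.insertNth r z : Fin (m + 1) → ℝ)) = fun r =>
      i.insertNth 0 z + r • (Pi.single i (1 : ℝ) : Fin (m + 1) → ℝ) from funext hins]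
    fun_prop
  have hder : ∀ r, partialD i t (i.insertNth r z) = deriv τ r := by
    intro r
    unfold partialD lineDeriv
    have : (fun q : ℝ => t ((i.insertNth r z : Fin (m + 1) → ℝ) +
        q • (Pi.single i (1 : ℝ) : Fin (m + 1) → ℝ))) = fun q => τ (r + q) := by
      funext q
      rw [hτ]
      simp only
      rw [hins r, hins (r + q), add_smul, add_assoc]
    rw [this, deriv_comp_const_add, add_zero]
  have hprod : ∀ (γ : Fin (m + 1) → ℕ) (r : ℝ), tensDeriv G x γ (i.insertNth r z) =
      (-1) ^ (∑ k, γ k) * (∏ l, G (i.succAbove l) (γ (i.succAbove l)) (x (i.succAbove l) - z l)) *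
        G i (γ i) (x i - r) := by
    intro γ r
    unfold tensDeriv tens
    rw [Fin.prod_univ_succAbove _ i]
    simp only [Pi.sub_apply, Fin.insertNth_apply_same, Fin.insertNth_apply_succAbove]
    ring
  simp only [hprod, hder]
  have hlt : β i < n := by
    have := hβ i
    simp at this
    omega
  have key := (hC i).integral_sub_mul_deriv hlt (x i) hτs hτc
  have e1 : ∑ k, (β k + (Pi.single i 1 : Fin (m + 1) → ℕ) k) = ∑ k, β k + 1 := by
    simp [Finset.sum_add_distrib]
  have e2 : ∀ l, (β + (Pi.single i 1 : Fin (m + 1) → ℕ)) (i.succAbove l) = β (i.succAbove l) := by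
    intro l
    simp
  simp only [e1, e2, mul_assoc, integral_const_mul, Pi.add_apply, Pi.single_eq_same, pow_succ, key]
  simp [hτ]

/-! ### Representation of functionals on the test space -/

theorem abs_exp_mul_prod_le_wtd {d : ℕ} (b : ℝ) {n : ℕ} {β : Fin d → ℕ} (hβ : β ≤ fun _ => n)
    (x : Fin d → ℝ) : |Real.exp (b * l1Norm x) * ∏ i, x i ^ β i| ≤ wtd b n x := by
  rw [abs_mul, abs_of_pos (Real.exp_pos _), Finset.abs_prod, l1Norm, Finset.mul_sum, Real.exp_sum,
    ← Finset.prod_mul_distrib]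
  refine Finset.prod_le_prod (fun i _ => by positivity) fun i _ => ?_
  rw [wt, abs_pow]
  gcongr
  have h := abs_nonneg (x i)
  calc |x i| ^ β i ≤ (1 + |x i|) ^ β i := by gcongr; linarith
    _ ≤ (1 + |x i|) ^ n := pow_le_pow_right₀ (by linarith) (hβ i)

theorem expSum_le {d : ℕ} (b : ℝ) (n : ℕ) (D : (Fin d → ℕ) → (Fin d → ℝ) → ℂ) :
    expSum b (fun _ => n) D ≤ (Finset.Icc (0 : Fin d → ℕ) fun _ => n).card *
      ∑ α ∈ Finset.Icc (0 : Fin d → ℕ) fun _ => n,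
        eLpNorm (fun x => (wtd b n x : ℂ) * D α x) 2 volume := by
  unfold expSum
  rw [Finset.mul_sum]
  refine Finset.sum_le_sum fun α _ => ?_
  rw [← nsmul_eq_mul]
  refine Finset.sum_le_card_nsmul _ _ _ fun β hβ => ?_
  refine eLpNorm_mono fun x => ?_
  rw [norm_mul, norm_mul, Complex.norm_real, Complex.norm_real,
    Real.norm_of_nonneg (wtd_pos b n x).le, Real.norm_eq_abs]
  gcongr
  exact abs_exp_mul_prod_le_wtd b (Finset.mem_Icc.1 hβ).2 x

theorem expSum_lt_top {d : ℕ} {b : ℝ} {n : ℕ} {D : (Fin d → ℕ) → (Fin d → ℝ) → ℂ}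
    (hD : ∀ α ≤ fun _ => n, MemWd b n (D α)) : expSum b (fun _ => n) D < ⊤ := by
  refine (expSum_le b n D).trans_lt (ENNReal.mul_lt_top (by simp) ?_)
  rw [ENNReal.sum_lt_top]
  exact fun α hα => (hD α (Finset.mem_Icc.1 hα).2).2

theorem isWeakDerivFamily_tensDeriv {d : ℕ} {b : ℝ} (hb : 0 ≤ b) {n : ℕ} {G : Fin d → ℕ → ℝ → ℂ}
    (hC : ∀ i, Chain n (G i)) (hG : ∀ i, ∀ s ≤ n, MemW b n (G i s)) {u : Fin d → ℝ → ℂ}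
    (hu : ∀ i, u i =ᵐ[volume] G i 0) (x : Fin d → ℝ) :
    IsWeakDerivFamily (fun _ => n) (fun y => tens u (x - y)) (tensDeriv G x) := by
  have e : (fun y => tens u (x - y)) =ᵐ[volume] tensDeriv G x 0 := by
    have h1 : ∀ᵐ z : Fin d → ℝ, ∀ i, u i (z i) = G i 0 (z i) := by
      rw [ae_all_iff]
      exact fun i => (Measure.quasiMeasurePreserving_eval (α := fun _ : Fin d => ℝ)
        (fun _ => volume) i).ae (p := fun r => u i r = G i 0 r) (hu i)
    have h2 := (Measure.measurePreserving_sub_left (volume : Measure (Fin d → ℝ)) x).quasiMeasurePreserving.ae h1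
    filter_upwards [h2] with y hy
    simp only [tensDeriv, tens, Pi.zero_apply, Finset.sum_const_zero, pow_zero, one_mul]
    exact Finset.prod_congr rfl fun i _ => hy i
  have h0 : (0 : Fin d → ℕ) ≤ fun _ => n := fun _ => Nat.zero_le _
  intro α hα
  refine ⟨((memWd_tensDeriv hb hG x h0).locallyIntegrable hb).congr e.symm,
    (memWd_tensDeriv hb hG x hα).locallyIntegrable hb, fun t ht hc => ?_⟩
  rw [← integral_mul_multiD (A := tensDeriv G x) (fun β i hβ t ht hc =>
    integral_tensDeriv_partialD hb hC hG x β i hβ ht hc) hα ht hc]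
  refine integral_congr_ae (e.mono fun y hy => ?_)
  have hy' : tens u (x - y) = tensDeriv G x 0 y := hy
  simp only
  rw [hy']

/-- A linear form bounded by the norm of a linear map into a Hilbert space is an inner product with
that map. -/
theorem exists_inner_eq {P E : Type*} [AddCommGroup P] [Module ℂ P] [NormedAddCommGroup E]
    [InnerProductSpace ℂ E] [CompleteSpace E] (T : P →ₗ[ℂ] E) (l : P →ₗ[ℂ] ℂ) (C : ℝ)
    (h : ∀ p, ‖l p‖ ≤ C * ‖T p‖) : ∃ e : E, ∀ p, l p = inner ℂ e (T p) := by
  obtain ⟨s, hs⟩ := T.rangeRestrict.exists_rightInverse_of_surjective T.range_rangeRestrict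
  have hTs : ∀ v, T (s v) = v := fun v => by
    have := congrArg (fun g : LinearMap.range T →ₗ[ℂ] LinearMap.range T => ((g v : LinearMap.range T) : E)) hs
    simpa using this
  set m : LinearMap.range T →L[ℂ] ℂ := (l ∘ₗ s).mkContinuous C fun v => by
    have := h (s v)
    rw [hTs] at this
    exact this with hm
  obtain ⟨g, hg, -⟩ := exists_extension_norm_eq _ m
  refine ⟨(InnerProductSpace.toDual ℂ E).symm g, fun p => ?_⟩
  rw [InnerProductSpace.toDual_symm_apply]
  have h1 := hg ⟨T p, LinearMap.mem_range_self T p⟩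
  rw [h1]
  -- The vectors $p$ and $s(Tp)$ have the same image under $T$, and the bound forces $l$ to vanish
  -- on the kernel of $T$; hence the choice of the section is immaterial.
  have h2 : l (p - s ⟨T p, LinearMap.mem_range_self T p⟩) = 0 := by
    have := h (p - s ⟨T p, LinearMap.mem_range_self T p⟩)
    rw [map_sub T, hTs, sub_self, norm_zero, mul_zero] at this
    exact norm_le_zero_iff.1 this
  rw [map_sub, sub_eq_zero] at h2
  rw [h2]
  rfl

theorem MemWd.add {d : ℕ} {b : ℝ} {n : ℕ} {g h : (Fin d → ℝ) → ℂ} (hg : MemWd b n g)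
    (hh : MemWd b n h) : MemWd b n (g + h) := by
  have := MemLp.add hg hh
  refine (memLp_congr_ae (Eventually.of_forall fun x => ?_)).1 this
  simp only [Pi.add_apply]
  ring

/-- The pairs of a test function and a family of its weak derivatives in the weighted class. -/
def derivPairs (d : ℕ) (b : ℝ) (n : ℕ) :
    Submodule ℂ (((Fin d → ℝ) → ℂ) × ((Fin d → ℕ) → (Fin d → ℝ) → ℂ)) where
  carrier := {p | IsWeakDerivFamily (fun _ => n) p.1 p.2 ∧ ∀ α ≤ fun _ => n, MemWd b n (p.2 α)}
  zero_mem' := by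
    refine ⟨fun α _ => ⟨locallyIntegrable_zero, locallyIntegrable_zero, fun t _ _ => by simp⟩,
      fun α _ => ?_⟩
    unfold MemWd
    simp
  add_mem' := by
    rintro p q ⟨hp, hp'⟩ ⟨hq, hq'⟩
    exact ⟨fun α hα => (hp α hα).add (hq α hα), fun α hα => (hp' α hα).add (hq' α hα)⟩
  smul_mem' := by
    rintro c p ⟨hp, hp'⟩
    exact ⟨fun α hα => (hp α hα).smul c, fun α hα => (hp' α hα).const_mul c⟩

theorem derivPairs_mem_testSpace {d : ℕ} {b : ℝ} {n : ℕ} (p : derivPairs d b n) :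
    p.1.1 ∈ testSpace b (fun _ : Fin d => n) :=
  ⟨p.1.2, p.2.1, expSum_lt_top p.2.2⟩

/-- The map $\varphi\mapsto(WD^\alpha\varphi)_\alpha$ into a finite product of $L^2$ spaces controls
the norm of the test space, so $f$ becomes a bounded form on its range and is represented by
Hahn–Banach and Riesz. The domain consists of pairs $(\varphi,D)$, since $\varphi$ determines its
weak derivatives only almost everywhere. -/
theorem DualSpace.exists_repr {d : ℕ} {b : ℝ} {n : ℕ} (f : DualSpace b (fun _ : Fin d => n)) :
    ∃ a : (Fin d → ℕ) → (Fin d → ℝ) → ℂ, (∀ α, MemLp (a α) 2 volume) ∧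
      ∀ (φ : (Fin d → ℝ) → ℂ) (D : (Fin d → ℕ) → (Fin d → ℝ) → ℂ)
        (hφ : φ ∈ testSpace b (fun _ : Fin d => n)), IsWeakDerivFamily (fun _ => n) φ D →
        (∀ α ≤ fun _ => n, MemWd b n (D α)) →
        f.1 ⟨φ, hφ⟩ = ∑ α ∈ Finset.Icc (0 : Fin d → ℕ) fun _ => n,
          ∫ y, a α y * ((wtd b n y : ℂ) * D α y) := by
  obtain ⟨C, hC⟩ := f.2
  set I := Finset.Icc (0 : Fin d → ℕ) fun _ => n with hI
  have hle : ∀ α : I, (α : Fin d → ℕ) ≤ fun _ => n := fun α => (Finset.mem_Icc.1 α.2).2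
  have hp : ∀ (p : derivPairs d b n) (α : I),
      MemLp (fun x => (wtd b n x : ℂ) * p.1.2 α x) 2 volume := fun p α => p.2.2 α (hle α)
  let T : derivPairs d b n →ₗ[ℂ] PiLp 2 (fun _ : I => Lp ℂ 2 (volume : Measure (Fin d → ℝ))) :=
    { toFun := fun p => WithLp.toLp 2 fun α => (hp p α).toLp _
      map_add' := by
        intro p q
        ext1 α
        exact (MemLp.toLp_congr (hp (p + q) α) ((hp p α).add (hp q α)) (Eventually.of_forall fun x =>
          mul_add _ _ _)).trans (MemLp.toLp_add (hp p α) (hp q α))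
      map_smul' := by
        intro c p
        ext1 α
        exact (MemLp.toLp_congr (hp (c • p) α) ((hp p α).const_smul c) (Eventually.of_forall fun x =>
          mul_left_comm _ _ _)).trans (MemLp.toLp_const_smul c (hp p α)) }
  let l : derivPairs d b n →ₗ[ℂ] ℂ :=
    f.1 ∘ₗ LinearMap.codRestrict (testSpace b (fun _ : Fin d => n))
      ((LinearMap.fst ℂ _ _) ∘ₗ (derivPairs d b n).subtype) derivPairs_mem_testSpace
  have hT : ∀ (p : derivPairs d b n) (α : I), ‖T p α‖ ≤ ‖T p‖ := fun p α =>
    PiLp.norm_apply_le (T p) α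
  have hbound : ∀ p, ‖l p‖ ≤ (C * (I.card * I.card)) * ‖T p‖ := by
    intro p
    have h1 := hC ⟨p.1.1, derivPairs_mem_testSpace p⟩ p.1.2 p.2.1
    have h2 : expSum b (fun _ => n) p.1.2 ≤ I.card * (I.card * ENNReal.ofReal ‖T p‖) := by
      refine (expSum_le b n p.1.2).trans ?_
      gcongr
      rw [← nsmul_eq_mul]
      refine Finset.sum_le_card_nsmul _ _ _ fun α hα => ?_
      have := hT p ⟨α, hα⟩
      have e : ‖T p ⟨α, hα⟩‖ = ENNReal.toReal (eLpNorm (fun x => (wtd b n x : ℂ) * p.1.2 α x) 2 volume) :=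
        Lp.norm_toLp _ (hp p ⟨α, hα⟩)
      rw [e] at this
      exact (ENNReal.le_ofReal_iff_toReal_le (p.2.2 α (Finset.mem_Icc.1 hα).2).2.ne (norm_nonneg _)).2 this
    have h3 : ‖l p‖ₑ ≤ ENNReal.ofReal ((C * (I.card * I.card)) * ‖T p‖) := by
      refine h1.trans ((mul_le_mul_right h2 _).trans (le_of_eq ?_))
      rw [ENNReal.ofReal_mul (by positivity), ENNReal.ofReal_mul (by positivity),
        ENNReal.ofReal_mul (by positivity), ENNReal.ofReal_natCast, ENNReal.ofReal_coe_nnreal]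
      ring
    rw [← ofReal_norm] at h3
    exact (ENNReal.ofReal_le_ofReal_iff (by positivity)).1 h3
  obtain ⟨e, he⟩ := exists_inner_eq T l _ hbound
  -- The inner product is conjugate linear in its first slot and the pairing is bilinear, hence the
  -- conjugate.
  refine ⟨fun α y => if h : α ∈ I then (starRingEnd ℂ) (e ⟨α, h⟩ y) else 0, fun α => ?_, ?_⟩
  · by_cases h : α ∈ I
    · simp only [h, dif_pos]
      exact (Lp.memLp (e ⟨α, h⟩)).star
    · simp [h]
  · intro φ D hφ hD hW
    have h1 := he ⟨(φ, D), hD, hW⟩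
    have h2 : l ⟨(φ, D), hD, hW⟩ = f.1 ⟨φ, hφ⟩ := rfl
    rw [← h2, h1, PiLp.inner_apply, ← Finset.sum_coe_sort I]
    refine Finset.sum_congr rfl fun α _ => ?_
    rw [L2.inner_def]
    refine integral_congr_ae ?_
    filter_upwards [MemLp.coeFn_toLp (hW α (hle α))] with y hy
    have e2 : (T ⟨(φ, D), hD, hW⟩ α : (Fin d → ℝ) → ℂ) y = (wtd b n y : ℂ) * D α y := hy
    simp only [e2, α.2, dif_pos, RCLike.inner_apply, Subtype.coe_eta]
    ring

/-! ### Pairings with translates -/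

theorem tendsto_eLpNorm_translate_sub {d : ℕ} {h : (Fin d → ℝ) → ℂ} (hh : MemLp h 2 volume)
    (x₀ : Fin d → ℝ) :
    Tendsto (fun x => eLpNorm (fun y => h (x - y) - h (x₀ - y)) 2 volume) (𝓝 x₀) (𝓝 0) := by
  have mp : ∀ x : Fin d → ℝ, MeasurePreserving (fun y => x - y) volume volume :=
    Measure.measurePreserving_sub_left volume
  let g : C(Fin d → ℝ, C(Fin d → ℝ, Fin d → ℝ)) :=
    ContinuousMap.curry ⟨fun q : (Fin d → ℝ) × (Fin d → ℝ) => q.1 - q.2, by fun_prop⟩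
  have hc := (continuous_const (y := hh.toLp h)).compMeasurePreservingLp g.continuous mp
    (by norm_num : (2 : ℝ≥0∞) ≠ ⊤)
  have h1 := (Lp.tendsto_Lp_iff_tendsto_eLpNorm' _ _).1 (hc.tendsto x₀)
  refine h1.congr fun x => eLpNorm_congr_ae ?_
  have e : ∀ x, (Lp.compMeasurePreserving (g x) (mp x) (hh.toLp h) : (Fin d → ℝ) → ℂ) =ᵐ[volume]
      fun y => h (x - y) := fun x =>
    (Lp.coeFn_compMeasurePreserving _ (mp x)).trans
      ((mp x).quasiMeasurePreserving.ae_eq_comp hh.coeFn_toLp)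
  exact (e x).sub (e x₀)

theorem enorm_integral_mul_le {α : Type*} [MeasurableSpace α] {μ : Measure α} {f g : α → ℂ}
    (hf : AEStronglyMeasurable f μ) (hg : AEStronglyMeasurable g μ) :
    ‖∫ y, f y * g y ∂μ‖ₑ ≤ eLpNorm f 2 μ * eLpNorm g 2 μ := by
  refine (enorm_integral_le_lintegral_enorm _).trans ?_
  have := eLpNorm_smul_le_mul_eLpNorm (p := 2) (q := 2) (r := 1) hg hf
  rwa [eLpNorm_one_eq_lintegral_enorm] at this

/-- The pairing of `a` with `W u(x - ·)`. -/
noncomputable def pair {d : ℕ} (b : ℝ) (n : ℕ) (a u : (Fin d → ℝ) → ℂ) (x : Fin d → ℝ) : ℂ :=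
  ∫ y, a y * ((wtd b n y : ℂ) * u (x - y))

theorem norm_ofReal_wtd {d : ℕ} (b : ℝ) (n : ℕ) (x : Fin d → ℝ) : ‖(wtd b n x : ℂ)‖ = wtd b n x := by
  rw [Complex.norm_real, Real.norm_of_nonneg (wtd_pos b n x).le]

theorem integrable_pair {d : ℕ} {b : ℝ} (hb : 0 ≤ b) {n : ℕ} {a u : (Fin d → ℝ) → ℂ}
    (ha : MemLp a 2 volume) (hu : MemWd b n u) (x : Fin d → ℝ) :
    Integrable (fun y => a y * ((wtd b n y : ℂ) * u (x - y))) :=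
  MemLp.integrable_mul ha (hu.comp_sub hb x)

theorem pair_congr_ae {d : ℕ} (b : ℝ) (n : ℕ) (a : (Fin d → ℝ) → ℂ) {u v : (Fin d → ℝ) → ℂ}
    (h : u =ᵐ[volume] v) : pair b n a u = pair b n a v := by
  funext x
  refine integral_congr_ae ?_
  filter_upwards [(Measure.measurePreserving_sub_left (volume : Measure (Fin d → ℝ))
    x).quasiMeasurePreserving.ae_eq_comp h] with y hy
  have hy' : u (x - y) = v (x - y) := hy
  rw [hy']

theorem pair_finset_sum {d : ℕ} {b : ℝ} (hb : 0 ≤ b) {n : ℕ} {a : (Fin d → ℝ) → ℂ}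
    (ha : MemLp a 2 volume) {ι : Type*} (s : Finset ι) {u : ι → (Fin d → ℝ) → ℂ}
    (hu : ∀ k ∈ s, MemWd b n (u k)) (x : Fin d → ℝ) :
    pair b n a (fun z => ∑ k ∈ s, u k z) x = ∑ k ∈ s, pair b n a (u k) x := by
  unfold pair
  rw [← integral_finsetSum s fun k hk => integrable_pair hb ha (hu k hk) x]
  simp only [Finset.mul_sum]

/-- Cauchy–Schwarz after $W(y)\le W(x)W(x-y)$, which puts the weight onto the translated function.
-/
theorem exists_norm_pair_le {d : ℕ} {b : ℝ} (hb : 0 ≤ b) {n : ℕ} {a u : (Fin d → ℝ) → ℂ}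
    (ha : MemLp a 2 volume) (hu : MemWd b n u) :
    ∃ C : ℝ, 0 ≤ C ∧ ∀ x, ‖pair b n a u x‖ ≤ C * wtd b n x := by
  refine ⟨(eLpNorm a 2 volume * eLpNorm (fun x => (wtd b n x : ℂ) * u x) 2 volume).toReal,
    ENNReal.toReal_nonneg, fun x => ?_⟩
  have h1 : ‖pair b n a u x‖ₑ ≤ eLpNorm a 2 volume *
      (ENNReal.ofReal (wtd b n x) * eLpNorm (fun x => (wtd b n x : ℂ) * u x) 2 volume) := by
    refine (enorm_integral_mul_le ha.1 (hu.comp_sub hb x).1).trans ?_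
    gcongr
    have mp := Measure.measurePreserving_sub_left (volume : Measure (Fin d → ℝ)) x
    have hu' : MemLp (fun x => (wtd b n x : ℂ) * u x) 2 volume := hu
    have h2 : eLpNorm (fun y => (wtd b n (x - y) : ℂ) * u (x - y)) 2 volume =
        eLpNorm (fun x => (wtd b n x : ℂ) * u x) 2 volume :=
      eLpNorm_comp_measurePreserving (g := fun x => (wtd b n x : ℂ) * u x) hu'.1 mp
    rw [← h2]
    have h3 : ENNReal.ofReal (wtd b n x) = ‖(wtd b n x : ℂ)‖ₑ := by
      rw [← ofReal_norm, norm_ofReal_wtd]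
    rw [h3, ← eLpNorm_const_smul]
    refine eLpNorm_mono fun y => ?_
    simp only [Pi.smul_apply, smul_eq_mul, norm_mul, norm_ofReal_wtd]
    rw [← mul_assoc]
    gcongr
    exact wtd_le_mul_sub hb n x y
  rw [← ofReal_norm] at h1
  have hfin := ENNReal.mul_ne_top ha.2.ne hu.2.ne
  refine (ENNReal.ofReal_le_ofReal_iff (by have := wtd_pos b n x; positivity)).1 (h1.trans (le_of_eq ?_))
  rw [ENNReal.ofReal_mul ENNReal.toReal_nonneg, ENNReal.ofReal_toReal hfin]
  ring

theorem continuous_pair {d : ℕ} {b : ℝ} (hb : 0 ≤ b) {n : ℕ} {a u : (Fin d → ℝ) → ℂ}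
    (ha : MemLp a 2 volume) (hu : MemWd b n u) : Continuous (pair b n a u) := by
  have hW := continuous_wtd (d := d) b n
  set h : (Fin d → ℝ) → ℂ := fun x => (wtd b n x : ℂ) * u x with hh
  have mp : ∀ x : Fin d → ℝ, MeasurePreserving (fun y => x - y) volume volume :=
    Measure.measurePreserving_sub_left volume
  -- The quotient $W(y)/W(x-y)$ is continuous and at most $W(x)$, and $h=Wu$ is in $L^2$. The two
  -- dependences on $x$ are treated separately: that of $m$ by dominated convergence, that of
  -- $h(x-\cdot)$ by continuity of translations in $L^2$.
  set m : (Fin d → ℝ) → (Fin d → ℝ) → ℂ := fun x y =>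
    ((wtd b n y * (wtd b n (x - y))⁻¹ : ℝ) : ℂ) with hm
  have hmc : Continuous fun q : (Fin d → ℝ) × (Fin d → ℝ) => m q.1 q.2 := by
    refine Complex.continuous_ofReal.comp ((hW.comp continuous_snd).mul
      ((hW.comp (continuous_fst.sub continuous_snd)).inv₀ fun q => (wtd_pos b n _).ne'))
  have hmn : ∀ x y, ‖m x y‖ ≤ wtd b n x := by
    intro x y
    have h1 := wtd_pos b n (x - y)
    have h2 := wtd_pos b n y
    rw [Complex.norm_real, Real.norm_of_nonneg (by positivity), ← div_eq_mul_inv, div_le_iff₀ h1]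
    exact wtd_le_mul_sub hb n x y
  have e : ∀ x, pair b n a u x = ∫ y, (m x y * a y) * h (x - y) := by
    intro x
    refine integral_congr_ae (Eventually.of_forall fun y => ?_)
    have : (wtd b n (x - y) : ℂ) ≠ 0 := by exact_mod_cast (wtd_pos b n (x - y)).ne'
    simp only [hm, hh]
    push_cast
    field_simp
  have hma : ∀ x, MemLp (fun y => m x y * a y) 2 volume := by
    intro x
    refine (ha.const_mul (wtd b n x : ℂ)).mono (AEStronglyMeasurable.mul
      (hmc.comp (Continuous.prodMk_right x)).aestronglyMeasurable ha.1) (Eventually.of_forall fun y => ?_)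
    rw [norm_mul, norm_mul, norm_ofReal_wtd]
    gcongr
    exact hmn x y
  have hh2 : ∀ x, MemLp (fun y => h (x - y)) 2 volume := fun x =>
    MemLp.comp_measurePreserving hu (mp x)
  have hi : ∀ x z, Integrable (fun y => (m x y * a y) * h (z - y)) := fun x z =>
    (hma x).integrable_mul (hh2 z)
  rw [continuous_iff_continuousAt]
  intro x₀
  have h1 : ContinuousAt (fun x => ∫ y, (m x y * a y) * h (x₀ - y)) x₀ := by
    have hev : ∀ᶠ x in 𝓝 x₀, wtd b n x < wtd b n x₀ + 1 :=
      hW.continuousAt.eventually_lt continuousAt_const (by linarith)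
    refine continuousAt_of_dominated (bound := fun y => (wtd b n x₀ + 1) * ‖a y * h (x₀ - y)‖)
      (Eventually.of_forall fun x => (hi x x₀).1) (hev.mono fun x hx => Eventually.of_forall fun y => ?_)
      ((ha.integrable_mul (hh2 x₀)).norm.const_mul _) (Eventually.of_forall fun y => ?_)
    · rw [mul_assoc, norm_mul]
      gcongr
      exact (hmn x y).trans hx.le
    · have : Continuous fun x => m x y := hmc.comp (Continuous.prodMk_left y)
      exact ((this.mul continuous_const).mul continuous_const).continuousAt
  have h2 : Tendsto (fun x => ∫ y, (m x y * a y) * (h (x - y) - h (x₀ - y))) (𝓝 x₀) (𝓝 0) := by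
    rw [tendsto_zero_iff_enorm_tendsto_zero]
    have hlim : Tendsto (fun x => ENNReal.ofReal (wtd b n x) * eLpNorm a 2 volume *
        eLpNorm (fun y => h (x - y) - h (x₀ - y)) 2 volume) (𝓝 x₀) (𝓝 0) := by
      have := ENNReal.Tendsto.mul (ENNReal.Tendsto.mul_const
        ((ENNReal.continuous_ofReal.comp hW).tendsto x₀) (Or.inr ha.2.ne))
        (Or.inr ENNReal.zero_ne_top) (tendsto_eLpNorm_translate_sub hu x₀)
        (Or.inr (ENNReal.mul_ne_top ENNReal.ofReal_ne_top ha.2.ne))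
      simpa using this
    refine tendsto_of_tendsto_of_tendsto_of_le_of_le tendsto_const_nhds hlim (fun _ => zero_le)
      fun x => ?_
    refine (enorm_integral_mul_le (hma x).1 ((hh2 x).sub (hh2 x₀)).1).trans
      (mul_le_mul_left ?_ _)
    have h3 : ENNReal.ofReal (wtd b n x) = ‖(wtd b n x : ℂ)‖ₑ := by
      rw [← ofReal_norm, norm_ofReal_wtd]
    rw [h3, ← eLpNorm_const_smul]
    refine eLpNorm_mono fun y => ?_
    simp only [Pi.smul_apply, smul_eq_mul, norm_mul, norm_ofReal_wtd]
    gcongr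
    exact hmn x y
  have h3 := h1.tendsto.add h2
  rw [add_zero, ← e] at h3
  refine h3.congr fun x => ?_
  rw [e, ← integral_add (hi x x₀)]
  · simp only [mul_sub]
    refine integral_congr_ae (Eventually.of_forall fun y => ?_)
    ring
  · simp only [mul_sub]
    exact (hi x x).sub (hi x x₀)

theorem quasiMeasurePreserving_sub_sub {d : ℕ} (x : Fin d → ℝ) :
    Measure.QuasiMeasurePreserving (fun q : (Fin d → ℝ) × (Fin d → ℝ) => x - q.1 - q.2)
      (volume.prod volume) volume :=
  (quasiMeasurePreserving_sub_of_right_invariant volume volume).comp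
    ((Measure.measurePreserving_sub_left volume x).prod
      (MeasurePreserving.id volume)).quasiMeasurePreserving

theorem integral_tens_mul_tens {d : ℕ} (A u : Fin d → ℝ → ℂ) (x y : Fin d → ℝ) :
    ∫ z, tens A z * tens u (x - z - y) = tens (fun i => cv (A i) (u i)) (x - y) := by
  unfold tens cv
  rw [← integral_fintype_prod_volume_eq_prod]
  refine integral_congr_ae (Eventually.of_forall fun z => ?_)
  simp only
  rw [← Finset.prod_mul_distrib]
  refine Finset.prod_congr rfl fun i _ => ?_
  simp only [Pi.sub_apply, sub_right_comm]

/-- The absolute values $|A_i|$, $|u_i|$ and their convolutions stay in the weighted class.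
Integrating the modulus over $z$ therefore leaves a pairing of $|a|$ with such a convolution, finite
by Cauchy–Schwarz. -/
theorem integrable_prod_tens_mul {d : ℕ} {b : ℝ} (hb : 0 ≤ b) {n : ℕ} (hn : 1 ≤ n)
    {a : (Fin d → ℝ) → ℂ} (ha : MemLp a 2 volume) {A u : Fin d → ℝ → ℂ}
    (hA : ∀ i, MemW b n (A i)) (hu : ∀ i, MemW b n (u i)) (x : Fin d → ℝ) :
    Integrable (fun q : (Fin d → ℝ) × (Fin d → ℝ) =>
      tens A q.1 * (a q.2 * ((wtd b n q.2 : ℂ) * tens u (x - q.1 - q.2)))) (volume.prod volume) := by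
  have hmA := aestronglyMeasurable_tens fun i => (hA i).aestronglyMeasurable
  have hmu := aestronglyMeasurable_tens fun i => (hu i).aestronglyMeasurable
  have hmW : AEStronglyMeasurable (fun y : Fin d → ℝ => (wtd b n y : ℂ)) volume :=
    (Complex.continuous_ofReal.comp (continuous_wtd b n)).aestronglyMeasurable
  have hm : AEStronglyMeasurable (fun q : (Fin d → ℝ) × (Fin d → ℝ) =>
      tens A q.1 * (a q.2 * ((wtd b n q.2 : ℂ) * tens u (x - q.1 - q.2)))) (volume.prod volume) :=
    hmA.comp_fst.mul (ha.1.comp_snd.mul (hmW.comp_snd.mul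
      (hmu.comp_quasiMeasurePreserving (quasiMeasurePreserving_sub_sub x))))
  rw [integrable_prod_iff' hm]
  constructor
  · refine Eventually.of_forall fun y => ?_
    have h1 : Integrable (fun z : Fin d → ℝ => ∏ i, (A i (z i) * u i (x i - y i - z i))) :=
      Integrable.fintype_prod (f := fun i t => A i t * u i (x i - y i - t)) fun i =>
        (hA i).integrable_conv hb (hu i) (x i - y i)
    refine (h1.const_mul (a y * (wtd b n y : ℂ))).congr (Eventually.of_forall fun z => ?_)
    simp only [tens, Pi.sub_apply, Finset.prod_mul_distrib, sub_right_comm _ (z _)]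
    ring
  · have h2 := (integrable_pair hb ha.norm.ofReal (memWd_tens fun i =>
      (hA i).norm.cv hb hn (hu i).norm) x).norm
    refine h2.congr (Eventually.of_forall fun y => ?_)
    have h3 := integral_tens_mul_tens (fun i t => ((‖A i t‖ : ℝ) : ℂ))
      (fun i t => ((‖u i t‖ : ℝ) : ℂ)) x y
    have h4 : ∀ (v : Fin d → ℝ → ℂ) z, tens (fun i t => ((‖v i t‖ : ℝ) : ℂ)) z =
        ((‖tens v z‖ : ℝ) : ℂ) := by
      intro v z
      simp [tens, norm_prod]
    simp only [h4] at h3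
    have h5 : (∫ z, ‖tens A z‖ * ‖tens u (x - z - y)‖) =
        ‖tens (fun i => cv (fun t => ((‖A i t‖ : ℝ) : ℂ)) fun t => ((‖u i t‖ : ℝ) : ℂ)) (x - y)‖ := by
      rw [← h3]
      rw [← Real.norm_of_nonneg (integral_nonneg (f := fun z => ‖tens A z‖ * ‖tens u (x - z - y)‖)
        fun z => by positivity), ← Complex.norm_real, ← integral_complex_ofReal]
      push_cast
      rfl
    simp only [norm_mul]
    rw [← h5, ← integral_const_mul, ← integral_const_mul]
    refine integral_congr_ae (Eventually.of_forall fun z => ?_)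
    simp
    ring

theorem integrable_tens_mul_pair {d : ℕ} {b : ℝ} (hb : 0 ≤ b) {n : ℕ} (hn : 1 ≤ n)
    {a : (Fin d → ℝ) → ℂ} (ha : MemLp a 2 volume) {A u : Fin d → ℝ → ℂ}
    (hA : ∀ i, MemW b n (A i)) (hu : ∀ i, MemW b n (u i)) (x : Fin d → ℝ) :
    Integrable fun z => tens A z * pair b n a (tens u) (x - z) := by
  refine (integrable_prod_tens_mul hb hn ha hA hu x).integral_prod_left.congr
    (Eventually.of_forall fun z => ?_)
  simp only
  rw [integral_const_mul]
  rfl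

theorem integral_tens_mul_pair {d : ℕ} {b : ℝ} (hb : 0 ≤ b) {n : ℕ} (hn : 1 ≤ n)
    {a : (Fin d → ℝ) → ℂ} (ha : MemLp a 2 volume) {A u : Fin d → ℝ → ℂ}
    (hA : ∀ i, MemW b n (A i)) (hu : ∀ i, MemW b n (u i)) (x : Fin d → ℝ) :
    ∫ z, tens A z * pair b n a (tens u) (x - z) = pair b n a (tens fun i => cv (A i) (u i)) x := by
  unfold pair
  simp only [← integral_const_mul]
  rw [integral_integral_swap (integrable_prod_tens_mul hb hn ha hA hu x)]
  refine integral_congr_ae (Eventually.of_forall fun y => ?_)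
  simp only
  rw [← integral_tens_mul_tens, ← integral_const_mul, ← integral_const_mul]
  refine integral_congr_ae (Eventually.of_forall fun z => ?_)
  simp only
  ring

/-! ### The Calderón formula for functionals -/

/-- Halving the argument leaves half of the exponential rate unused, which absorbs the polynomial
factor. This fits the available integrability of $e^{b|x|}|S(x)|$, without polynomial weight. -/
theorem exists_wt_half_le {b : ℝ} (hb : 0 < b) (n : ℕ) :
    ∃ C : ℝ, 0 ≤ C ∧ ∀ (x : ℝ) (r : ℝ), 0 ≤ r → r ≤ 1 / 2 → wt b n (r * x) ≤ C * Real.exp (b * |x|) := by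
  obtain ⟨C, hC, h⟩ := exists_pow_le_exp n (half_pos hb)
  refine ⟨C * Real.exp (b / 2), by positivity, fun x r hr hr2 => ?_⟩
  have h1 := h (1 + |x|)
  have hx := abs_nonneg x
  have hrx : |r * x| ≤ 1 / 2 * |x| := by
    rw [abs_mul, abs_of_nonneg hr]
    gcongr
  rw [abs_of_nonneg (by positivity : 0 ≤ 1 + |x|)] at h1
  calc wt b n (r * x) ≤ Real.exp (b * (1 / 2 * |x|)) * (1 + |x|) ^ n := by
        unfold wt
        have : |r * x| ≤ |x| := by linarith
        gcongr
    _ ≤ Real.exp (b * (1 / 2 * |x|)) * (C * Real.exp (b / 2 * (1 + |x|))) := by gcongr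
    _ = C * (Real.exp (b * (1 / 2 * |x|)) * Real.exp (b / 2 * (1 + |x|))) := by ring
    _ = C * (Real.exp (b / 2) * Real.exp (b * |x|)) := by
        rw [← Real.exp_add, ← Real.exp_add]
        ring_nf
    _ = _ := by ring

theorem integral_tens_scl_mul {d : ℕ} (S : Fin d → ℝ → ℂ) (F : (Fin d → ℝ) → ℂ) {r : ℝ} (hr : 0 < r)
    (x : Fin d → ℝ) :
    ∫ z, tens (fun i => scl r (S i)) z * F (x - z) = ∫ z, tens S z * F (x - r⁻¹ • z) := by
  have h := Measure.integral_comp_smul (volume : Measure (Fin d → ℝ))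
    (fun z => tens S z * F (x - r⁻¹ • z)) r
  have e : ∀ z, tens (fun i => scl r (S i)) z * F (x - z) =
      (r : ℂ) ^ d * (tens S (r • z) * F (x - r⁻¹ • r • z)) := by
    intro z
    rw [inv_smul_smul₀ hr.ne', ← mul_assoc]
    congr 1
    simp [tens, scl, Finset.prod_mul_distrib]
  simp only [e]
  rw [integral_const_mul, h, Module.finrank_fin_fun, abs_of_pos (by positivity), Complex.real_smul]
  push_cast
  rw [← mul_assoc, mul_inv_cancel₀ (by exact_mod_cast (pow_pos hr d).ne'), one_mul]

theorem tendsto_integral_tens_scl {d : ℕ} {b : ℝ} (hb : 0 < b) {n : ℕ} (hn : 1 ≤ n)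
    {S : Fin d → ℝ → ℂ} (hS : ∀ i, MemW b n (S i)) (h1 : ∀ i, ∫ x, S i x = 1)
    {F : (Fin d → ℝ) → ℂ} (hF : Continuous F) {C : ℝ} (hC : 0 ≤ C)
    (hFC : ∀ x, ‖F x‖ ≤ C * wtd b n x) (x : Fin d → ℝ) :
    Tendsto (fun N : ℕ => ∫ z, tens (fun i => scl (2 ^ N) (S i)) z * F (x - z)) atTop (𝓝 (F x)) := by
  obtain ⟨K, hK, hwt⟩ := exists_wt_half_le hb n
  have e : ∀ N : ℕ, ∫ z, tens (fun i => scl (2 ^ N) (S i)) z * F (x - z) =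
      ∫ z, tens S z * F (x - ((2 : ℝ) ^ N)⁻¹ • z) := fun N =>
    integral_tens_scl_mul S F (by positivity) x
  have hlim : ∫ z, tens S z * F x = F x := by
    rw [integral_mul_const]
    unfold tens
    rw [integral_fintype_prod_volume_eq_prod]
    simp [h1]
  simp only [e]
  rw [← hlim]
  have hmS := aestronglyMeasurable_tens fun i => (hS i).aestronglyMeasurable
  refine tendsto_integral_filter_of_dominated_convergence
    (fun z => C * wtd b n x * ∏ i, (K * (Real.exp (b * |z i|) * ‖S i (z i)‖)))
    (Eventually.of_forall fun N => hmS.mul (hF.comp (by fun_prop)).aestronglyMeasurable) ?_ ?_ ?_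
  -- Only $N\ge1$ gives $2^{-N}\le1/2$; the term $N=0$ need not be dominated.
  · filter_upwards [eventually_ge_atTop 1] with N hN
    refine Eventually.of_forall fun z => ?_
    have hr : ((2 : ℝ) ^ N)⁻¹ ≤ 1 / 2 := by
      rw [one_div]
      gcongr
      exact le_self_pow₀ (by norm_num) (by omega)
    have h2 : wtd b n (x - ((2 : ℝ) ^ N)⁻¹ • z) ≤
        wtd b n x * ∏ i, (K * Real.exp (b * |z i|)) := by
      have h3 := wtd_add_le hb.le n x (-(((2 : ℝ) ^ N)⁻¹ • z))
      rw [← sub_eq_add_neg, wtd_neg] at h3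
      refine h3.trans (mul_le_mul_of_nonneg_left ?_ (wtd_pos b n x).le)
      exact Finset.prod_le_prod (fun i _ => (wt_pos b n _).le) fun i _ =>
        hwt (z i) _ (by positivity) hr
    rw [norm_mul]
    calc ‖tens S z‖ * ‖F (x - ((2 : ℝ) ^ N)⁻¹ • z)‖
        ≤ ‖tens S z‖ * (C * (wtd b n x * ∏ i, (K * Real.exp (b * |z i|)))) := by
          gcongr
          exact (hFC _).trans (by gcongr)
      _ = _ := by
          rw [tens, norm_prod]
          simp only [Finset.prod_mul_distrib]
          ring
  · exact (Integrable.fintype_prod (f := fun i t => K * (Real.exp (b * |t|) * ‖S i t‖)) fun i =>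
      ((hS i).integrable_exp hn).const_mul K).const_mul _
  · refine Eventually.of_forall fun z => Tendsto.const_mul _ ?_
    have h3 : Tendsto (fun N : ℕ => x - ((2 : ℝ) ^ N)⁻¹ • z) atTop (𝓝 (x - (0 : ℝ) • z)) := by
      refine tendsto_const_nhds.sub (Tendsto.smul_const ?_ z)
      simp_rw [← inv_pow]
      exact tendsto_pow_atTop_nhds_zero_of_lt_one (by norm_num) (by norm_num)
    rw [zero_smul, sub_zero] at h3
    exact (hF.tendsto x).comp h3

/-- The convolution of a functional with representation `a` and the tensor product of `G_i 0`. -/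
noncomputable def reprConv {d : ℕ} (b : ℝ) (n : ℕ) (a : (Fin d → ℕ) → (Fin d → ℝ) → ℂ)
    (G : Fin d → ℕ → ℝ → ℂ) (x : Fin d → ℝ) : ℂ :=
  ∑ α ∈ Finset.Icc (0 : Fin d → ℕ) fun _ => n,
    (-1) ^ (∑ i, α i) * pair b n (a α) (tens fun i => G i (α i)) x

/-- A single family $a$ serves all tensor products at once. This lets the convolutions of $f$ with
$\psi_{\bar j}$ and with $\varphi_{\bar k}$ be compared through one integral representation. -/
theorem DualSpace.exists_conv_eq {d : ℕ} {b : ℝ} (hb : 0 ≤ b) {n : ℕ}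
    (f : DualSpace b (fun _ : Fin d => n)) :
    ∃ a : (Fin d → ℕ) → (Fin d → ℝ) → ℂ, (∀ α, MemLp (a α) 2 volume) ∧
      ∀ (u : Fin d → ℝ → ℂ) (G : Fin d → ℕ → ℝ → ℂ), (∀ i, Chain n (G i)) →
        (∀ i, ∀ s ≤ n, MemW b n (G i s)) → (∀ i, u i =ᵐ[volume] G i 0) →
        conv (tens u) f = reprConv b n a G := by
  obtain ⟨a, ha, h⟩ := f.exists_repr
  refine ⟨a, ha, fun u G hC hG hu => ?_⟩
  funext x
  have hW : ∀ α ≤ fun _ => n, MemWd b n (tensDeriv G x α) := fun α hα => memWd_tensDeriv hb hG x hα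
  have hD := isWeakDerivFamily_tensDeriv hb hC hG hu x
  have hmem : (fun y => tens u (x - y)) ∈ testSpace b (fun _ : Fin d => n) :=
    ⟨tensDeriv G x, hD, expSum_lt_top hW⟩
  rw [conv, dif_pos hmem, h _ _ hmem hD hW]
  refine Finset.sum_congr rfl fun α _ => ?_
  rw [pair, ← integral_const_mul]
  refine integral_congr_ae (Eventually.of_forall fun y => ?_)
  simp only [tensDeriv]
  ring

section

variable {d : ℕ} {b : ℝ} {n : ℕ} {a : (Fin d → ℕ) → (Fin d → ℝ) → ℂ}

theorem continuous_reprConv (hb : 0 ≤ b) (ha : ∀ α, MemLp (a α) 2 volume) {G : Fin d → ℕ → ℝ → ℂ}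
    (hG : ∀ i, ∀ s ≤ n, MemW b n (G i s)) : Continuous (reprConv b n a G) := by
  unfold reprConv
  refine continuous_finsetSum _ fun α hα => continuous_const.mul (continuous_pair hb (ha α) ?_)
  exact memWd_tens fun i => hG i (α i) ((Finset.mem_Icc.1 hα).2 i)

theorem exists_norm_reprConv_le (hb : 0 ≤ b) (ha : ∀ α, MemLp (a α) 2 volume)
    {G : Fin d → ℕ → ℝ → ℂ} (hG : ∀ i, ∀ s ≤ n, MemW b n (G i s)) :
    ∃ C : ℝ, 0 ≤ C ∧ ∀ x, ‖reprConv b n a G x‖ ≤ C * wtd b n x := by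
  have h : ∀ α : Fin d → ℕ, ∃ C : ℝ, 0 ≤ C ∧ (α ∈ Finset.Icc (0 : Fin d → ℕ) (fun _ => n) →
      ∀ x, ‖pair b n (a α) (tens fun i => G i (α i)) x‖ ≤ C * wtd b n x) := by
    intro α
    by_cases hα : α ∈ Finset.Icc (0 : Fin d → ℕ) fun _ => n
    · obtain ⟨C, h0, hC⟩ := exists_norm_pair_le hb (ha α)
        (memWd_tens fun i => hG i (α i) ((Finset.mem_Icc.1 hα).2 i))
      exact ⟨C, h0, fun _ => hC⟩
    · exact ⟨0, le_rfl, fun h => absurd h hα⟩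
  choose C hC0 hC using h
  refine ⟨∑ α ∈ Finset.Icc (0 : Fin d → ℕ) fun _ => n, C α, Finset.sum_nonneg fun α _ => hC0 α,
    fun x => ?_⟩
  unfold reprConv
  rw [Finset.sum_mul]
  refine norm_sum_le_of_le _ fun α hα => ?_
  rw [norm_mul, norm_pow, norm_neg, norm_one, one_pow, one_mul]
  exact hC α hα x

theorem integral_tens_mul_reprConv (hb : 0 ≤ b) (hn : 1 ≤ n) (ha : ∀ α, MemLp (a α) 2 volume)
    {A : Fin d → ℝ → ℂ} (hA : ∀ i, MemW b n (A i)) {G : Fin d → ℕ → ℝ → ℂ}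
    (hG : ∀ i, ∀ s ≤ n, MemW b n (G i s)) (x : Fin d → ℝ) :
    ∫ z, tens A z * reprConv b n a G (x - z) =
      reprConv b n a (fun i s => cv (A i) (G i s)) x := by
  unfold reprConv
  simp only [Finset.mul_sum]
  rw [integral_finsetSum]
  · refine Finset.sum_congr rfl fun α hα => ?_
    rw [← integral_tens_mul_pair hb hn (ha α) hA fun i => hG i (α i) ((Finset.mem_Icc.1 hα).2 i),
      ← integral_const_mul]
    refine integral_congr_ae (Eventually.of_forall fun z => ?_)
    simp only
    ring
  · intro α hα
    refine ((integrable_tens_mul_pair hb hn (ha α) hA (fun i => hG i (α i) ((Finset.mem_Icc.1 hα).2 i))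
      x).const_mul ((-1) ^ (∑ i, α i))).congr
      (Eventually.of_forall fun z => ?_)
    simp only
    ring

theorem reprConv_sum (hb : 0 ≤ b) (ha : ∀ α, MemLp (a α) 2 volume) {G : Fin d → ℕ → ℝ → ℂ}
    {N : ℕ} {H : Fin d → ℕ → ℕ → ℝ → ℂ} (hH : ∀ i k, ∀ s ≤ n, MemW b n (H i k s))
    (h : ∀ i, ∀ s ≤ n, G i s =ᵐ[volume] fun x => ∑ k ∈ Finset.range N, H i k s x) (x : Fin d → ℝ) :
    reprConv b n a G x =
      ∑ k ∈ Fintype.piFinset fun _ : Fin d => Finset.range N, reprConv b n a (fun i => H i (k i)) x := by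
  unfold reprConv
  rw [Finset.sum_comm]
  refine Finset.sum_congr rfl fun α hα => ?_
  have hα' := (Finset.mem_Icc.1 hα).2
  have e : tens (fun i => G i (α i)) =ᵐ[volume]
      fun z => ∑ k ∈ Fintype.piFinset fun _ : Fin d => Finset.range N, tens (fun i => H i (k i) (α i)) z := by
    have h1 : ∀ᵐ z : Fin d → ℝ, ∀ i, G i (α i) (z i) = ∑ k ∈ Finset.range N, H i k (α i) (z i) := by
      rw [ae_all_iff]
      exact fun i => (Measure.quasiMeasurePreserving_eval (α := fun _ : Fin d => ℝ)
        (fun _ => volume) i).ae (p := fun r => G i (α i) r = ∑ k ∈ Finset.range N, H i k (α i) r)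
        (h i (α i) (hα' i))
    filter_upwards [h1] with z hz
    unfold tens
    simp only [hz]
    exact Finset.prod_univ_sum _ _
  rw [pair_congr_ae b n (a α) e, pair_finset_sum hb (ha α), Finset.mul_sum]
  exact fun k _ => memWd_tens fun i => hH i (k i) (α i) (hα' i)

/-- The pointwise consequence of the reproducing formula. -/
theorem enorm_reprConv_le {b' : ℝ} {L : ℕ} {a : (Fin d → ℕ) → (Fin d → ℝ) → ℂ} (hb : 0 < b)
    (ha : ∀ α, MemLp (a α) 2 volume)
    {C : Fin d → ℝ} {Ψ F : Fin d → ℕ → ℕ → ℝ → ℂ} {S : Fin d → ℝ → ℂ} {K : Fin d → ℕ → ℕ → ℝ → ℂ}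
    (h : ∀ i, RepSystem b b' (C i) L (Ψ i) (F i) (S i) (K i)) (j : Fin d → ℕ) (x : Fin d → ℝ) :
    ‖reprConv b (L + 1) a (fun i => Ψ i (j i)) x‖ₑ ≤
      ∑' k : Fin d → ℕ, ∫⁻ z, ‖tens (fun i => K i (j i) (k i)) z‖ₑ *
        ‖reprConv b (L + 1) a (fun i => F i (k i)) (x - z)‖ₑ := by
  have hn : 1 ≤ L + 1 := Nat.le_add_left 1 L
  have hΨ : ∀ i, ∀ s ≤ L + 1, MemW b (L + 1) (Ψ i (j i) s) := fun i => (h i).memW_left (j i)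
  have hF : ∀ (k : Fin d → ℕ) i, ∀ s ≤ L + 1, MemW b (L + 1) (F i (k i) s) :=
    fun k i => (h i).memW_right (k i)
  obtain ⟨D, hD0, hD⟩ := exists_norm_reprConv_le hb.le ha hΨ
  have hlim := tendsto_integral_tens_scl hb hn (fun i => (h i).memW_approx)
    (fun i => (h i).integral_approx) (continuous_reprConv hb.le ha hΨ) hD0 hD x
  -- The bound is proved for each approximate identity, whose finite sum is at most the full series
  -- in $[0,\infty]$. Convergence of the series is not required, so $f$ may be any functional.
  refine le_of_tendsto hlim.enorm (Eventually.of_forall fun N => ?_)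
  have hS : ∀ i, MemW b (L + 1) (scl (2 ^ N) (S i)) := fun i =>
    (h i).memW_approx.scl hb.le (one_le_pow₀ (by norm_num))
  rw [integral_tens_mul_reprConv hb.le hn ha hS hΨ,
    reprConv_sum hb.le ha (N := N + 1) (H := fun i k s => cv (K i (j i) k) (F i k s))
      (fun i k s hs => ((h i).memW_kernel _ _).cv hb.le hn ((h i).memW_right k s hs))
      (fun i s hs => (h i).reproduce (j i) N s hs)]
  refine (enorm_sum_le _ _).trans (le_trans (Finset.sum_le_sum fun k _ => ?_)
    (ENNReal.sum_le_tsum (Fintype.piFinset fun _ : Fin d => Finset.range (N + 1))))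
  -- Read backwards, the formula takes the kernel out of the chain and leaves the genuine
  -- convolution of $f$ with $\varphi_{\bar k}$.
  rw [← integral_tens_mul_reprConv hb.le hn ha (fun i => (h i).memW_kernel (j i) (k i)) (hF k)]
  refine (enorm_integral_le_lintegral_enorm _).trans (le_of_eq ?_)
  simp only [enorm_mul]

end

/-! ### Estimates of the maximal function and of exponential averages -/

theorem expKer_nonneg (γ : ℝ) (m : ℕ) (x : ℝ) : 0 ≤ expKer γ m x := by
  unfold expKer
  positivity

/-- An exponential at a scale no finer than $2^j$ varies under translation by at most the factor
found in the denominator of the Peetre function at level $j$. -/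
theorem expKer_sub_le {γ : ℝ} (hγ : 0 ≤ γ) {m j : ℕ} (hm : m ≤ j) (x y : ℝ) :
    expKer γ m (x - y) ≤ expKer γ m x * Real.exp (2 ^ j * γ * |y|) := by
  unfold expKer
  rw [mul_assoc, ← Real.exp_add]
  gcongr
  have h1 : |x| ≤ |x - y| + |y| := by simpa using abs_add_le (x - y) y
  have h2 : (2 : ℝ) ^ m ≤ 2 ^ j := pow_le_pow_right₀ (by norm_num) hm
  have h3 : (2 : ℝ) ^ m * |y| ≤ 2 ^ j * |y| := by gcongr
  have h4 : (2 : ℝ) ^ m * |x| ≤ 2 ^ m * |x - y| + 2 ^ m * |y| := by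
    rw [← mul_add]
    gcongr
  nlinarith

/-- The tensor product of exponential kernels. -/
noncomputable def expTens {d : ℕ} (γ : ℝ) (m : Fin d → ℕ) (x : Fin d → ℝ) : ℝ :=
  ∏ i, expKer γ (m i) (x i)

theorem continuous_expTens {d : ℕ} (γ : ℝ) (m : Fin d → ℕ) : Continuous (expTens γ m) := by
  unfold expTens expKer
  fun_prop

theorem expTens_nonneg {d : ℕ} (γ : ℝ) (m : Fin d → ℕ) (x : Fin d → ℝ) : 0 ≤ expTens γ m x :=
  Finset.prod_nonneg fun i _ => expKer_nonneg γ (m i) (x i)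

/-- The average of `|F|` with exponential weights. -/
noncomputable def expAvg {d : ℕ} (γ : ℝ) (m : Fin d → ℕ) (F : (Fin d → ℝ) → ℂ) (x : Fin d → ℝ) : ℝ≥0∞ :=
  ∫⁻ u, ENNReal.ofReal (expTens γ m u) * ‖F (x - u)‖ₑ

theorem peetreMax_le_tsum {d : ℕ} {b' : ℝ} (hb' : 0 ≤ b') {j : Fin d → ℕ} {F : (Fin d → ℝ) → ℂ}
    {G : (Fin d → ℕ) → (Fin d → ℝ) → ℂ} {K : (Fin d → ℕ) → Fin d → ℝ → ℂ}
    (h : ∀ x, ‖F x‖ₑ ≤ ∑' k : Fin d → ℕ, ∫⁻ z, ‖tens (K k) z‖ₑ * ‖G k (x - z)‖ₑ)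
    {c : (Fin d → ℕ) → Fin d → ℝ} {m : (Fin d → ℕ) → Fin d → ℕ} (hc : ∀ k i, 0 ≤ c k i)
    (hm : ∀ k i, m k i ≤ j i) (hK : ∀ k i x, ‖K k i x‖ ≤ c k i * expKer b' (m k i) x)
    (x : Fin d → ℝ) :
    peetreMax b' j F x ≤ ∑' k, ENNReal.ofReal (∏ i, c k i) * expAvg b' (m k) (G k) x := by
  refine iSup_le fun y => ENNReal.div_le_of_le_mul ?_
  refine (h (x - y)).trans ?_
  rw [← ENNReal.tsum_mul_right]
  refine ENNReal.tsum_le_tsum fun k => ?_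
  -- The substitution $z=u-y$ turns $G_k(x-y-z)$ into $G_k(x-u)$; the point $y$ survives only in the
  -- kernel, where `expKer_sub_le` removes it.
  rw [← lintegral_sub_right_eq_self _ y, mul_right_comm, expAvg,
    ← ENNReal.ofReal_mul (Finset.prod_nonneg fun i _ => hc k i),
    ← lintegral_const_mul' _ _ ENNReal.ofReal_ne_top]
  refine lintegral_mono fun u => ?_
  simp only
  rw [sub_sub_sub_cancel_right, ← mul_assoc, ← ENNReal.ofReal_mul (mul_nonneg
    (Finset.prod_nonneg fun i _ => hc k i) (Finset.prod_nonneg fun i _ => (Real.exp_pos _).le)),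
    ← ofReal_norm]
  gcongr
  unfold tens expTens
  rw [norm_prod, ← Finset.prod_mul_distrib, ← Finset.prod_mul_distrib]
  refine Finset.prod_le_prod (fun i _ => norm_nonneg _) fun i _ => ?_
  refine (hK k i _).trans ?_
  rw [mul_assoc, mul_comm (Real.exp _)]
  exact mul_le_mul_of_nonneg_left (expKer_sub_le hb' (hm k i) _ _) (hc k i)

theorem eLpNorm_tsum_le {α κ : Type*} [MeasurableSpace α] [Countable κ] {μ : Measure α}
    {f : κ → α → ℝ≥0∞} (hf : ∀ k, AEMeasurable (f k) μ) {p : ℝ≥0∞} (hp : 1 ≤ p) :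
    eLpNorm (fun x => ∑' k, f k x) p μ ≤ ∑' k, eLpNorm (f k) p μ := by
  rcases eq_or_ne p ⊤ with rfl | hpt
  · simp only [eLpNorm_exponent_top]
    refine essSup_le_of_ae_le _ ?_
    have h1 : ∀ᵐ x ∂μ, ∀ k, ‖f k x‖ₑ ≤ eLpNormEssSup (f k) μ :=
      ae_all_iff.2 fun k => enorm_ae_le_eLpNormEssSup (f k) μ
    filter_upwards [h1] with x hx
    exact ENNReal.tsum_le_tsum hx
  have hp0 : p ≠ 0 := (one_pos.trans_le hp).ne'
  have hr : 0 < p.toReal := ENNReal.toReal_pos hp0 hpt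
  have hfin : ∀ s : Finset κ, eLpNorm (fun x => ∑ k ∈ s, f k x) p μ ≤ ∑' k, eLpNorm (f k) p μ := by
    intro s
    have h1 := eLpNorm_sum_le (f := f) (s := s) (fun k _ => (hf k).aestronglyMeasurable) hp
    have e : ∑ k ∈ s, f k = fun x => ∑ k ∈ s, f k x := by
      funext x
      simp
    rw [e] at h1
    exact h1.trans (ENNReal.sum_le_tsum s)
  rw [eLpNorm_eq_lintegral_rpow_enorm_toReal hp0 hpt]
  have e : ∀ x, ‖∑' k, f k x‖ₑ ^ p.toReal = ⨆ s : Finset κ, (∑ k ∈ s, f k x) ^ p.toReal := by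
    intro x
    rw [enorm_eq_self, ENNReal.tsum_eq_iSup_sum]
    exact (ENNReal.orderIsoRpow p.toReal hr).map_iSup _
  simp only [e]
  rw [lintegral_iSup_directed]
  · rw [one_div, ENNReal.rpow_inv_le_iff hr]
    refine iSup_le fun s => ?_
    have := ENNReal.rpow_le_rpow (hfin s) hr.le
    rw [eLpNorm_eq_lintegral_rpow_enorm_toReal hp0 hpt, one_div, ENNReal.rpow_inv_rpow hr.ne'] at this
    exact this
  · exact fun s => (Finset.aemeasurable_fun_sum s fun k _ => hf k).pow_const _
  · refine Monotone.directed_le fun s t hst x => ?_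
    exact ENNReal.rpow_le_rpow (Finset.sum_le_sum_of_subset hst) hr.le

/-- Uniformity in $m$ comes from $2^m\ge1$: each factor is $2\cdot2^m/(b'2^m-c)\le2/(b'-c)$. -/
theorem lintegral_expTens_le {d : ℕ} {b' c : ℝ} (hc : 0 ≤ c) (hcb : c < b') (m : Fin d → ℕ) :
    ∫⁻ u, ENNReal.ofReal (expTens b' m u) * ENNReal.ofReal (Real.exp (c * l1Norm u)) ≤
      ENNReal.ofReal ((2 / (b' - c)) ^ d) := by
  have hp : ∀ i, 0 < b' * 2 ^ m i - c := by
    intro i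
    have : (1 : ℝ) ≤ 2 ^ m i := one_le_pow₀ (by norm_num)
    nlinarith
  have e : ∀ u : Fin d → ℝ, expTens b' m u * Real.exp (c * l1Norm u) =
      ∏ i, (2 ^ m i * Real.exp (-((b' * 2 ^ m i - c) * |u i|))) := by
    intro u
    rw [l1Norm, Finset.mul_sum, Real.exp_sum, expTens, ← Finset.prod_mul_distrib]
    refine Finset.prod_congr rfl fun i _ => ?_
    rw [expKer, mul_assoc, ← Real.exp_add]
    congr 2
    ring
  simp_rw [← ENNReal.ofReal_mul (expTens_nonneg b' m _), e]
  rw [← ofReal_integral_eq_lintegral_ofReal]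
  · refine ENNReal.ofReal_le_ofReal ?_
    rw [integral_fintype_prod_volume_eq_prod (f := fun i t =>
      2 ^ m i * Real.exp (-((b' * 2 ^ m i - c) * |t|)))]
    have : (2 / (b' - c)) ^ d = ∏ _i : Fin d, (2 / (b' - c)) := (Fin.prod_const d _).symm
    rw [this]
    refine Finset.prod_le_prod (fun i _ => integral_nonneg fun t => by positivity) fun i _ => ?_
    rw [integral_const_mul, integral_exp_neg_abs (hp i), mul_div_assoc', div_le_div_iff₀ (hp i) (by linarith)]
    have : (1 : ℝ) ≤ 2 ^ m i := one_le_pow₀ (by norm_num)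
    nlinarith
  · exact Integrable.fintype_prod (f := fun i t =>
      2 ^ m i * Real.exp (-((b' * 2 ^ m i - c) * |t|))) fun i =>
      (integrable_exp_neg_abs (hp i)).const_mul _
  · exact Eventually.of_forall fun u => Finset.prod_nonneg fun i _ => by positivity

/-- Jensen's inequality is applied for the density $Qe$ to $e^{-1}g$; the power $e^{-r}$ so produced
cancels the growth $e^r$ of the weight. Only the first power of $e$ has to be integrable against
$Q$, and with $e=e^{(c/p)|u|_1}$ this is why $c/p<b'$ suffices. -/
theorem lintegral_avg_rpow_mul_le {d : ℕ} {Q g v e e' : (Fin d → ℝ) → ℝ≥0∞} (hQ : Measurable Q)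
    (hg : Measurable g) (hv : AEMeasurable v volume) (he : Measurable e) (he' : Measurable e')
    (hee : ∀ u, e u * e' u = 1) {r : ℝ} (hr : 1 ≤ r) {D : ℝ≥0∞}
    (h : ∀ x u, v x ≤ D * (v (x - u) * e u ^ r)) :
    ∫⁻ x, v x * (∫⁻ u, Q u * g (x - u)) ^ r ≤
      D * (∫⁻ u, Q u * e u) ^ r * ∫⁻ x, v x * g x ^ r := by
  set I := ∫⁻ u, Q u * e u with hI
  have hr0 : 0 ≤ r := by linarith
  have e1 : ∀ x, (∫⁻ u, Q u * g (x - u)) ^ r ≤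
      I ^ (r - 1) * ∫⁻ u, (Q u * e u) * (e' u * g (x - u)) ^ r := by
    intro x
    have h1 := lintegral_mul_rpow_le (μ := volume) (k := fun u => Q u * e u)
      (g := fun u => e' u * g (x - u)) (hQ.mul he).aemeasurable
      (he'.mul (hg.comp (measurable_const.sub measurable_id))).aemeasurable hr
    refine le_trans (le_of_eq ?_) h1
    congr 1
    refine lintegral_congr fun u => ?_
    rw [mul_assoc, ← mul_assoc (e u), hee, one_mul]
  have e2 : ∀ x u, v x * ((Q u * e u) * (e' u * g (x - u)) ^ r) ≤
      D * ((Q u * e u) * (v (x - u) * g (x - u) ^ r)) := by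
    intro x u
    rw [ENNReal.mul_rpow_of_nonneg _ _ hr0]
    have h3 : e u ^ r * e' u ^ r = 1 := by
      rw [← ENNReal.mul_rpow_of_nonneg _ _ hr0, hee, ENNReal.one_rpow]
    calc v x * ((Q u * e u) * (e' u ^ r * g (x - u) ^ r))
        ≤ (D * (v (x - u) * e u ^ r)) * ((Q u * e u) * (e' u ^ r * g (x - u) ^ r)) :=
          mul_le_mul_left (h x u) _
      _ = D * ((Q u * e u) * (v (x - u) * g (x - u) ^ r)) * (e u ^ r * e' u ^ r) := by ring
      _ = _ := by rw [h3, mul_one]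
  have hmg : AEMeasurable (fun x => v x * g x ^ r) volume := hv.mul (hg.pow_const r).aemeasurable
  have hmp : AEMeasurable (fun q : (Fin d → ℝ) × (Fin d → ℝ) =>
      (Q q.2 * e q.2) * (v (q.1 - q.2) * g (q.1 - q.2) ^ r)) (volume.prod volume) :=
    ((hQ.mul he).comp measurable_snd).aemeasurable.mul (hmg.comp_quasiMeasurePreserving
      (quasiMeasurePreserving_sub_of_right_invariant volume volume))
  have e3 : ∫⁻ x, ∫⁻ u, (Q u * e u) * (v (x - u) * g (x - u) ^ r) = I * ∫⁻ x, v x * g x ^ r := by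
    have hQe : Measurable fun u => Q u * e u := hQ.mul he
    rw [lintegral_lintegral_swap hmp, hI, ← lintegral_mul_const'' _ hQe.aemeasurable]
    refine lintegral_congr fun u => ?_
    have h5 : AEMeasurable (fun x => v (x - u) * g (x - u) ^ r) volume :=
      hmg.comp_quasiMeasurePreserving (measurePreserving_sub_right volume u).quasiMeasurePreserving
    rw [lintegral_const_mul'' _ h5, lintegral_sub_right_eq_self (fun x => v x * g x ^ r) u]
  have hmp1 : AEMeasurable (fun x => ∫⁻ u, (Q u * e u) * (v (x - u) * g (x - u) ^ r)) volume :=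
    hmp.lintegral_prod_right'
  calc ∫⁻ x, v x * (∫⁻ u, Q u * g (x - u)) ^ r
      ≤ ∫⁻ x, (I ^ (r - 1) * D) * ∫⁻ u, (Q u * e u) * (v (x - u) * g (x - u) ^ r) := by
        refine lintegral_mono fun x => ?_
        have h4 : Measurable fun u => (Q u * e u) * (e' u * g (x - u)) ^ r :=
          (hQ.mul he).mul ((he'.mul (hg.comp (measurable_const.sub measurable_id))).pow_const r)
        have h6 : AEMeasurable (fun u => (Q u * e u) * (v (x - u) * g (x - u) ^ r)) volume :=
          (hQ.mul he).aemeasurable.mul (hmg.comp_quasiMeasurePreserving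
            (Measure.measurePreserving_sub_left volume x).quasiMeasurePreserving)
        calc v x * (∫⁻ u, Q u * g (x - u)) ^ r
            ≤ v x * (I ^ (r - 1) * ∫⁻ u, (Q u * e u) * (e' u * g (x - u)) ^ r) := by
              gcongr
              exact e1 x
          _ = I ^ (r - 1) * ∫⁻ u, v x * ((Q u * e u) * (e' u * g (x - u)) ^ r) := by
              rw [lintegral_const_mul _ h4]
              ring
          _ ≤ I ^ (r - 1) * ∫⁻ u, D * ((Q u * e u) * (v (x - u) * g (x - u) ^ r)) := by
              refine mul_le_mul_right (lintegral_mono fun u => ?_) _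
              exact e2 x u
          _ = _ := by
              rw [lintegral_const_mul'' _ h6]
              ring
    _ = (I ^ (r - 1) * D) * (I * ∫⁻ x, v x * g x ^ r) := by
        rw [lintegral_const_mul'' _ hmp1, e3]
    _ = D * (I ^ (r - 1) * I ^ (1 : ℝ)) * ∫⁻ x, v x * g x ^ r := by
        rw [ENNReal.rpow_one]
        ring
    _ = _ := by
        rw [← ENNReal.rpow_add_of_nonneg _ _ (by linarith) zero_le_one, sub_add_cancel]

theorem IsExpWeight.aemeasurable {d : ℕ} {w : (Fin d → ℝ) → ℝ} {c : ℝ} (hw : IsExpWeight w c) :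
    AEMeasurable (fun x => ENNReal.ofReal (w x)) volume :=
  hw.locallyIntegrable.aestronglyMeasurable.aemeasurable.ennreal_ofReal

theorem IsExpWeight.absolutelyContinuous {d : ℕ} {w : (Fin d → ℝ) → ℝ} {c : ℝ}
    (hw : IsExpWeight w c) : volume ≪ weighted w :=
  withDensity_absolutelyContinuous' hw.aemeasurable
    (Eventually.of_forall fun x => (ENNReal.ofReal_pos.2 (hw.pos x)).ne')

theorem measurable_expAvg {d : ℕ} (γ : ℝ) (m : Fin d → ℕ) {F : (Fin d → ℝ) → ℂ} (hF : Continuous F) :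
    Measurable (expAvg γ m F) := by
  have : Measurable fun q : (Fin d → ℝ) × (Fin d → ℝ) =>
      ENNReal.ofReal (expTens γ m q.2) * ‖F (q.1 - q.2)‖ₑ := by
    have h1 := (continuous_expTens γ m).measurable
    have h2 := hF.measurable
    fun_prop
  exact this.lintegral_prod_right'

theorem exists_eLpNorm_expAvg_le {d : ℕ} {p : ℝ≥0∞} (hp : 1 ≤ p) {w : (Fin d → ℝ) → ℝ} {c : ℝ}
    (hw : IsExpWeight w c) {b' : ℝ} (hb' : 0 < b') (hcb' : c / p.toReal < b') :
    ∃ D : ℝ≥0, ∀ (m : Fin d → ℕ) (F : (Fin d → ℝ) → ℂ), Continuous F →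
      eLpNorm (expAvg b' m F) p (weighted w) ≤ D * eLpNorm F p (weighted w) := by
  have hc := hw.const_pos
  rcases eq_or_ne p ⊤ with rfl | hpt
  -- For $p=\infty$ the weight enters only through its null sets. These are Lebesgue null sets, as
  -- $w>0$, so the total mass of the kernel is the constant.
  · refine ⟨((2 / b') ^ d).toNNReal, fun m F hF => ?_⟩
    simp only [eLpNorm_exponent_top]
    refine essSup_le_of_ae_le _ (Eventually.of_forall fun x => ?_)
    have h0 : ∀ᵐ z, ‖F z‖ₑ ≤ eLpNormEssSup F (weighted w) :=
      hw.absolutelyContinuous.ae_le (enorm_ae_le_eLpNormEssSup F (weighted w))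
    have h1 : ∀ᵐ u, ‖F (x - u)‖ₑ ≤ eLpNormEssSup F (weighted w) :=
      (Measure.measurePreserving_sub_left (volume : Measure (Fin d → ℝ)) x).quasiMeasurePreserving.ae h0
    have h2 := lintegral_expTens_le le_rfl hb' m
    simp only [zero_mul, Real.exp_zero, ENNReal.ofReal_one, mul_one, sub_zero] at h2
    calc ‖expAvg b' m F x‖ₑ = ∫⁻ u, ENNReal.ofReal (expTens b' m u) * ‖F (x - u)‖ₑ := rfl
      _ ≤ ∫⁻ u, ENNReal.ofReal (expTens b' m u) * eLpNormEssSup F (weighted w) :=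
          lintegral_mono_ae (h1.mono fun u hu => by gcongr)
      _ = (∫⁻ u, ENNReal.ofReal (expTens b' m u)) * eLpNormEssSup F (weighted w) :=
          lintegral_mul_const _ (continuous_expTens b' m).measurable.ennreal_ofReal
      _ ≤ _ := mul_le_mul_left h2 _
  have hp0 : p ≠ 0 := (one_pos.trans_le hp).ne'
  have hr : 0 < p.toReal := ENNReal.toReal_pos hp0 hpt
  have hr1 : 1 ≤ p.toReal := by
    have := ENNReal.toReal_mono hpt hp
    simpa using this
  set r := p.toReal with hrdef
  obtain ⟨K, hK⟩ := hw.bound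
  refine ⟨K.toNNReal ^ (1 / r) * ((2 / (b' - c / r)) ^ d).toNNReal, fun m F hF => ?_⟩
  set Q : (Fin d → ℝ) → ℝ≥0∞ := fun u => ENNReal.ofReal (expTens b' m u) with hQ
  have hQm : Measurable Q := (continuous_expTens b' m).measurable.ennreal_ofReal
  have hl : Measurable (l1Norm : (Fin d → ℝ) → ℝ) := by
    unfold l1Norm
    fun_prop
  have hmain := lintegral_avg_rpow_mul_le (Q := Q) (g := fun x => ‖F x‖ₑ)
    (v := fun x => ENNReal.ofReal (w x)) (e := fun u => ENNReal.ofReal (Real.exp (c / r * l1Norm u)))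
    (e' := fun u => ENNReal.ofReal (Real.exp (-(c / r * l1Norm u)))) hQm hF.measurable.enorm
    hw.aemeasurable (by fun_prop) (by fun_prop) (fun u => by
      rw [← ENNReal.ofReal_mul (Real.exp_pos _).le, ← Real.exp_add, add_neg_cancel, Real.exp_zero,
        ENNReal.ofReal_one]) hr1 (D := ENNReal.ofReal K) (fun x u => by
      rw [ENNReal.ofReal_rpow_of_pos (Real.exp_pos _), ← Real.exp_mul, mul_right_comm,
        div_mul_cancel₀ _ hr.ne', ← ENNReal.ofReal_mul (hw.pos _).le]
      have h1 := hK x u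
      have h2 : 0 < w (x - u) * Real.exp (c * l1Norm u) := mul_pos (hw.pos _) (Real.exp_pos _)
      rw [← ENNReal.ofReal_mul' h2.le]
      exact ENNReal.ofReal_le_ofReal h1)
  have hden : ∀ g : (Fin d → ℝ) → ℝ≥0∞, ∫⁻ x, g x ∂(weighted w) = ∫⁻ x, ENNReal.ofReal (w x) * g x :=
    fun g => lintegral_withDensity_eq_lintegral_mul_non_measurable₀ _ hw.aemeasurable
      (Eventually.of_forall fun x => ENNReal.ofReal_lt_top) g
  rw [eLpNorm_eq_lintegral_rpow_enorm_toReal hp0 hpt, eLpNorm_eq_lintegral_rpow_enorm_toReal hp0 hpt,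
    hden, hden, ← hrdef]
  have hinv : 0 ≤ 1 / r := by positivity
  refine (ENNReal.rpow_le_rpow hmain hinv).trans ?_
  rw [ENNReal.mul_rpow_of_nonneg _ _ hinv, ENNReal.mul_rpow_of_nonneg _ _ hinv, ← ENNReal.rpow_mul,
    mul_one_div_cancel hr.ne', ENNReal.rpow_one, ENNReal.coe_mul, ENNReal.coe_rpow_of_nonneg _ hinv]
  gcongr ?_ * ?_ * _
  · exact le_rfl
  · exact lintegral_expTens_le (by positivity) hcb' m

/-! ### Discrete estimates -/

theorem tsum_pow_dist_le (θ : ℝ≥0∞) (j : ℕ) :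
    ∑' k, θ ^ ((j - k) + (k - j)) ≤ 2 * (1 - θ)⁻¹ := by
  have h0 := Summable.sum_add_tsum_nat_add' (f := fun k => θ ^ ((j - k) + (k - j))) (k := j)
    ENNReal.summable
  rw [← h0, two_mul]
  refine add_le_add ?_ (le_of_eq ?_)
  · rw [← Finset.sum_range_reflect, ← ENNReal.tsum_geometric]
    have h1 : ∀ k ∈ Finset.range j, θ ^ ((j - (j - 1 - k)) + (j - 1 - k - j)) = θ ^ (k + 1) := by
      intro k hk
      have := Finset.mem_range.1 hk
      congr 1
      omega
    rw [Finset.sum_congr rfl h1]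
    exact (ENNReal.sum_le_tsum _).trans
      (ENNReal.tsum_comp_le_tsum_of_injective (add_left_injective 1) fun k => θ ^ k)
  · rw [← ENNReal.tsum_geometric]
    refine tsum_congr fun k => ?_
    congr 1
    omega

theorem tsum_prod_le {d : ℕ} (g : Fin d → ℕ → ℝ≥0∞) :
    ∑' k : Fin d → ℕ, ∏ i, g i (k i) ≤ ∏ i, ∑' l, g i l := by
  rw [ENNReal.tsum_eq_iSup_sum]
  refine iSup_le fun s => ?_
  have hs : s ⊆ Fintype.piFinset fun i => s.image fun k => k i := fun k hk =>
    Fintype.mem_piFinset.2 fun i => Finset.mem_image_of_mem _ hk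
  refine (Finset.sum_le_sum_of_subset hs).trans ?_
  rw [← Finset.prod_univ_sum]
  exact Finset.prod_le_prod' fun i _ => ENNReal.sum_le_tsum _

/-- Schur's test for sums. -/
theorem tsum_schur_le {κ : Type*} [Countable κ] {T : κ → κ → ℝ≥0∞} {M : ℝ≥0∞}
    (h1 : ∀ j, ∑' k, T j k ≤ M) (h2 : ∀ k, ∑' j, T j k ≤ M) (a : κ → ℝ≥0∞) {q : ℝ} (hq : 1 ≤ q) :
    ∑' j, (∑' k, T j k * a k) ^ q ≤ M ^ q * ∑' k, a k ^ q := by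
  let _ : MeasurableSpace κ := ⊤
  -- Jensen's inequality for the counting measure with the $j$-th row of $T$ as weight; the column
  -- sums enter after the order of summation is exchanged.
  have hj : ∀ j, (∑' k, T j k * a k) ^ q ≤ M ^ (q - 1) * ∑' k, T j k * a k ^ q := by
    intro j
    have := lintegral_mul_rpow_le (μ := Measure.count) (k := T j) (g := a)
      measurable_from_top.aemeasurable measurable_from_top.aemeasurable hq
    simp only [lintegral_count] at this
    refine this.trans (mul_le_mul_left (ENNReal.rpow_le_rpow (h1 j) (by linarith)) _)
  calc ∑' j, (∑' k, T j k * a k) ^ q ≤ ∑' j, M ^ (q - 1) * ∑' k, T j k * a k ^ q :=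
        ENNReal.tsum_le_tsum hj
    _ = M ^ (q - 1) * ∑' k, (∑' j, T j k) * a k ^ q := by
        rw [ENNReal.tsum_mul_left, ENNReal.tsum_comm]
        simp only [ENNReal.tsum_mul_right]
    _ ≤ M ^ (q - 1) * ∑' k, M * a k ^ q := by
        refine mul_le_mul_right (ENNReal.tsum_le_tsum fun k => ?_) _
        exact mul_le_mul_left (h2 k) _
    _ = M ^ (q - 1) * M ^ (1 : ℝ) * ∑' k, a k ^ q := by
        rw [ENNReal.tsum_mul_left, ENNReal.rpow_one, mul_assoc]
    _ = _ := by
        rw [← ENNReal.rpow_add_of_nonneg _ _ (by linarith) zero_le_one, sub_add_cancel]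

theorem smoothSum_eq {d : ℕ} {q : ℝ≥0∞} (hq : q ≠ ⊤) (δ : Seminorm ℝ (Fin d → ℝ))
    (A : (Fin d → ℕ) → ℝ≥0∞) : smoothSum q δ A =
      (∑' j, (ENNReal.ofReal ((2 : ℝ) ^ δ (toReal j)) * A j) ^ q.toReal) ^ (1 / q.toReal) := by
  rw [smoothSum, if_neg hq]
  congr 1
  refine tsum_congr fun j => ?_
  rw [ENNReal.mul_rpow_of_nonneg _ _ ENNReal.toReal_nonneg, ENNReal.ofReal_rpow_of_pos (by positivity),
    ← Real.rpow_mul (by norm_num), mul_comm (δ _)]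

theorem smoothSum_le {d : ℕ} {q : ℝ≥0∞} (hq : 1 ≤ q) (δ : Seminorm ℝ (Fin d → ℝ))
    {A B : (Fin d → ℕ) → ℝ≥0∞} {T : (Fin d → ℕ) → (Fin d → ℕ) → ℝ≥0∞} {M : ℝ≥0∞}
    (h1 : ∀ j, ∑' k, T j k ≤ M) (h2 : ∀ k, ∑' j, T j k ≤ M)
    (h : ∀ j, ENNReal.ofReal ((2 : ℝ) ^ δ (toReal j)) * B j ≤
      ∑' k, T j k * (ENNReal.ofReal ((2 : ℝ) ^ δ (toReal k)) * A k)) :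
    smoothSum q δ B ≤ M * smoothSum q δ A := by
  rcases eq_or_ne q ⊤ with rfl | hqt
  · simp only [smoothSum, if_true]
    refine iSup_le fun j => (h j).trans ?_
    calc ∑' k, T j k * (ENNReal.ofReal ((2 : ℝ) ^ δ (toReal k)) * A k)
        ≤ ∑' k, T j k * ⨆ k, ENNReal.ofReal ((2 : ℝ) ^ δ (toReal k)) * A k :=
          ENNReal.tsum_le_tsum fun k => mul_le_mul_right
            (le_iSup (fun k => ENNReal.ofReal ((2 : ℝ) ^ δ (toReal k)) * A k) k) _
      _ = (∑' k, T j k) * ⨆ k, ENNReal.ofReal ((2 : ℝ) ^ δ (toReal k)) * A k := ENNReal.tsum_mul_right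
      _ ≤ _ := mul_le_mul_left (h1 j) _
  · have hr1 : 1 ≤ q.toReal := by
      have := ENNReal.toReal_mono hqt hq
      simpa using this
    have hr : 0 < q.toReal := by linarith
    rw [smoothSum_eq hqt, smoothSum_eq hqt]
    have h3 : ∑' j, (ENNReal.ofReal ((2 : ℝ) ^ δ (toReal j)) * B j) ^ q.toReal ≤
        M ^ q.toReal * ∑' k, (ENNReal.ofReal ((2 : ℝ) ^ δ (toReal k)) * A k) ^ q.toReal :=
      (ENNReal.tsum_le_tsum fun j => ENNReal.rpow_le_rpow (h j) hr.le).trans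
        (tsum_schur_le h1 h2 _ hr1)
    refine (ENNReal.rpow_le_rpow h3 (by positivity)).trans (le_of_eq ?_)
    rw [ENNReal.mul_rpow_of_nonneg _ _ (by positivity), ← ENNReal.rpow_mul,
      mul_one_div_cancel hr.ne', ENNReal.rpow_one]

theorem seminorm_le_sum {d : ℕ} (δ : Seminorm ℝ (Fin d → ℝ)) (x : Fin d → ℝ) :
    δ x ≤ ∑ i, δ (Pi.single i 1) * |x i| := by
  have e : x = ∑ i, x i • (Pi.single i 1 : Fin d → ℝ) := pi_eq_sum_univ' x
  conv_lhs => rw [e]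
  refine (Finset.le_sum_of_subadditive δ (map_zero δ).le (map_add_le_add δ) _ _).trans
    (le_of_eq (Finset.sum_congr rfl fun i _ => ?_))
  rw [map_smul_eq_mul, Real.norm_eq_abs, mul_comm]

theorem seminorm_toReal_le {d : ℕ} (δ : Seminorm ℝ (Fin d → ℝ)) (j k : Fin d → ℕ) :
    δ (toReal j) ≤ δ (toReal k) +
      ∑ i, δ (Pi.single i 1) * (((j i - k i) + (k i - j i) : ℕ) : ℝ) := by
  have h1 : δ (toReal j) ≤ δ (toReal k) + δ (toReal j - toReal k) := by
    have := map_add_le_add δ (toReal k) (toReal j - toReal k)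
    rwa [add_sub_cancel] at this
  refine h1.trans (add_le_add_right ((seminorm_le_sum δ _).trans (le_of_eq ?_)) _)
  refine Finset.sum_congr rfl fun i _ => ?_
  congr 1
  simp only [Pi.sub_apply, toReal]
  rcases le_total (j i) (k i) with h | h
  · have : (j i : ℝ) ≤ k i := by exact_mod_cast h
    rw [abs_of_nonpos (by linarith), Nat.sub_eq_zero_of_le h, zero_add, Nat.cast_sub h]
    ring
  · have : (k i : ℝ) ≤ j i := by exact_mod_cast h
    rw [abs_of_nonneg (by linarith), Nat.sub_eq_zero_of_le h, add_zero, Nat.cast_sub h]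

/-- By subadditivity of $\delta$ the unit vectors are the decisive case: $\delta(e_i)<L$ gives a
geometric gain in each coordinate. -/
theorem seminorm_single_lt {d : ℕ} {δ : Seminorm ℝ (Fin d → ℝ)} {L : ℕ}
    (hL : ∀ j : Fin d → ℕ, j ≠ 0 → δ (toReal j) < L * l1Norm (toReal j)) (i : Fin d) :
    δ (Pi.single i 1) < L := by
  have h := hL (Pi.single i 1) (by simp)
  have e : toReal (Pi.single i 1 : Fin d → ℕ) = Pi.single i 1 := by
    funext l
    by_cases hl : l = i
    · subst hl
      simp [toReal]
    · simp [toReal, hl]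
  have e2 : l1Norm (Pi.single i 1 : Fin d → ℝ) = 1 := by
    unfold l1Norm
    rw [Finset.sum_eq_single i (fun l _ hl => by simp [hl]) (by simp)]
    simp
  rwa [e, e2, mul_one] at h

theorem two_rpow_seminorm_mul_le {d : ℕ} (δ : Seminorm ℝ (Fin d → ℝ)) (L : ℕ) (j k : Fin d → ℕ) :
    (2 : ℝ) ^ δ (toReal j) * ∏ i, (((2 : ℝ) ^ L) ^ ((j i - k i) + (k i - j i)))⁻¹ ≤
      (∏ i, ((2 : ℝ) ^ (δ (Pi.single i 1) - L)) ^ ((j i - k i) + (k i - j i))) *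
        (2 : ℝ) ^ δ (toReal k) := by
  have h := Real.rpow_le_rpow_of_exponent_le (x := 2) (by norm_num) (seminorm_toReal_le δ j k)
  rw [Real.rpow_add (by norm_num), Real.rpow_sum_of_pos (by norm_num)] at h
  refine (mul_le_mul_of_nonneg_right h (Finset.prod_nonneg fun i _ => by positivity)).trans
    (le_of_eq ?_)
  rw [mul_assoc, ← Finset.prod_mul_distrib, mul_comm]
  congr 1
  refine Finset.prod_congr rfl fun i _ => ?_
  rw [Real.rpow_sub (by norm_num), Real.rpow_natCast, div_pow, Real.rpow_mul (by norm_num),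
    Real.rpow_natCast, div_eq_mul_inv]

/-! ### The main estimate -/

/-- The constant is chosen before $F$, $G$ and $K$, with only the kernel constants $C_i$ fixed; this
makes the final bound independent of $f$. -/
theorem exists_peetreMax_smoothSum_le {d : ℕ} {p q : ℝ≥0∞} (hp : 1 ≤ p) (hq : 1 ≤ q)
    {w : (Fin d → ℝ) → ℝ} {c : ℝ} (hw : IsExpWeight w c) (δ : Seminorm ℝ (Fin d → ℝ)) {L : ℕ}
    (hL : ∀ j : Fin d → ℕ, j ≠ 0 → δ (toReal j) < L * l1Norm (toReal j)) {b' : ℝ} (hb' : 0 < b')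
    (hcb' : c / p.toReal < b') (C : Fin d → ℝ) (hC : ∀ i, 0 ≤ C i) :
    ∃ D : ℝ≥0, ∀ (F G : (Fin d → ℕ) → (Fin d → ℝ) → ℂ) (K : Fin d → ℕ → ℕ → ℝ → ℂ),
      (∀ k, Continuous (G k)) →
      (∀ i j k x, ‖K i j k x‖ ≤
        C i * (((2 : ℝ) ^ L) ^ ((j - k) + (k - j)))⁻¹ * expKer b' (min j (k - 1)) x) →
      (∀ j x, ‖F j x‖ₑ ≤ ∑' k : Fin d → ℕ,
        ∫⁻ z, ‖tens (fun i => K i (j i) (k i)) z‖ₑ * ‖G k (x - z)‖ₑ) →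
      smoothSum q δ (fun j => eLpNorm (peetreMax b' j (F j)) p (weighted w)) ≤
        D * smoothSum q δ (fun j => eLpNorm (G j) p (weighted w)) := by
  obtain ⟨D, hD⟩ := exists_eLpNorm_expAvg_le hp hw hb' hcb'
  -- A step in coordinate $i$ costs at most $2^{\delta(e_i)}$ in the smoothness factor and gains
  -- $2^{-L}$ from the kernel; the ratio is $\theta_i<1$.
  set θ : Fin d → ℝ := fun i => (2 : ℝ) ^ (δ (Pi.single i 1) - L) with hθ
  have hθ0 : ∀ i, 0 ≤ θ i := fun i => Real.rpow_nonneg (by norm_num) _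
  have hθ1 : ∀ i, ENNReal.ofReal (θ i) < 1 := fun i => by
    rw [ENNReal.ofReal_lt_one]
    exact Real.rpow_lt_one_of_one_lt_of_neg (by norm_num) (sub_neg.2 (seminorm_single_lt hL i))
  set M : ℝ≥0∞ := ∏ i, (2 * (1 - ENNReal.ofReal (θ i))⁻¹) with hM
  have hMt : M ≠ ⊤ := ENNReal.prod_ne_top fun i _ =>
    ENNReal.mul_ne_top (by norm_num) (ENNReal.inv_ne_top.2 (tsub_pos_of_lt (hθ1 i)).ne')
  set E : ℝ≥0∞ := ENNReal.ofReal (∏ i, C i) * D with hE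
  have hEt : E ≠ ⊤ := ENNReal.mul_ne_top ENNReal.ofReal_ne_top ENNReal.coe_ne_top
  set τ : (Fin d → ℕ) → (Fin d → ℕ) → ℝ≥0∞ := fun j k =>
    ∏ i, ENNReal.ofReal (θ i) ^ ((j i - k i) + (k i - j i)) with hτ
  have hτ1 : ∀ j, ∑' k, τ j k ≤ M := fun j =>
    (tsum_prod_le fun i l => ENNReal.ofReal (θ i) ^ ((j i - l) + (l - j i))).trans
      (Finset.prod_le_prod' fun i _ => tsum_pow_dist_le _ _)
  have hτs : ∀ j k, τ j k = τ k j := fun j k =>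
    Finset.prod_congr rfl fun i _ => by rw [add_comm]
  refine ⟨(E * M).toNNReal, fun F G K hG hK hF => ?_⟩
  rw [ENNReal.coe_toNNReal (ENNReal.mul_ne_top hEt hMt)]
  refine smoothSum_le hq δ (T := fun j k => E * τ j k) (fun j => ?_) (fun k => ?_) fun j => ?_
  · rw [ENNReal.tsum_mul_left]
    exact mul_le_mul_right (hτ1 j) _
  · rw [ENNReal.tsum_mul_left]
    simp_rw [hτs _ k]
    exact mul_le_mul_right (hτ1 k) _
  set R : (Fin d → ℕ) → ℝ := fun k => ∏ i, (((2 : ℝ) ^ L) ^ ((j i - k i) + (k i - j i)))⁻¹ with hR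
  have hR0 : ∀ k, 0 ≤ R k := fun k => Finset.prod_nonneg fun i _ => by positivity
  have h1 : eLpNorm (peetreMax b' j (F j)) p (weighted w) ≤
      ∑' k, ENNReal.ofReal ((∏ i, C i) * R k) * (D * eLpNorm (G k) p (weighted w)) := by
    have h2 := peetreMax_le_tsum hb'.le (j := j) (F := F j) (G := G)
      (K := fun k i => K i (j i) (k i)) (hF j)
      (c := fun k i => C i * (((2 : ℝ) ^ L) ^ ((j i - k i) + (k i - j i)))⁻¹)
      (m := fun k i => min (j i) (k i - 1)) (fun k i => mul_nonneg (hC i) (by positivity))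
      (fun k i => min_le_left _ _) fun k i x => hK i (j i) (k i) x
    simp only [Finset.prod_mul_distrib] at h2
    refine (eLpNorm_mono_enorm (g := fun x => ∑' k : Fin d → ℕ, ENNReal.ofReal ((∏ i, C i) * R k) *
      expAvg b' (fun i => min (j i) (k i - 1)) (G k) x) h2).trans ?_
    refine (eLpNorm_tsum_le (fun k => ((measurable_expAvg _ _ (hG k)).const_mul _).aemeasurable)
      hp).trans (ENNReal.tsum_le_tsum fun k => ?_)
    have h3 : eLpNorm (fun x => ENNReal.ofReal ((∏ i, C i) * R k) *
        expAvg b' (fun i => min (j i) (k i - 1)) (G k) x) p (weighted w) ≤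
        ENNReal.ofReal ((∏ i, C i) * R k) *
          eLpNorm (expAvg b' (fun i => min (j i) (k i - 1)) (G k)) p (weighted w) := by
      have h4 := eLpNorm_le_mul_eLpNorm_of_ae_le_mul'
        (f := fun x => ENNReal.ofReal ((∏ i, C i) * R k) *
          expAvg b' (fun i => min (j i) (k i - 1)) (G k) x)
        (g := expAvg b' (fun i => min (j i) (k i - 1)) (G k)) (μ := weighted w)
        (c := ((∏ i, C i) * R k).toNNReal) (Eventually.of_forall fun x => le_rfl) p
      exact h4
    exact h3.trans (mul_le_mul_right (hD _ _ (hG k)) _)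
  refine (mul_le_mul_right h1 _).trans ?_
  rw [← ENNReal.tsum_mul_left]
  refine ENNReal.tsum_le_tsum fun k => ?_
  have h5 : ENNReal.ofReal ((2 : ℝ) ^ δ (toReal j)) * ENNReal.ofReal (R k) ≤
      τ j k * ENNReal.ofReal ((2 : ℝ) ^ δ (toReal k)) := by
    have h6 := ENNReal.ofReal_le_ofReal (two_rpow_seminorm_mul_le δ L j k)
    rw [ENNReal.ofReal_mul (by positivity), ENNReal.ofReal_mul (Finset.prod_nonneg fun i _ =>
      pow_nonneg (hθ0 i) _), ENNReal.ofReal_prod_of_nonneg (fun i _ => pow_nonneg (hθ0 i) _)] at h6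
    refine h6.trans (le_of_eq ?_)
    congr 1
    exact Finset.prod_congr rfl fun i _ => ENNReal.ofReal_pow (hθ0 i) _
  rw [ENNReal.ofReal_mul (Finset.prod_nonneg fun i _ => hC i)]
  calc ENNReal.ofReal ((2 : ℝ) ^ δ (toReal j)) *
        (ENNReal.ofReal (∏ i, C i) * ENNReal.ofReal (R k) * (D * eLpNorm (G k) p (weighted w)))
      = (ENNReal.ofReal ((2 : ℝ) ^ δ (toReal j)) * ENNReal.ofReal (R k)) *
        (E * eLpNorm (G k) p (weighted w)) := by ring
    _ ≤ (τ j k * ENNReal.ofReal ((2 : ℝ) ^ δ (toReal k))) * (E * eLpNorm (G k) p (weighted w)) :=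
        mul_le_mul_left h5 _
    _ = _ := by ring

end ExpBesov

/-- Here `c / p.toReal` is `0` for `p = ∞`. Both sides of the inequality are numbers of `[0, ∞]`. The
sum on the right is the quasi-norm that defines the exponentially weighted Besov space, computed
with the admissible system built from `φ₀`; `f` belongs to that space iff it is finite. -/
theorem mainTheorem6 {d : ℕ} (p q : ℝ≥0∞) (hp : 1 ≤ p) (hq : 1 ≤ q)
    (w : (Fin d → ℝ) → ℝ) (c : ℝ) (hw : ExpBesov.IsExpWeight w c)
    (δ : Seminorm ℝ (Fin d → ℝ)) (hδ : ∀ x, δ x = 0 → x = 0)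
    (L : ℕ) (hL : ∀ j : Fin d → ℕ, j ≠ 0 →
      δ (ExpBesov.toReal j) < L * ExpBesov.l1Norm (ExpBesov.toReal j))
    (b b' : ℝ) (hb' : 0 < b') (hcb' : c / p.toReal < b') (hb'b : b' < b)
    (ψ₀ ψ φ₀ : Fin d → ℝ → ℂ)
    (hψ₀ : ∀ i, ExpBesov.MemTestSpace1 b (L + 1) (ψ₀ i))
    (hψ : ∀ i, ExpBesov.MemTestSpace1 b (L + 1) (ψ i))
    (hφ₀ : ∀ i, ExpBesov.MemTestSpace1 b (L + 1) (φ₀ i))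
    (hφ₀_int : ∀ i, ∫ x, ∫ y, φ₀ i (x - y) * φ₀ i y = 1)
    (hψ_van : ∀ i, ExpBesov.FourierVanishes L (ψ i))
    (hφ_van : ∀ i, ExpBesov.FourierVanishes L (ExpBesov.dyadicDiff (φ₀ i))) :
    ∃ C : ℝ≥0, ∀ f : ExpBesov.DualSpace b (fun _ : Fin d => L + 1),
      ExpBesov.smoothSum q δ (fun j =>
          eLpNorm (ExpBesov.peetreMax b' j (ExpBesov.conv (ExpBesov.tensorSeq ψ₀ ψ j) f)) p
            (ExpBesov.weighted w)) ≤
        C * ExpBesov.smoothSum q δ (fun j =>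
          eLpNorm (ExpBesov.conv
              (ExpBesov.tensorSeq φ₀ (fun i => ExpBesov.dyadicDiff (φ₀ i)) j) f) p
            (ExpBesov.weighted w)) := by
  have hb : 0 < b := hb'.trans hb'b
  choose C Ψ F S K hR hΨ hF using fun i => ExpBesov.exists_repSystem hb' hb'b (hψ₀ i) (hψ i)
    (hφ₀ i) (hφ₀_int i) (hψ_van i) (hφ_van i)
  obtain ⟨D, hD⟩ := ExpBesov.exists_peetreMax_smoothSum_le hp hq hw δ hL hb' hcb' C
    fun i => (hR i).const_nonneg
  refine ⟨D, fun f => ?_⟩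
  -- From here on $f$ is replaced by its coefficient family, and both kinds of convolutions are
  -- `reprConv` of the chains.
  obtain ⟨a, ha, hconv⟩ := f.exists_conv_eq hb.le
  have e1 : ∀ j : Fin d → ℕ, ExpBesov.conv (ExpBesov.tensorSeq ψ₀ ψ j) f =
      ExpBesov.reprConv b (L + 1) a fun i => Ψ i (j i) := fun j =>
    hconv (fun i => ExpBesov.dyadicSeq (ψ₀ i) (ψ i) (j i)) _ (fun i => (hR i).chain_left (j i))
      (fun i => (hR i).memW_left (j i)) fun i => hΨ i (j i)
  have e2 : ∀ k : Fin d → ℕ,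
      ExpBesov.conv (ExpBesov.tensorSeq φ₀ (fun i => ExpBesov.dyadicDiff (φ₀ i)) k) f =
        ExpBesov.reprConv b (L + 1) a fun i => F i (k i) := fun k =>
    hconv (fun i => ExpBesov.dyadicSeq (φ₀ i) (ExpBesov.dyadicDiff (φ₀ i)) (k i)) _
      (fun i => (hR i).chain_right (k i)) (fun i => (hR i).memW_right (k i)) fun i => hF i (k i)
  simp only [e1, e2]
  exact hD _ _ K (fun k => ExpBesov.continuous_reprConv hb.le ha fun i => (hR i).memW_right (k i))
    (fun i => (hR i).kernel_le) fun j => ExpBesov.enorm_reprConv_le hb ha hR j
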